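/- **Lemma 2.1.** Let $n \ge k \ge 1$. Let $\mathrm{Diff}_\partial(D^k)$ be the group, with the $C^\infty$-topology, of diffeomorphisms of the closed disk $D^k\subset\mathbb R^k$ relative to the boundary (i.e. those whose extension by the identity to $\mathbb R^k$ is smooth), and let $$d_*\colon \pi_{n-k}\mathrm{Diff}_\partial(D^k)\to \pi_n SO_k$$ be the map induced by the derivative: if a family $(g_s)_{s}$, $s\in (D^{n-k},\partial D^{n-k})$, represents $x$, then $d_*(x)$ is represented by $(s,y)\mapsto D_y g_s\in GL_k^+(\mathbb R)\simeq SO_k$ on $(D^{n-k}\times D^k)/\partial\cong S^n$. Let $A\colon \pi_{n-k}\mathrm{Diff}_\partial(D^k)\xrightarrow{\ \lambda\ }\pi_0\mathrm{Diff}_\partial(D^n)\xrightarrow{\ C\ }\Theta_{n+1}$ be Gromoll's map. Here $\lambda$ sends the class of a smooth family $\psi=(\psi_s)$ to the class of the diffeomorphism $\Psi(s,y)=(s,\psi_s(y))$ of $D^{n-k}\times D^k\cong D^n$ (every class $x$ has such a smooth representative). The map $C$ extends $\Psi$ by the identity to a diffeomorphism $\varphi$ of $S^n\supset D^n$ and sends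 it to the homotopy sphere $D^{n+1}\cup_\varphi D^{n+1}$. Then for every $x\in\pi_{n-k}\mathrm{Diff}_\partial(D^k)$, the homotopy sphere $\Sigma=A(x)$ admits a smooth embedding into $\mathbb R^{n+k+1}$ whose normal bundle $\nu$ is classified, up to sign, by $d_*(x)\in\pi_n SO_k\cong\pi_{n+1}BSO_k$. That is, for some homotopy equivalence $h\colon S^{n+1}\to\Sigma$ (of degree $1$ or $-1$ with respect to a given orientation of $\Sigma$), the pull-back $h^*\nu$ is isomorphic to the vector bundle over $S^{n+1}=D^{n+1}_+\cup D^{n+1}_-$ obtained by clutching trivial bundles along a map $S^n\to SO_k$ representing $d_*(x)$. -/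

import Mathlib

open scoped ContDiff Manifold unitInterval Topology Topology.Homotopy ContinuousMap

noncomputable section

namespace DerivMap

/-- Euclidean space `ℝ^d`. -/
abbrev Euc (d : ℕ) : Type := EuclideanSpace ℝ (Fin d)

/-- The standard unit sphere `S^d ⊆ ℝ^{d+1}`. -/
abbrev Sph (d : ℕ) : Type := Metric.sphere (0 : EuclideanSpace ℝ (Fin (d + 1))) 1

/-- The special orthogonal group `SO_k`. -/
abbrev SO (k : ℕ) : Type := Matrix.specialOrthogonalGroup (Fin k) ℝ

/-- The columns of a matrix, as vectors of Euclidean space. -/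
def cols {k : ℕ} (A : Matrix (Fin k) (Fin k) ℝ) (j : Fin k) : Euc k :=
  WithLp.toLp 2 fun i => A i j

/-- The matrix obtained from `A` by applying the Gram-Schmidt process to its columns. -/
def gramSchmidtMatrix {k : ℕ} (A : Matrix (Fin k) (Fin k) ℝ) : Matrix (Fin k) (Fin k) ℝ :=
  Matrix.of fun i j => InnerProductSpace.gramSchmidtNormed ℝ (cols A) j i

lemma cols_linearIndependent {k : ℕ} {A : Matrix (Fin k) (Fin k) ℝ} (hA : 0 < A.det) :
    LinearIndependent ℝ (cols A) := by
  have h : LinearIndependent ℝ A.col :=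
    Matrix.linearIndependent_cols_iff_isUnit.mpr
      ((Matrix.isUnit_iff_isUnit_det A).mpr (isUnit_iff_ne_zero.mpr hA.ne'))
  exact h.map' (WithLp.linearEquiv 2 ℝ (Fin k → ℝ)).symm.toLinearMap (LinearEquiv.ker _)

lemma gramSchmidtMatrix_mem {k : ℕ} {A : Matrix (Fin k) (Fin k) ℝ} (hA : 0 < A.det) :
    gramSchmidtMatrix A ∈ Matrix.specialOrthogonalGroup (Fin k) ℝ := by
  have hli := cols_linearIndependent hA
  have hon := InnerProductSpace.gramSchmidtNormed_orthonormal (𝕜 := ℝ) hli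
  set Q := gramSchmidtMatrix A with hQ
  have hinner : ∀ x y : Euc k, inner ℝ x y = ∑ l, x l * y l := fun x y => by
    simp [PiLp.inner_apply, mul_comm]
  have hQQ : Q.transpose * Q = 1 := by
    ext i j
    have := (orthonormal_iff_ite.mp hon) i j
    rw [hinner] at this
    rw [Matrix.mul_apply, Matrix.one_apply, ← this]
    rfl
  have horth : Q ∈ Matrix.orthogonalGroup (Fin k) ℝ :=
    (Matrix.mem_orthogonalGroup_iff' _ _).mpr hQQ
  refine Matrix.mem_specialOrthogonalGroup_iff.mpr ⟨horth, ?_⟩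
  have htri : (Q.transpose * A).det = ∏ i, (Q.transpose * A) i i := by
    apply Matrix.det_of_isUpperTriangular
    intro i j hij
    have h0 := InnerProductSpace.gramSchmidt_inv_triangular ℝ (cols A) (i := j) (j := i) hij
    have : inner ℝ (InnerProductSpace.gramSchmidtNormed ℝ (cols A) i) (cols A j) = 0 := by
      rw [InnerProductSpace.gramSchmidtNormed, inner_smul_left, h0, mul_zero]
    rw [hinner] at this
    exact this
  have hpos : ∀ i, 0 < (Q.transpose * A) i i := by
    intro i
    have hne := InnerProductSpace.gramSchmidt_ne_zero (𝕜 := ℝ) i hli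
    have h1 : inner ℝ (InnerProductSpace.gramSchmidt ℝ (cols A) i) (cols A i)
        = ‖InnerProductSpace.gramSchmidt ℝ (cols A) i‖ ^ 2 := by
      conv_lhs => rw [InnerProductSpace.gramSchmidt_def'' ℝ (cols A) i]
      rw [inner_add_right, inner_sum, Finset.sum_eq_zero, add_zero,
        real_inner_self_eq_norm_sq]
      intro l hl
      rw [inner_smul_right,
        InnerProductSpace.gramSchmidt_orthogonal ℝ (cols A) (Finset.mem_Iio.mp hl).ne', mul_zero]
    have h2 : 0 < inner ℝ (InnerProductSpace.gramSchmidtNormed ℝ (cols A) i) (cols A i) := by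
      rw [InnerProductSpace.gramSchmidtNormed, inner_smul_left, h1]
      have := norm_pos_iff.mpr hne
      simp only [RCLike.ofReal_real_eq_id, id_eq, conj_trivial]
      positivity
    rw [hinner] at h2
    exact h2
  have hQA : 0 < Q.det * A.det := by
    rw [← Matrix.det_transpose Q, ← Matrix.det_mul, htri]
    exact Finset.prod_pos fun i _ => hpos i
  have hQpos : 0 < Q.det := (pos_iff_pos_of_mul_pos hQA).mpr hA
  have hsq : Q.det * Q.det = 1 := by
    have := congrArg Matrix.det hQQ
    rwa [Matrix.det_mul, Matrix.det_transpose, Matrix.det_one] at this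
  nlinarith

lemma continuousOn_gramSchmidtMatrix (k : ℕ) :
    ContinuousOn (gramSchmidtMatrix (k := k)) {A | 0 < A.det} := by
  have hc : ∀ j, Continuous fun A : Matrix (Fin k) (Fin k) ℝ => cols A j := fun j => by
    unfold cols; fun_prop
  have hgs : ∀ j : Fin k, ContinuousOn
      (fun A : Matrix (Fin k) (Fin k) ℝ => InnerProductSpace.gramSchmidt ℝ (cols A) j)
      {A | 0 < A.det} := by
    intro j
    induction j using WellFoundedLT.induction with
    | ind j ih =>
      have : (fun A : Matrix (Fin k) (Fin k) ℝ => InnerProductSpace.gramSchmidt ℝ (cols A) j)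
          = fun A => cols A j - ∑ i ∈ Finset.Iio j,
            (inner ℝ (InnerProductSpace.gramSchmidt ℝ (cols A) i) (cols A j)
              / ‖InnerProductSpace.gramSchmidt ℝ (cols A) i‖ ^ 2)
              • InnerProductSpace.gramSchmidt ℝ (cols A) i := by
        funext A
        rw [InnerProductSpace.gramSchmidt_def ℝ (cols A) j]
        simp [Submodule.starProjection_singleton]
      rw [this]
      refine (hc j).continuousOn.sub (continuousOn_finsetSum _ fun i hi => ?_)
      have hi' := ih i (Finset.mem_Iio.mp hi)
      refine ContinuousOn.smul (ContinuousOn.div (hi'.inner (𝕜 := ℝ) (hc j).continuousOn)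
        (hi'.norm.pow 2) fun A hA => ?_) hi'
      exact pow_ne_zero _ (norm_ne_zero_iff.mpr
        (InnerProductSpace.gramSchmidt_ne_zero i (cols_linearIndependent hA)))
  refine continuousOn_pi.mpr fun i => continuousOn_pi.mpr fun j => ?_
  have h := hgs j
  have hn : ContinuousOn (fun A : Matrix (Fin k) (Fin k) ℝ =>
      InnerProductSpace.gramSchmidtNormed ℝ (cols A) j) {A | 0 < A.det} := by
    unfold InnerProductSpace.gramSchmidtNormed
    have hinv : ContinuousOn (fun A : Matrix (Fin k) (Fin k) ℝ =>
        ((‖InnerProductSpace.gramSchmidt ℝ (cols A) j‖ : ℝ))⁻¹) {A | 0 < A.det} := by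
      refine ContinuousOn.inv₀ h.norm fun A hA => ?_
      exact norm_ne_zero_iff.mpr
        (InnerProductSpace.gramSchmidt_ne_zero j (cols_linearIndependent hA))
    exact hinv.smul h
  exact (PiLp.continuous_apply 2 (fun _ : Fin k => ℝ) i).comp_continuousOn hn

lemma gramSchmidtMatrix_one (k : ℕ) : gramSchmidtMatrix (1 : Matrix (Fin k) (Fin k) ℝ) = 1 := by
  have hcol : cols (1 : Matrix (Fin k) (Fin k) ℝ) = fun j => EuclideanSpace.single j (1 : ℝ) := by
    funext j
    ext i
    simp [cols, Matrix.one_apply]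
  have horth : Pairwise fun i j : Fin k => inner ℝ (EuclideanSpace.single i (1 : ℝ))
      (EuclideanSpace.single j (1 : ℝ)) = 0 := fun i j hij => by
    simp [EuclideanSpace.inner_single_left, hij]
  ext i j
  simp only [gramSchmidtMatrix, Matrix.of_apply, InnerProductSpace.gramSchmidtNormed, hcol]
  rw [InnerProductSpace.gramSchmidt_of_orthogonal ℝ horth]
  simp [Matrix.one_apply]


/-- The group `Diff_∂(D^k)` (as a set): diffeomorphisms of the closed unit disk `D^k ⊆ ℝ^k` relative
to the boundary. An element is a diffeomorphism of `D^k` whose extension by the identity to `ℝ^k`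
is smooth (it agrees with the identity to infinite order along `∂D^k`); we record this extension. -/
structure DiffDisk (k : ℕ) where
  toDiffeo : Euc k ≃ₘ^∞⟮𝓘(ℝ, Euc k), 𝓘(ℝ, Euc k)⟯ Euc k
  eq_of_one_le : ∀ y, 1 ≤ ‖y‖ → toDiffeo y = y

namespace DiffDisk

variable {k : ℕ}

instance : CoeFun (DiffDisk k) fun _ => Euc k → Euc k := ⟨fun f => f.toDiffeo⟩

/-- The identity of `D^k`, the base point of `Diff_∂(D^k)`. -/
def id (k : ℕ) : DiffDisk k := ⟨Diffeomorph.refl _ _ _, fun _ _ => rfl⟩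

lemma contDiff (f : DiffDisk k) : ContDiff ℝ ∞ f := f.toDiffeo.contMDiff_toFun.contDiff

/-- The `i`-th total derivative of a diffeomorphism of the disk, as a continuous map. -/
def iterDeriv (i : ℕ) (f : DiffDisk k) : C(Euc k, Euc k [×i]→L[ℝ] Euc k) :=
  ⟨iteratedFDeriv ℝ i f, f.contDiff.continuous_iteratedFDeriv (by exact_mod_cast le_top)⟩

/-- The `C^∞`-topology on `Diff_∂(D^k)`: uniform convergence of all derivatives (on compact sets
of `ℝ^k`, or equivalently on `D^k`). -/
instance : TopologicalSpace (DiffDisk k) :=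
  ⨅ i : ℕ, TopologicalSpace.induced (iterDeriv i) inferInstance

lemma continuous_iterDeriv (i : ℕ) : Continuous (iterDeriv (k := k) i) :=
  continuous_iInf_dom (i := i) continuous_induced_dom

/-- The Jacobian matrix of a diffeomorphism `f` of the disk at the point `y`. -/
def jacobian (f : DiffDisk k) (y : Euc k) : Matrix (Fin k) (Fin k) ℝ :=
  Matrix.of fun i j => fderiv ℝ f y (EuclideanSpace.single j 1) i

lemma continuous_jacobian : Continuous fun p : DiffDisk k × Euc k => p.1.jacobian p.2 := by
  refine continuous_pi fun i => continuous_pi fun j => ?_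
  have h : (fun p : DiffDisk k × Euc k => p.1.jacobian p.2 i j) = fun p =>
      (iterDeriv 1 p.1 p.2 (fun _ => EuclideanSpace.single j 1)) i := by
    funext p
    simp [jacobian, iterDeriv]
  rw [h]
  have h1 : Continuous fun p : DiffDisk k × Euc k => iterDeriv 1 p.1 p.2 :=
    ((continuous_iterDeriv 1).comp continuous_fst).eval continuous_snd
  have h2 : Continuous fun p : DiffDisk k × Euc k =>
      iterDeriv 1 p.1 p.2 (fun _ => EuclideanSpace.single j 1) :=
    h1.eval_const _
  exact (PiLp.continuous_apply 2 (fun _ : Fin k => ℝ) i).comp h2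

lemma jacobian_eq_one (f : DiffDisk k) {y : Euc k} (hy : 1 ≤ ‖y‖) :
    f.jacobian y = 1 := by
  have hopen : ∀ z : Euc k, 1 < ‖z‖ → f.jacobian z = 1 := by
    intro z hz
    have he : (f : Euc k → Euc k) =ᶠ[𝓝 z] _root_.id := by
      filter_upwards [(isOpen_lt continuous_const continuous_norm).mem_nhds hz] with w hw
      exact f.eq_of_one_le w (le_of_lt hw)
    ext i j
    simp [jacobian, he.fderiv_eq, Matrix.one_apply]
  have hcl : y ∈ closure {z : Euc k | 1 < ‖z‖} := by
    have : Filter.Tendsto (fun t : ℝ => t • y) (𝓝[>] 1) (𝓝 y) := by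
      have : ContinuousAt (fun t : ℝ => t • y) 1 := by fun_prop
      have := this.tendsto
      rw [one_smul] at this
      exact this.mono_left nhdsWithin_le_nhds
    refine mem_closure_of_tendsto this ?_
    filter_upwards [self_mem_nhdsWithin] with t ht
    have ht' : (1 : ℝ) < t := ht
    change 1 < ‖t • y‖
    rw [norm_smul, Real.norm_eq_abs, abs_of_pos (by linarith : 0 < t)]
    nlinarith
  have hc : IsClosed {z : Euc k | f.jacobian z = 1} :=
    isClosed_eq (continuous_jacobian.comp (by fun_prop : Continuous fun z : Euc k => (f, z)))
      continuous_const
  exact hc.closure_subset_iff.mpr hopen hcl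

lemma jacobian_det_pos (f : DiffDisk k) (y : Euc k) : 0 < (f.jacobian y).det := by
  rcases Nat.eq_zero_or_pos k with rfl | hk
  · simp
  have hne : ∀ z, (f.jacobian z).det ≠ 0 := by
    intro z
    have hd : DifferentiableAt ℝ f z := (f.contDiff.differentiable (by simp)) z
    have hs : ContDiff ℝ ∞ f.toDiffeo.symm := f.toDiffeo.symm.contMDiff_toFun.contDiff
    have hds : DifferentiableAt ℝ f.toDiffeo.symm (f z) := (hs.differentiable (by simp)) _
    have hcomp : (fderiv ℝ f.toDiffeo.symm (f z)).comp (fderiv ℝ f z)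
        = ContinuousLinearMap.id ℝ (Euc k) := by
      rw [← fderiv_comp z hds hd]
      have : (f.toDiffeo.symm ∘ f : Euc k → Euc k) = _root_.id := by
        funext w; simp
      rw [this, fderiv_id]
    have hJ : f.jacobian z = LinearMap.toMatrix (EuclideanSpace.basisFun (Fin k) ℝ).toBasis
        (EuclideanSpace.basisFun (Fin k) ℝ).toBasis (fderiv ℝ f z).toLinearMap := by
      ext i j
      simp [jacobian, LinearMap.toMatrix_apply]
    rw [hJ, LinearMap.det_toMatrix]
    intro h0
    have := congrArg (fun L : Euc k →L[ℝ] Euc k => LinearMap.det L.toLinearMap) hcomp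
    simp only [ContinuousLinearMap.toLinearMap_comp, LinearMap.det_comp, h0, mul_zero] at this
    simp at this
  have hcont : Continuous fun z => (f.jacobian z).det :=
    (continuous_jacobian.comp (by fun_prop : Continuous fun z : Euc k => (f, z))).matrix_det
  by_contra hneg
  have hlt : (f.jacobian y).det < 0 := lt_of_le_of_ne (not_lt.mp hneg) (hne y)
  have hone : (f.jacobian (EuclideanSpace.single ⟨0, hk⟩ 1)).det = 1 := by
    rw [f.jacobian_eq_one (by simp), Matrix.det_one]
  obtain ⟨z, hz⟩ := mem_range_of_exists_le_of_exists_ge hcont ⟨y, hlt.le⟩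
    ⟨EuclideanSpace.single ⟨0, hk⟩ 1, by rw [hone]; exact zero_le_one⟩
  exact hne z hz

/-- The derivative map `(f, y) ↦ D_y f`, with values in `SO_k` through the Gram-Schmidt retraction
`GL_k^+(ℝ) → SO_k`, which is inverse to the inclusion up to homotopy. -/
def derivSO : C(DiffDisk k × Euc k, SO k) where
  toFun p := ⟨gramSchmidtMatrix (p.1.jacobian p.2), gramSchmidtMatrix_mem (jacobian_det_pos _ _)⟩
  continuous_toFun := Continuous.subtype_mk
    ((continuousOn_gramSchmidtMatrix k).comp_continuous continuous_jacobian
      fun p => jacobian_det_pos p.1 p.2) _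

lemma derivSO_eq_one (f : DiffDisk k) {y : Euc k} (hy : 1 ≤ ‖y‖) :
    derivSO (f, y) = 1 :=
  Subtype.ext (by
    change gramSchmidtMatrix (f.jacobian y) = 1
    rw [f.jacobian_eq_one hy, gramSchmidtMatrix_one])

lemma derivSO_id (y : Euc k) : derivSO (DiffDisk.id k, y) = 1 :=
  Subtype.ext (by
    change gramSchmidtMatrix ((DiffDisk.id k).jacobian y) = 1
    have : (DiffDisk.id k).jacobian y = 1 := by
      have h : ((DiffDisk.id k : DiffDisk k) : Euc k → Euc k) = _root_.id := rfl
      ext i j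
      simp [jacobian, h, Matrix.one_apply]
    rw [this, gramSchmidtMatrix_one])

end DiffDisk

/-- The affine identification of the unit cube `I^d` with the cube `[-1,1]^d ⊆ ℝ^d`, which contains
the disk `D^d`. -/
def box {d : ℕ} (s : Fin d → I) : Euc d := WithLp.toLp 2 fun i => 2 * (s i : ℝ) - 1

lemma continuous_box {d : ℕ} : Continuous (box (d := d)) := by
  unfold box; fun_prop

lemma one_le_norm_box {d : ℕ} {s : Fin d → I} (hs : s ∈ Cube.boundary (Fin d)) :
    1 ≤ ‖box s‖ := by
  obtain ⟨i, hi⟩ := hs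
  refine le_trans ?_ (PiLp.norm_apply_le (box s) i)
  rcases hi with hi | hi <;> norm_num [box, hi]

/-- The map `Ω^m Diff_∂(D^k) → Ω^{m+k} SO_k` induced by the derivative: the family `g` of
diffeomorphisms is sent to `(s, t) ↦ D_t g_s`, for `s ∈ I^m` and `t ∈ I^k ≅ [-1,1]^k ⊇ D^k` (the
derivative is the identity outside `D^k`). -/
def derivLoop {m k : ℕ} (g : Ω^ (Fin m) (DiffDisk k) (DiffDisk.id k)) :
    Ω^ (Fin (m + k)) (SO k) 1 :=
  ⟨⟨fun z => DiffDisk.derivSO (g (fun i => z (Fin.castAdd k i)), box fun j => z (Fin.natAdd m j)),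
    DiffDisk.derivSO.continuous.comp <|
      ((map_continuous g.1).comp (by fun_prop)).prodMk (continuous_box.comp (by fun_prop))⟩, by
    rintro z ⟨i, hi⟩
    induction i using Fin.addCases with
    | left i =>
      have : g (fun i => z (Fin.castAdd k i)) = DiffDisk.id k := g.2 _ ⟨i, hi⟩
      change DiffDisk.derivSO (g _, _) = 1
      rw [this]
      exact DiffDisk.derivSO_id _
    | right j => exact DiffDisk.derivSO_eq_one _ (one_le_norm_box ⟨j, hi⟩)⟩

lemma derivLoop_homotopic {m k : ℕ} {g g' : Ω^ (Fin m) (DiffDisk k) (DiffDisk.id k)}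
    (h : GenLoop.Homotopic g g') : GenLoop.Homotopic (derivLoop g) (derivLoop g') := by
  obtain ⟨H⟩ := h
  refine ⟨⟨⟨⟨fun p => DiffDisk.derivSO (H (p.1, fun i => p.2 (Fin.castAdd k i)),
    box fun j => p.2 (Fin.natAdd m j)), ?_⟩, fun z => ?_, fun z => ?_⟩, ?_⟩⟩
  · exact DiffDisk.derivSO.continuous.comp <|
      ((map_continuous H).comp (by fun_prop)).prodMk (continuous_box.comp (by fun_prop))
  · change DiffDisk.derivSO (H (0, _), _) = _
    rw [H.apply_zero]; rfl
  · change DiffDisk.derivSO (H (1, _), _) = _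
    rw [H.apply_one]; rfl
  · intro t z hz
    have hb : derivLoop g z = 1 := (derivLoop g).2 z hz
    refine Eq.trans ?_ hb.symm
    obtain ⟨i, hi⟩ := hz
    change DiffDisk.derivSO (H (t, _), _) = 1
    induction i using Fin.addCases with
    | left i =>
      have hm : (fun i => z (Fin.castAdd k i)) ∈ Cube.boundary (Fin m) := ⟨i, hi⟩
      rw [H.eq_fst t hm, show g.1 (fun i => z (Fin.castAdd k i)) = DiffDisk.id k from g.2 _ hm]
      exact DiffDisk.derivSO_id _
    | right j => exact DiffDisk.derivSO_eq_one _ (one_le_norm_box ⟨j, hi⟩)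

/-- The map `d_* : π_m Diff_∂(D^k) → π_{m+k} SO_k` induced by the derivative map. -/
def derivStar {m k : ℕ} : HomotopyGroup.Pi m (DiffDisk k) (DiffDisk.id k) →
    HomotopyGroup.Pi (m + k) (SO k) 1 :=
  Quotient.map derivLoop fun _ _ h => derivLoop_homotopic h

/-! ### Gromoll's map -/

/-- A homotopy `d`-sphere: a closed smooth manifold of dimension `d` that is homotopy equivalent
to `S^d`. -/
structure HomotopySphere (d : ℕ) where
  carrier : Type
  [topology : TopologicalSpace carrier]
  [charted : ChartedSpace (Euc d) carrier]
  [isManifold : IsManifold (𝓡 d) ∞ carrier]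
  [t2 : T2Space carrier]
  [compact : CompactSpace carrier]
  homotopyEquiv_sphere : Nonempty (Sph d ≃ₕ carrier)

attribute [instance] HomotopySphere.topology HomotopySphere.charted HomotopySphere.isManifold
  HomotopySphere.t2 HomotopySphere.compact

/-- The map `ψ : ℝ^m × ℝ^k → ℝ^k` is a smooth family of diffeomorphisms of `D^k` that represents
the loop `g` in `Diff_∂(D^k)`: we have `ψ (s, y) = g_s y` for `s ∈ I^m ≅ [-1,1]^m`, and the
extension of `ψ` by the identity to the parameters outside this cube is smooth. -/
structure IsSmoothFamily {m k : ℕ} (g : Ω^ (Fin m) (DiffDisk k) (DiffDisk.id k))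
    (ψ : Euc m × Euc k → Euc k) : Prop where
  contDiff : ContDiff ℝ ∞ ψ
  on_box : ∀ s y, ψ (box s, y) = g s y
  off_box : ∀ p ∉ Set.range (box (d := m)), ∀ y, ψ (p, y) = y

/-- The compactly supported self-map `(p, y) ↦ (p, ψ (p, y))` of `ℝ^m × ℝ^k = ℝ^{m+k}` given by a
family `ψ`. -/
def fiberwise {m k : ℕ} (ψ : Euc m × Euc k → Euc k) (z : Euc (m + k)) : Euc (m + k) :=
  let p : Euc m := WithLp.toLp 2 fun i => z (Fin.castAdd k i)
  let y : Euc k := WithLp.toLp 2 fun j => z (Fin.natAdd m j)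
  WithLp.toLp 2 (Fin.append p (ψ (p, y)))

/-- The inverse stereographic projection `ℝ^n → S^n ⊆ ℝ^n × ℝ`,
`p ↦ (2 p, |p|² - 1) / (|p|² + 1)`, by which we regard `ℝ^n`, and with it any disk in `ℝ^n`, as a
subset of `S^n`. -/
def toSphere {n : ℕ} (p : Euc n) : Sph n :=
  ⟨WithLp.toLp 2 (Fin.snoc (α := fun _ => ℝ) (fun i => 2 * p i / (‖p‖ ^ 2 + 1))
    ((‖p‖ ^ 2 - 1) / (‖p‖ ^ 2 + 1))), by
    have h : (‖p‖ ^ 2 + 1) ≠ 0 := by positivity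
    have hp : ∑ i, (2 * p i / (‖p‖ ^ 2 + 1)) ^ 2 = 4 * ‖p‖ ^ 2 / (‖p‖ ^ 2 + 1) ^ 2 := by
      have hi : ∀ i, (2 * p i / (‖p‖ ^ 2 + 1)) ^ 2 = 4 / (‖p‖ ^ 2 + 1) ^ 2 * p i ^ 2 :=
        fun i => by rw [div_pow, mul_pow]; ring
      simp_rw [hi]
      rw [← Finset.mul_sum, ← EuclideanSpace.real_norm_sq_eq]
      ring
    rw [mem_sphere_zero_iff_norm, ← sq_eq_sq₀ (norm_nonneg _) zero_le_one,
      EuclideanSpace.real_norm_sq_eq, Fin.sum_univ_castSucc]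
    simp only [Fin.snoc_castSucc, Fin.snoc_last]
    rw [hp]
    field_simp
    ring⟩

/-- The diffeomorphism `φ` of `S^n` is the extension by the identity of the self-map `Ψ` of
`ℝ^n ⊆ S^n`. -/
def IsExtension {n : ℕ} (Ψ : Euc n → Euc n) (φ : Sph n ≃ₘ^∞⟮𝓡 n, 𝓡 n⟯ Sph n) : Prop :=
  (∀ p, φ (toSphere p) = toSphere (Ψ p)) ∧ ∀ u ∉ Set.range (toSphere (n := n)), φ u = u

/-- The smooth manifold `M` is (diffeomorphic to) the manifold `D^{n+1} ∪_φ D^{n+1}` obtained by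
clutching two disks along the diffeomorphism `φ` of their boundary `S^n`, with the smooth structure
given by the radial collars: `M` is covered by two smooth open embeddings `c₀`, `c₁` of `ℝ^{n+1}`,
such that `c₀ (t u) = c₁ (t⁻¹ φ(u))` for `t > 0` and `u ∈ S^n`, and there are no further
identifications. Hence `M` is the union of the disks `c₀ (D^{n+1})` and `c₁ (D^{n+1})`, which meet
exactly in their boundaries, where `c₀ u = c₁ (φ u)`. -/
def IsTwistedSphere {n : ℕ} (φ : Sph n ≃ₘ^∞⟮𝓡 n, 𝓡 n⟯ Sph n) (M : Type) [TopologicalSpace M]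
    [ChartedSpace (Euc (n + 1)) M] : Prop :=
  ∃ c₀ c₁ : Euc (n + 1) → M,
    IsLocalDiffeomorph (𝓡 (n + 1)) (𝓡 (n + 1)) ∞ c₀ ∧ Function.Injective c₀ ∧
    IsLocalDiffeomorph (𝓡 (n + 1)) (𝓡 (n + 1)) ∞ c₁ ∧ Function.Injective c₁ ∧
    Set.range c₀ ∪ Set.range c₁ = Set.univ ∧
    ∀ v w, c₀ v = c₁ w ↔
      ∃ t : ℝ, 0 < t ∧ ∃ u : Sph n, v = t • (u : Euc (n + 1)) ∧ w = t⁻¹ • (φ u : Euc (n + 1))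

/-- The homotopy sphere `S` represents the image `A(x) ∈ Θ_{m+k+1}` of `x ∈ π_m Diff_∂(D^k)` under
Gromoll's map, up to orientation: a smooth family `ψ` representing `x` is regarded as a
diffeomorphism of `D^{m+k}`, which is extended by the identity to `S^{m+k}`, and `S` is obtained by
clutching two disks along the result. -/
def RepresentsGromoll {m k : ℕ} (x : HomotopyGroup.Pi m (DiffDisk k) (DiffDisk.id k))
    (S : HomotopySphere (m + k + 1)) : Prop :=
  ∃ (g : Ω^ (Fin m) (DiffDisk k) (DiffDisk.id k)) (ψ : Euc m × Euc k → Euc k)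
    (φ : Sph (m + k) ≃ₘ^∞⟮𝓡 (m + k), 𝓡 (m + k)⟯ Sph (m + k)),
    x = Quotient.mk _ g ∧ IsSmoothFamily g ψ ∧ IsExtension (fiberwise ψ) φ ∧
      IsTwistedSphere φ S.carrier

/-! ### Normal bundles and clutching -/

/-- The fibre at `p` of the normal bundle of a smooth map `e : M → ℝ^N` (an embedding in practice):
the orthogonal complement of the image of the differential of `e` at `p`. -/
def normalSpace {d N : ℕ} {M : Type} [TopologicalSpace M] [ChartedSpace (Euc d) M]
    (e : M → Euc N) (p : M) : Submodule ℝ (Euc N) :=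
  (LinearMap.range (mfderiv (𝓡 d) (𝓡 N) e p : Euc d →L[ℝ] Euc N).toLinearMap)ᗮ

/-- The map `a : S^n → SO_k` corresponding to a loop `γ : (I^n, ∂I^n) → (SO_k, 1)` under
`I^n/∂I^n ≃ S^n`: it is `γ` on the cube `I^n ≅ [-1,1]^n ⊆ ℝ^n ⊆ S^n` and `1` elsewhere. -/
def IsSphereMap {n k : ℕ} (γ : Ω^ (Fin n) (SO k) 1) (a : C(Sph n, SO k)) : Prop :=
  (∀ z, a (toSphere (box z)) = γ z) ∧ ∀ u ∉ Set.range fun z => toSphere (box (d := n) z), a u = 1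

/-- The last coordinate of a point of the sphere. -/
def height {d : ℕ} (w : Sph d) : ℝ := (w : Euc (d + 1)) (Fin.last d)

/-- The inclusion of `S^n` into `S^{n+1}` as the equator. -/
def equator {n : ℕ} (u : Sph n) : Sph (n + 1) :=
  ⟨WithLp.toLp 2 (Fin.snoc (α := fun _ => ℝ) (fun i => (u : Euc (n + 1)) i) 0), by
    have hu : ‖(u : Euc (n + 1))‖ = 1 := mem_sphere_zero_iff_norm.mp u.2
    rw [mem_sphere_zero_iff_norm, ← sq_eq_sq₀ (norm_nonneg _) zero_le_one,
      EuclideanSpace.real_norm_sq_eq, Fin.sum_univ_castSucc]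
    simp only [Fin.snoc_castSucc, Fin.snoc_last]
    rw [← EuclideanSpace.real_norm_sq_eq, hu]
    norm_num⟩

/-- The vector bundle on `S^{n+1}` with fibres `V w ⊆ ℝ^N` is isomorphic to the bundle
`(D^{n+1}_+ × ℝ^k) ∪_a (D^{n+1}_- × ℝ^k)` with clutching function `a : S^n → SO_k`: there are
continuous trivializations `F` and `G` over the upper and the lower closed hemisphere, such that
`F_u = G_u ∘ a(u)` on the equator. -/
def IsClutchedBy {n k N : ℕ} (V : Sph (n + 1) → Submodule ℝ (Euc N)) (a : C(Sph n, SO k)) : Prop :=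
  ∃ F G : Sph (n + 1) → Euc k →L[ℝ] Euc N,
    ContinuousOn F {w | 0 ≤ height w} ∧ ContinuousOn G {w | height w ≤ 0} ∧
    (∀ w, 0 ≤ height w → Function.Injective (F w) ∧ LinearMap.range (F w).toLinearMap = V w) ∧
    (∀ w, height w ≤ 0 → Function.Injective (G w) ∧ LinearMap.range (G w).toLinearMap = V w) ∧
    ∀ u v, F (equator u) v = G (equator u) (Matrix.toEuclideanLin (a u).1 v)

/-- The vector bundle with fibres `V p ⊆ ℝ^N` on a homotopy sphere `M` of dimension `n + 1` is
classified, up to sign, by `α ∈ π_n SO_k ≅ π_{n+1} BSO_k`: for some homotopy equivalence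
`h : S^{n+1} → M`, the bundle `h^* V` is clutched by a map `S^n → SO_k` in the class `α`.

The homotopy equivalence may have degree `1` or `-1` for a given orientation of `M`; changing the
degree replaces `α` by `α⁻¹`. If `V` is a normal bundle, then its orientation coming from the
clutching construction can be made to agree with the one given by orientations of `M` and `ℝ^N`,
by composing the embedding with a reflection of `ℝ^N` if necessary. -/
def IsClassifiedUpToSign {n k N : ℕ} {M : Type} [TopologicalSpace M]
    (V : M → Submodule ℝ (Euc N)) (α : HomotopyGroup.Pi n (SO k) 1) : Prop :=
  ∃ (h : Sph (n + 1) ≃ₕ M) (γ : Ω^ (Fin n) (SO k) 1) (a : C(Sph n, SO k)),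
    α = Quotient.mk _ γ ∧ IsSphereMap γ a ∧ IsClutchedBy (fun w => V (h w)) a

end DerivMap

end

open DerivMap

/-!
The twisted sphere of a smooth family `ψ` of diffeomorphisms of `D^k` with parameters in `D^m` is
embedded in `ℝ^{m+k+1} × ℝ^k` by realizing the clutching diffeomorphism as the end of an isotopy
of embeddings.

Write `χ(s, y) = ψ_s(y) - y` for the displacement of the family. For an angle `θ`, consider the map
`(s, y) ↦ (s, y + sin² θ χ, sin θ cos θ χ)` from `ℝ^m × ℝ^k` to `ℝ^m × ℝ^k × ℝ^k`: as `θ` grows from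
`0` to `π / 2`, the point `y` moves to `ψ_s(y)` along a half circle. This is an embedding for every
`θ`: unless `sin θ cos θ = 0`, where it is the inclusion or the family itself, the last coordinate
determines `χ` and hence `y`. In stereographic coordinates, with `θ` depending on the radius, these
embeddings of spheres sweep out an embedding (`track`) of `ℝ^{m+k+1}`, which is linear near the
origin and the cone over the diffeomorphism `φ` of the sphere outside the unit ball. An inversion
at a unit vector of the factor `ℝ^k` closes the image to a compact embedded manifold (`closedTrack`,
`cap`), which is the twisted sphere of `φ` (`IsGluing.isSmoothEmbedding`).

The normal bundle over the second disk is framed by the factor `ℝ^k`. Over the first disk one needs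
a complement of the tangent spaces of the track, up to the angle `π / 2`, where the fibrewise
differential is the Jacobian `A` of `ψ_s`. If `Q` is the Gram-Schmidt orthonormalization of `A`,
then the vectors `(sin θ cos θ (w - Qᵀ w), w + sin² θ (Qᵀ w - w))` in `ℝ^k × ℝ^k` span such a
complement, since `cos² θ Q + sin² θ A` is invertible (`graph_complement`, by the triangular form of
`Qᵀ A`). On the common boundary the two frames differ by `Q`, so that `Q` is the clutching function (`IsGluing.exists_isClutchedBy`); it represents
`d_*(x)` by definition (`IsSmoothFamily.isSphereMap`).

A twisted sphere exists for every class. A loop in `Diff_∂(D^k)` is `C^1`-close to a finite convex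
combination of its values with smooth coefficients, and maps that are `C^1`-close to a
diffeomorphism of the disk are diffeomorphisms, so that the straight line is a homotopy to a smooth
family (`exists_smooth_representative`). The gluing of two disks is realized on the topological
sphere, where one of the two stereographic charts is composed with the cone over `φ`
(`exists_homotopySphere`); this is also how a twisted sphere is homotopy equivalent to the sphere
(`IsGluing.homeomorph`).
-/

noncomputable section

namespace DerivMap

/-! ### Stereographic coordinates and cones -/

section stereographic

variable {n : ℕ}

/-- The stereographic projection of the ray through `v`: a left inverse, up to positive scalars, of
`toSphere`. It is meaningful off the ray through the north pole. -/
def stereo (v : Euc (n + 1)) : Euc n :=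
  WithLp.toLp 2 fun i => v i.castSucc / (‖v‖ - v (Fin.last n))

/-- The complement of the closed ray through the north pole. -/
def offPole (n : ℕ) : Set (Euc (n + 1)) := {v | v (Fin.last n) < ‖v‖}

/-- The open cone around the ray through the north pole whose points have a stereographic
projection of squared norm greater than `R`. -/
def nearPole (n : ℕ) (R : ℝ) : Set (Euc (n + 1)) :=
  {v | R * (‖v‖ - v (Fin.last n)) < ‖v‖ + v (Fin.last n)}

lemma continuous_last : Continuous fun v : Euc (n + 1) => v (Fin.last n) := by fun_prop

lemma isOpen_offPole : IsOpen (offPole n) := isOpen_lt continuous_last continuous_norm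

lemma isOpen_nearPole (R : ℝ) : IsOpen (nearPole n R) :=
  isOpen_lt (continuous_const.mul (continuous_norm.sub continuous_last))
    (continuous_norm.add continuous_last)

lemma last_le_norm (v : Euc (n + 1)) : v (Fin.last n) ≤ ‖v‖ :=
  (le_abs_self _).trans (PiLp.norm_apply_le v (Fin.last n))

lemma norm_pos_of_mem_offPole {v : Euc (n + 1)} (hv : v ∈ offPole n) : 0 < ‖v‖ := by
  rcases eq_or_ne v 0 with rfl | h
  · simp [offPole] at hv
  · exact norm_pos_iff.mpr h

lemma mem_offPole_or_mem_nearPole (R : ℝ) {v : Euc (n + 1)} (hv : v ≠ 0) :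
    v ∈ offPole n ∨ v ∈ nearPole n R := by
  rcases (last_le_norm v).lt_or_eq with h | h
  · exact Or.inl h
  · right
    have := norm_pos_iff.mpr hv
    simp only [nearPole, Set.mem_ofPred_eq, h, sub_self, mul_zero]
    linarith

lemma norm_sq_eq_sum_last (v : Euc (n + 1)) :
    ‖v‖ ^ 2 = ∑ i : Fin n, v i.castSucc ^ 2 + v (Fin.last n) ^ 2 := by
  rw [EuclideanSpace.real_norm_sq_eq, Fin.sum_univ_castSucc]

lemma norm_sq_stereo {v : Euc (n + 1)} (hv : v ∈ offPole n) :
    ‖stereo v‖ ^ 2 = (‖v‖ + v (Fin.last n)) / (‖v‖ - v (Fin.last n)) := by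
  have h : 0 < ‖v‖ - v (Fin.last n) := sub_pos.mpr hv
  rw [EuclideanSpace.real_norm_sq_eq]
  simp only [stereo, div_pow]
  rw [← Finset.sum_div, eq_sub_of_add_eq (norm_sq_eq_sum_last v).symm]
  field_simp
  ring

lemma lt_norm_sq_stereo {R : ℝ} {v : Euc (n + 1)} (hv : v ∈ offPole n) (hv' : v ∈ nearPole n R) :
    R < ‖stereo v‖ ^ 2 := by
  rw [norm_sq_stereo hv, lt_div_iff₀ (sub_pos.mpr hv)]
  exact hv'

lemma toSphere_castSucc (p : Euc n) (i : Fin n) :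
    (toSphere p : Euc (n + 1)) i.castSucc = 2 * p i / (‖p‖ ^ 2 + 1) := by
  simp [toSphere]

lemma toSphere_last (p : Euc n) :
    (toSphere p : Euc (n + 1)) (Fin.last n) = (‖p‖ ^ 2 - 1) / (‖p‖ ^ 2 + 1) := by
  simp [toSphere]

lemma norm_sphere (u : Sph n) : ‖(u : Euc (n + 1))‖ = 1 := mem_sphere_zero_iff_norm.mp u.2

lemma smul_toSphere_mem_offPole {r : ℝ} (hr : 0 < r) (p : Euc n) :
    r • (toSphere p : Euc (n + 1)) ∈ offPole n := by
  have h : (0 : ℝ) < ‖p‖ ^ 2 + 1 := by positivity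
  simp only [offPole, Set.mem_ofPred_eq, norm_smul, norm_sphere, PiLp.smul_apply, smul_eq_mul,
    toSphere_last, Real.norm_eq_abs, abs_of_pos hr]
  gcongr
  rw [div_lt_one h]
  linarith

lemma norm_smul_toSphere {r : ℝ} (hr : 0 ≤ r) (p : Euc n) :
    ‖r • (toSphere p : Euc (n + 1))‖ = r := by
  rw [norm_smul, norm_sphere, mul_one, Real.norm_eq_abs, abs_of_nonneg hr]

lemma stereo_smul_toSphere {r : ℝ} (hr : 0 < r) (p : Euc n) :
    stereo (r • (toSphere p : Euc (n + 1))) = p := by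
  have h : ‖p‖ ^ 2 + 1 ≠ 0 := by positivity
  ext i
  simp only [stereo, norm_smul_toSphere hr.le, PiLp.smul_apply, smul_eq_mul, toSphere_last,
    toSphere_castSucc]
  field_simp
  ring_nf

lemma norm_smul_toSphere_stereo {v : Euc (n + 1)} (hv : v ∈ offPole n) :
    ‖v‖ • (toSphere (stereo v) : Euc (n + 1)) = v := by
  have h : 0 < ‖v‖ - v (Fin.last n) := sub_pos.mpr hv
  have h0 := norm_pos_of_mem_offPole hv
  have hs : ‖stereo v‖ ^ 2 + 1 = 2 * ‖v‖ / (‖v‖ - v (Fin.last n)) := by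
    rw [norm_sq_stereo hv]; field_simp; ring
  ext i
  induction i using Fin.lastCases with
  | last =>
    have hs' : ‖stereo v‖ ^ 2 - 1 = 2 * v (Fin.last n) / (‖v‖ - v (Fin.last n)) := by
      rw [norm_sq_stereo hv]; field_simp; ring
    simp only [PiLp.smul_apply, smul_eq_mul, toSphere_last, hs, hs']
    field_simp
  | cast i =>
    simp only [PiLp.smul_apply, smul_eq_mul, toSphere_castSucc, hs]
    simp only [stereo]
    field_simp

lemma contDiff_toSphere : ContDiff ℝ ∞ fun p : Euc n => (toSphere p : Euc (n + 1)) := by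
  rw [contDiff_euclidean]
  intro i
  have hn : ContDiff ℝ ∞ fun p : Euc n => ‖p‖ ^ 2 := contDiff_norm_sq ℝ
  have h : ∀ p : Euc n, ‖p‖ ^ 2 + 1 ≠ 0 := fun p => by positivity
  induction i using Fin.lastCases with
  | last =>
    simp only [toSphere_last]
    exact (hn.sub contDiff_const).div (hn.add contDiff_const) h
  | cast i =>
    simp only [toSphere_castSucc]
    exact (contDiff_const.mul (by fun_prop)).div (hn.add contDiff_const) h

lemma contDiffAt_norm_of_mem_offPole {v : Euc (n + 1)} (hv : v ∈ offPole n) :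
    ContDiffAt ℝ ∞ (fun v : Euc (n + 1) => ‖v‖) v :=
  contDiffAt_norm ℝ (norm_pos_iff.mp (norm_pos_of_mem_offPole hv))

lemma contDiffAt_stereo {v : Euc (n + 1)} (hv : v ∈ offPole n) : ContDiffAt ℝ ∞ stereo v := by
  rw [contDiffAt_euclidean]
  intro i
  exact ContDiffAt.div (by fun_prop)
    ((contDiffAt_norm_of_mem_offPole hv).sub (by fun_prop)) (sub_pos.mpr hv).ne'

open Classical in
/-- The extension to `ℝ^{n+1}` of a function on `(0, ∞) × ℝ^n`, which is regarded as the complement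
of the ray through the north pole by `(r, p) ↦ r • toSphere p`; the function is extended by `b`. -/
def polarExtend {W : Type*} (A : ℝ → Euc n → W) (b : Euc (n + 1) → W) (v : Euc (n + 1)) : W :=
  if v ∈ offPole n then A ‖v‖ (stereo v) else b v

section polarExtend

variable {W : Type*} {A : ℝ → Euc n → W} {b : Euc (n + 1) → W} {R : ℝ}

lemma polarExtend_of_mem {v : Euc (n + 1)} (hv : v ∈ offPole n) :
    polarExtend A b v = A ‖v‖ (stereo v) := if_pos hv

lemma polarExtend_smul_toSphere {r : ℝ} (hr : 0 < r) (p : Euc n) :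
    polarExtend A b (r • (toSphere p : Euc (n + 1))) = A r p := by
  rw [polarExtend_of_mem (smul_toSphere_mem_offPole hr p), norm_smul_toSphere hr.le,
    stereo_smul_toSphere hr]

lemma polarExtend_eventuallyEq_polar {v : Euc (n + 1)} (hv : v ∈ offPole n) :
    polarExtend A b =ᶠ[𝓝 v] fun v => A ‖v‖ (stereo v) := by
  filter_upwards [isOpen_offPole.mem_nhds hv] with w hw using polarExtend_of_mem hw

lemma polarExtend_of_mem_nearPole
    (hA : ∀ r p, 0 < r → R < ‖p‖ ^ 2 → A r p = b (r • (toSphere p : Euc (n + 1))))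
    {v : Euc (n + 1)} (hv : v ∈ nearPole n R) : polarExtend A b v = b v := by
  by_cases h : v ∈ offPole n
  · rw [polarExtend_of_mem h, hA _ _ (norm_pos_of_mem_offPole h) (lt_norm_sq_stereo h hv),
      norm_smul_toSphere_stereo h]
  · exact if_neg h

lemma polarExtend_eventuallyEq_of_mem_nearPole
    (hA : ∀ r p, 0 < r → R < ‖p‖ ^ 2 → A r p = b (r • (toSphere p : Euc (n + 1))))
    {v : Euc (n + 1)} (hv : v ∈ nearPole n R) : polarExtend A b =ᶠ[𝓝 v] b := by
  filter_upwards [(isOpen_nearPole R).mem_nhds hv] with w hw using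
    polarExtend_of_mem_nearPole hA hw

lemma polarExtend_eq_of_norm {v : Euc (n + 1)}
    (hA : ∀ p, A ‖v‖ p = b (‖v‖ • (toSphere p : Euc (n + 1)))) :
    polarExtend A b v = b v := by
  by_cases h : v ∈ offPole n
  · rw [polarExtend_of_mem h, hA, norm_smul_toSphere_stereo h]
  · exact if_neg h

lemma continuousAt_polarExtend [TopologicalSpace W] (hA : Continuous (Function.uncurry A))
    (hb : Continuous b)
    (hAb : ∀ r p, 0 < r → R < ‖p‖ ^ 2 → A r p = b (r • (toSphere p : Euc (n + 1))))
    {v : Euc (n + 1)} (hv : v ≠ 0) : ContinuousAt (polarExtend A b) v := by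
  rcases mem_offPole_or_mem_nearPole R hv with h | h
  · refine ContinuousAt.congr ?_ (polarExtend_eventuallyEq_polar h).symm
    exact hA.continuousAt.comp (f := fun v : Euc (n + 1) => (‖v‖, stereo v))
      (continuous_norm.continuousAt.prodMk (contDiffAt_stereo h).continuousAt)
  · exact hb.continuousAt.congr (polarExtend_eventuallyEq_of_mem_nearPole hAb h).symm

lemma contDiffAt_polarExtend [NormedAddCommGroup W] [NormedSpace ℝ W]
    (hA : ContDiff ℝ ∞ (Function.uncurry A)) (hb : ContDiff ℝ ∞ b)
    (hAb : ∀ r p, 0 < r → R < ‖p‖ ^ 2 → A r p = b (r • (toSphere p : Euc (n + 1))))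
    {v : Euc (n + 1)} (hv : v ≠ 0) : ContDiffAt ℝ ∞ (polarExtend A b) v := by
  rcases mem_offPole_or_mem_nearPole R hv with h | h
  · refine ContDiffAt.congr_of_eventuallyEq ?_ (polarExtend_eventuallyEq_polar h)
    exact hA.contDiffAt.comp v (f := fun v : Euc (n + 1) => (‖v‖, stereo v))
      ((contDiffAt_norm_of_mem_offPole h).prodMk (contDiffAt_stereo h))
  · exact hb.contDiffAt.congr_of_eventuallyEq (polarExtend_eventuallyEq_of_mem_nearPole hAb h)

end polarExtend

/-- The norm-preserving self-map of `ℝ^{n+1}` which is given on the sphere of radius `r` by the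
self-map `Ψ r` of `ℝ^n`, through stereographic projection; it fixes the ray through the north
pole. -/
def coneMap (Ψ : ℝ → Euc n → Euc n) : Euc (n + 1) → Euc (n + 1) :=
  polarExtend (fun r p => r • (toSphere (Ψ r p) : Euc (n + 1))) id

section coneMap

variable {Ψ Ψ' : ℝ → Euc n → Euc n} {R : ℝ}

lemma coneMap_smul_toSphere {r : ℝ} (hr : 0 < r) (p : Euc n) :
    coneMap Ψ (r • (toSphere p : Euc (n + 1))) = r • (toSphere (Ψ r p) : Euc (n + 1)) :=
  polarExtend_smul_toSphere hr p

lemma coneMap_of_notMem {v : Euc (n + 1)} (hv : v ∉ offPole n) : coneMap Ψ v = v := if_neg hv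

lemma coneMap_of_mem {v : Euc (n + 1)} (hv : v ∈ offPole n) :
    coneMap Ψ v = ‖v‖ • (toSphere (Ψ ‖v‖ (stereo v)) : Euc (n + 1)) := if_pos hv

@[simp] lemma norm_coneMap (v : Euc (n + 1)) : ‖coneMap Ψ v‖ = ‖v‖ := by
  by_cases h : v ∈ offPole n
  · rw [coneMap_of_mem h, norm_smul_toSphere (norm_nonneg _)]
  · rw [coneMap_of_notMem h]

@[simp] lemma coneMap_zero : coneMap Ψ (0 : Euc (n + 1)) = 0 := by
  rw [← norm_eq_zero, norm_coneMap, norm_zero]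

lemma coneMap_mem_offPole {v : Euc (n + 1)} : coneMap Ψ v ∈ offPole n ↔ v ∈ offPole n := by
  by_cases h : v ∈ offPole n
  · simp only [h, iff_true, coneMap_of_mem h]
    exact smul_toSphere_mem_offPole (norm_pos_of_mem_offPole h) _
  · rw [coneMap_of_notMem h]

lemma coneMap_coneMap (v : Euc (n + 1)) :
    coneMap Ψ (coneMap Ψ' v) = coneMap (fun r p => Ψ r (Ψ' r p)) v := by
  by_cases h : v ∈ offPole n
  · rw [coneMap_of_mem h, coneMap_of_mem h, coneMap_smul_toSphere (norm_pos_of_mem_offPole h)]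
  · rw [coneMap_of_notMem h, coneMap_of_notMem h, coneMap_of_notMem h]

lemma coneMap_eq_self {v : Euc (n + 1)} (h : ∀ p, Ψ ‖v‖ p = p) : coneMap Ψ v = v :=
  polarExtend_eq_of_norm fun p => by simp [h]

lemma contDiffAt_coneMap (hΨ : ContDiff ℝ ∞ (Function.uncurry Ψ))
    (hR : ∀ r p, R < ‖p‖ ^ 2 → Ψ r p = p) {v : Euc (n + 1)} (hv : v ≠ 0) :
    ContDiffAt ℝ ∞ (coneMap Ψ) v := by
  refine contDiffAt_polarExtend (R := R) ?_ contDiff_id (fun r p _ hp => by simp [hR r p hp]) hv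
  exact contDiff_fst.smul (contDiff_toSphere.comp hΨ)

lemma continuous_coneMap (hΨ : ContDiff ℝ ∞ (Function.uncurry Ψ))
    (hR : ∀ r p, R < ‖p‖ ^ 2 → Ψ r p = p) : Continuous (coneMap Ψ) := by
  refine continuous_iff_continuousAt.mpr fun v => ?_
  rcases eq_or_ne v 0 with rfl | hv
  · rw [ContinuousAt, coneMap_zero, tendsto_zero_iff_norm_tendsto_zero]
    simp only [norm_coneMap]
    exact continuous_norm.tendsto' 0 0 norm_zero
  · exact (contDiffAt_coneMap hΨ hR hv).continuousAt

/-- If the self-map of `ℝ^n` does not depend on the radius, the cone is homogeneous. -/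
lemma coneMap_smul (Φ : Euc n → Euc n) {t : ℝ} (ht : 0 < t) (v : Euc (n + 1)) :
    coneMap (fun _ => Φ) (t • v) = t • coneMap (fun _ => Φ) v := by
  by_cases h : v ∈ offPole n
  · have h0 := norm_pos_of_mem_offPole h
    conv_lhs => rw [← norm_smul_toSphere_stereo h, smul_smul,
      coneMap_smul_toSphere (mul_pos ht h0)]
    rw [coneMap_of_mem h, smul_smul]
  · have h' : t • v ∉ offPole n := by
      intro h'
      apply h
      simp only [offPole, Set.mem_ofPred_eq, norm_smul, PiLp.smul_apply, smul_eq_mul,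
        Real.norm_eq_abs, abs_of_pos ht] at h' ⊢
      exact lt_of_mul_lt_mul_left h' ht.le
    rw [coneMap_of_notMem h, coneMap_of_notMem h']

end coneMap

lemma mem_range_toSphere_iff {u : Sph n} :
    u ∈ Set.range (toSphere (n := n)) ↔ (u : Euc (n + 1)) ∈ offPole n := by
  constructor
  · rintro ⟨p, rfl⟩
    simpa using smul_toSphere_mem_offPole one_pos p
  · intro h
    refine ⟨stereo (u : Euc (n + 1)), Subtype.ext ?_⟩
    simpa [norm_sphere] using norm_smul_toSphere_stereo h

lemma stereo_toSphere (p : Euc n) : stereo (toSphere p : Euc (n + 1)) = p := by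
  simpa using stereo_smul_toSphere one_pos p

lemma toSphere_injective : Function.Injective (toSphere (n := n)) := fun p q h => by
  rw [← stereo_toSphere p, h, stereo_toSphere]

/-- On the unit sphere, the cone over `Ψ` is the extension of `Ψ` by the identity. -/
lemma IsExtension.coe_eq_coneMap {Ψ : Euc n → Euc n} {φ : Sph n ≃ₘ^∞⟮𝓡 n, 𝓡 n⟯ Sph n}
    (h : IsExtension Ψ φ) (u : Sph n) :
    (φ u : Euc (n + 1)) = coneMap (fun _ => Ψ) (u : Euc (n + 1)) := by
  by_cases hu : (u : Euc (n + 1)) ∈ offPole n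
  · obtain ⟨p, rfl⟩ := mem_range_toSphere_iff.mpr hu
    rw [h.1, coneMap_of_mem hu, stereo_toSphere, norm_sphere, one_smul]
  · rw [h.2 u (mt mem_range_toSphere_iff.mp hu), coneMap_of_notMem hu]

end stereographic

/-! ### Frames of orthogonal complements -/

section frame

variable {E F W : Type*} [NormedAddCommGroup E] [InnerProductSpace ℝ E] [FiniteDimensional ℝ E]
  [NormedAddCommGroup F] [InnerProductSpace ℝ F]
  [NormedAddCommGroup W] [InnerProductSpace ℝ W] [FiniteDimensional ℝ W]

/-- The projection of the linear map `Q` to the orthogonal complement of the range of an injective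
linear map `L`, written as `Q - L (Lᵀ L)⁻¹ Lᵀ Q` to make its dependence on `L` visible. -/
def orthFrame (L : E →L[ℝ] W) (Q : F →L[ℝ] W) : F →L[ℝ] W :=
  Q - L ∘L (Ring.inverse (L.adjoint ∘L L) ∘L (L.adjoint ∘L Q))

lemma isUnit_adjoint_comp_self {L : E →L[ℝ] W} (hL : Function.Injective L) :
    IsUnit (L.adjoint ∘L L) := by
  rw [ContinuousLinearMap.isUnit_iff_isUnit_toLinearMap]
  rw [LinearMap.isUnit_iff_ker_eq_bot, LinearMap.ker_eq_bot']
  intro x hx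
  have h : inner ℝ (L.adjoint (L x)) x = 0 := by
    have hx' : L.adjoint (L x) = 0 := hx
    rw [hx', inner_zero_left]
  rw [ContinuousLinearMap.adjoint_inner_left] at h
  exact hL ((inner_self_eq_zero.mp h).trans (map_zero L).symm)

lemma orthFrame_eq_of_adjoint {L : E →L[ℝ] W} {Q : F →L[ℝ] W} {w : F}
    (h : L.adjoint (Q w) = 0) : orthFrame L Q w = Q w := by
  simp [orthFrame, h]

lemma adjoint_orthFrame {L : E →L[ℝ] W} (hL : Function.Injective L) (Q : F →L[ℝ] W) (w : F) :
    L.adjoint (orthFrame L Q w) = 0 := by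
  have h := Ring.mul_inverse_cancel _ (isUnit_adjoint_comp_self hL)
  have h' := congrArg (fun T : E →L[ℝ] E => T (L.adjoint (Q w))) h
  simp only [ContinuousLinearMap.mul_def, ContinuousLinearMap.comp_apply] at h'
  simp only [orthFrame, sub_apply, ContinuousLinearMap.comp_apply, map_sub, h']
  exact sub_self _

lemma range_eq_orthogonal_range {L : E →L[ℝ] W} {G : F →L[ℝ] W} (hL : Function.Injective L)
    (hG : Function.Injective G) (hLG : ∀ w, L.adjoint (G w) = 0)
    (hd : Module.finrank ℝ E + Module.finrank ℝ F = Module.finrank ℝ W) :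
    LinearMap.range G.toLinearMap = (LinearMap.range L.toLinearMap)ᗮ := by
  refine Submodule.eq_of_le_of_finrank_eq ?_ ?_
  · rintro _ ⟨w, rfl⟩ _ ⟨x, rfl⟩
    change inner ℝ (L x) (G w) = 0
    rw [← ContinuousLinearMap.adjoint_inner_right, hLG, inner_zero_right]
  · have h1 : Module.finrank ℝ (LinearMap.range L.toLinearMap) = Module.finrank ℝ E :=
      LinearMap.finrank_range_of_inj hL
    have h2 : Module.finrank ℝ (LinearMap.range G.toLinearMap) = Module.finrank ℝ F :=
      LinearMap.finrank_range_of_inj hG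
    have h3 := Submodule.finrank_add_finrank_orthogonal (LinearMap.range L.toLinearMap)
    omega

lemma orthFrame_injective {L : E →L[ℝ] W} {Q : F →L[ℝ] W}
    (h : ∀ x w, L x + Q w = 0 → x = 0 ∧ w = 0) : Function.Injective (orthFrame L Q) := by
  refine (injective_iff_map_eq_zero _).mpr fun w hw => ?_
  refine (h (-Ring.inverse (L.adjoint ∘L L) (L.adjoint (Q w))) w ?_).2
  rw [map_neg, neg_add_eq_sub]
  exact hw

lemma range_orthFrame {L : E →L[ℝ] W} {Q : F →L[ℝ] W}
    (h : ∀ x w, L x + Q w = 0 → x = 0 ∧ w = 0)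
    (hd : Module.finrank ℝ E + Module.finrank ℝ F = Module.finrank ℝ W) :
    LinearMap.range (orthFrame L Q).toLinearMap = (LinearMap.range L.toLinearMap)ᗮ := by
  have hL : Function.Injective L := (injective_iff_map_eq_zero _).mpr fun x hx =>
    (h x 0 (by rw [hx, map_zero, add_zero])).1
  exact range_eq_orthogonal_range hL (orthFrame_injective h) (adjoint_orthFrame hL Q) hd

lemma continuousOn_orthFrame {X : Type*} [TopologicalSpace X] {L : X → E →L[ℝ] W}
    {Q : X → F →L[ℝ] W} {s : Set X} (hL : ContinuousOn L s) (hQ : ContinuousOn Q s)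
    (hinj : ∀ x ∈ s, Function.Injective (L x)) :
    ContinuousOn (fun x => orthFrame (L x) (Q x)) s := by
  have hadj : ContinuousOn (fun x => (L x).adjoint) s :=
    (ContinuousLinearMap.adjoint (𝕜 := ℝ) (E := E) (F := W)).continuous.comp_continuousOn hL
  have hinv : ContinuousOn (fun x => Ring.inverse ((L x).adjoint ∘L L x)) s := by
    intro x hx
    obtain ⟨u, hu⟩ := isUnit_adjoint_comp_self (hinj x hx)
    have h := NormedRing.inverse_continuousAt u
    rw [hu] at h
    exact ContinuousAt.comp_continuousWithinAt (f := fun x => (L x).adjoint ∘L L x) h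
      ((hadj.clm_comp hL) x hx)
  exact hQ.sub (hL.clm_comp (hinv.clm_comp (hadj.clm_comp hQ)))

end frame

/-! ### Gram-Schmidt and a complement of the graph of a linear map -/

lemma transpose_gramSchmidtMatrix_mul {k : ℕ} {A : Matrix (Fin k) (Fin k) ℝ} (hA : 0 < A.det) :
    ((gramSchmidtMatrix A).transpose * A).IsUpperTriangular ∧
      ∀ i, 0 < ((gramSchmidtMatrix A).transpose * A) i i := by
  have hli := cols_linearIndependent hA
  have hinner : ∀ i j, ((gramSchmidtMatrix A).transpose * A) i j
      = inner ℝ (InnerProductSpace.gramSchmidtNormed ℝ (cols A) i) (cols A j) := fun i j => by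
    simp [PiLp.inner_apply, Matrix.mul_apply, gramSchmidtMatrix, cols, mul_comm]
  refine ⟨fun i j hij => ?_, fun i => ?_⟩
  · rw [hinner, InnerProductSpace.gramSchmidtNormed, inner_smul_left,
      InnerProductSpace.gramSchmidt_inv_triangular ℝ (cols A) (i := j) (j := i) hij, mul_zero]
  · have hne := InnerProductSpace.gramSchmidt_ne_zero (𝕜 := ℝ) i hli
    have h1 : inner ℝ (InnerProductSpace.gramSchmidt ℝ (cols A) i) (cols A i)
        = ‖InnerProductSpace.gramSchmidt ℝ (cols A) i‖ ^ 2 := by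
      conv_lhs => rw [InnerProductSpace.gramSchmidt_def'' ℝ (cols A) i]
      rw [inner_add_right, inner_sum, Finset.sum_eq_zero, add_zero, real_inner_self_eq_norm_sq]
      intro l hl
      rw [inner_smul_right,
        InnerProductSpace.gramSchmidt_orthogonal ℝ (cols A) (Finset.mem_Iio.mp hl).ne', mul_zero]
    rw [hinner, InnerProductSpace.gramSchmidtNormed, inner_smul_left, h1]
    have := norm_pos_iff.mpr hne
    simp only [RCLike.ofReal_real_eq_id, id_eq, conj_trivial]
    positivity

lemma gramSchmidtMatrix_mul_transpose {k : ℕ} {A : Matrix (Fin k) (Fin k) ℝ} (hA : 0 < A.det) :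
    gramSchmidtMatrix A * (gramSchmidtMatrix A).transpose = 1 :=
  (Matrix.mem_orthogonalGroup_iff _ _).mp (Matrix.mem_specialOrthogonalGroup_iff.mp
    (gramSchmidtMatrix_mem hA)).1

/-- The segment between a matrix of positive determinant and its Gram-Schmidt orthonormalization
consists of invertible matrices. -/
lemma det_segment_gramSchmidtMatrix_ne_zero {k : ℕ} {A : Matrix (Fin k) (Fin k) ℝ}
    (hA : 0 < A.det) {a b : ℝ} (ha : 0 ≤ a) (hb : 0 ≤ b) (hab : 0 < a + b) :
    (a • gramSchmidtMatrix A + b • A).det ≠ 0 := by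
  set Q := gramSchmidtMatrix A with hQ
  obtain ⟨hU, hpos⟩ := transpose_gramSchmidtMatrix_mul hA
  have hdet : Q.det ≠ 0 := by
    rw [(Matrix.mem_specialOrthogonalGroup_iff.mp (gramSchmidtMatrix_mem hA)).2]
    exact one_ne_zero
  have h1 : a • Q + b • A = Q * (a • 1 + b • (Q.transpose * A)) := by
    rw [mul_add, Matrix.mul_smul, Matrix.mul_smul, mul_one, ← mul_assoc,
      gramSchmidtMatrix_mul_transpose hA, one_mul]
  rw [h1, Matrix.det_mul]
  refine mul_ne_zero hdet ?_
  rw [Matrix.det_of_isUpperTriangular]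
  · refine Finset.prod_ne_zero_iff.mpr fun i _ => ne_of_gt ?_
    simp only [Matrix.add_apply, Matrix.smul_apply, Matrix.one_apply_eq, smul_eq_mul, mul_one]
    have hi := hpos i
    rcases ha.eq_or_lt with rfl | ha'
    · have : 0 < b := by simpa using hab
      positivity
    · positivity
  · intro i j hij
    have hij' : j < i := hij
    simp only [Matrix.add_apply, Matrix.smul_apply, smul_eq_mul]
    rw [Matrix.one_apply_ne hij'.ne', hU hij]
    simp

lemma eq_zero_of_segment_gramSchmidtMatrix {k : ℕ} {A : Matrix (Fin k) (Fin k) ℝ}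
    (hA : 0 < A.det) {a b : ℝ} (ha : 0 ≤ a) (hb : 0 ≤ b) (hab : 0 < a + b) {y : Euc k}
    (hy : a • Matrix.toEuclideanLin (gramSchmidtMatrix A) y + b • Matrix.toEuclideanLin A y = 0) :
    y = 0 := by
  have h := Matrix.eq_zero_of_mulVec_eq_zero (v := WithLp.ofLp y)
    (det_segment_gramSchmidtMatrix_ne_zero hA ha hb hab) (by
      have := congrArg WithLp.ofLp hy
      simpa [Matrix.add_mulVec, Matrix.smul_mulVec] using this)
  ext i
  exact congrFun h i

lemma toEuclideanLin_comp_apply {k : ℕ} (A B : Matrix (Fin k) (Fin k) ℝ) (y : Euc k) :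
    Matrix.toEuclideanLin A (Matrix.toEuclideanLin B y) = Matrix.toEuclideanLin (A * B) y := by
  simp [Matrix.toLpLin_apply]

lemma toEuclideanLin_one_apply {k : ℕ} (y : Euc k) :
    Matrix.toEuclideanLin (1 : Matrix (Fin k) (Fin k) ℝ) y = y := by
  simp

/-- For `c = cos θ` and `s = sin θ`, the plane of all `(y + s² (A y - y), c s (A y - y))` goes from
`ℝ^k × 0` to itself as `θ` grows from `0` to `π / 2`, and the plane of all
`(c s (w - Qᵀ w), w + s² (Qᵀ w - w))` is complementary to it throughout, where `Q` is the
orthonormalization of `A`. The reason is that `c² Q + s² A` is invertible. -/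
lemma graph_complement {k : ℕ} {A : Matrix (Fin k) (Fin k) ℝ} (hA : 0 < A.det) {c s : ℝ}
    (hcs : c ^ 2 + s ^ 2 = 1) {y w a q : Euc k} (ha : a = Matrix.toEuclideanLin A y)
    (hq : q = Matrix.toEuclideanLin (gramSchmidtMatrix A).transpose w)
    (h1 : (y + s ^ 2 • (a - y)) + (c * s) • (w - q) = 0)
    (h2 : (c * s) • (a - y) + (w + s ^ 2 • (q - w)) = 0) : y = 0 ∧ w = 0 := by
  have e1 : c • y = s • q := by
    have : c • y - s • q
        = c • ((y + s ^ 2 • (a - y)) + (c * s) • (w - q))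
          - s • ((c * s) • (a - y) + (w + s ^ 2 • (q - w)))
          + (s * (c ^ 2 + s ^ 2 - 1)) • (q - w) := by module
    rwa [h1, h2, hcs, sub_self, mul_zero, zero_smul, smul_zero, smul_zero, sub_self, add_zero,
      sub_eq_zero] at this
  have e2 : s • a + c • w = 0 := by
    have : s • a + c • w
        = s • ((y + s ^ 2 • (a - y)) + (c * s) • (w - q))
          + c • ((c * s) • (a - y) + (w + s ^ 2 • (q - w)))
          - (s * (c ^ 2 + s ^ 2 - 1)) • (a - y) := by module
    rwa [h1, h2, hcs, sub_self, mul_zero, zero_smul, smul_zero, smul_zero, add_zero,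
      sub_zero] at this
  have e3 : c • Matrix.toEuclideanLin (gramSchmidtMatrix A) y = s • w := by
    rw [← map_smul, e1, map_smul, hq, toEuclideanLin_comp_apply,
      gramSchmidtMatrix_mul_transpose hA, toEuclideanLin_one_apply]
  have hy : y = 0 := by
    refine eq_zero_of_segment_gramSchmidtMatrix hA (sq_nonneg c) (sq_nonneg s)
      (by rw [hcs]; exact one_pos) ?_
    rw [← ha, sq, mul_smul, e3]
    have := congrArg (s • ·) e2
    simp only [smul_add, smul_zero] at this
    rw [← this]
    module
  refine ⟨hy, ?_⟩
  subst hy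
  rw [ha, map_zero, smul_zero, zero_add] at e2
  rw [map_zero, smul_zero] at e3
  have : w = c • (c • w) + s • (s • w) := by
    rw [smul_smul, smul_smul, ← add_smul, ← sq, ← sq, hcs, one_smul]
  rw [this, e2, ← e3, smul_zero, smul_zero, add_zero]

/-! ### The rotation angle -/

/-- A smooth angle depending on the radius: `0` up to the radius `1 / 2` and `π / 2` from the radius
`3 / 4` on. -/
def angle (r : ℝ) : ℝ := Real.pi / 2 * Real.smoothTransition (4 * r - 2)

lemma contDiff_angle : ContDiff ℝ ∞ angle :=
  contDiff_const.mul (Real.smoothTransition.contDiff.comp (by fun_prop))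

lemma angle_of_le {r : ℝ} (hr : r ≤ 1 / 2) : angle r = 0 := by
  rw [angle, Real.smoothTransition.zero_of_nonpos (by linarith), mul_zero]

lemma angle_of_ge {r : ℝ} (hr : 3 / 4 ≤ r) : angle r = Real.pi / 2 := by
  rw [angle, Real.smoothTransition.one_of_one_le (by linarith), mul_one]

/-! ### Immersions and normal spaces in a local parametrization -/

section immersion

variable {d k N : ℕ} {M : Type} [TopologicalSpace M] [ChartedSpace (Euc d) M]

/-- Near a point where the derivative of a smooth map is invertible, the map restricts to a
diffeomorphism between open sets. -/
lemma exists_openPartialHomeomorph_of_fderiv {X Y : Type*} [NormedAddCommGroup X] [NormedSpace ℝ X]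
    [CompleteSpace X] [NormedAddCommGroup Y] [NormedSpace ℝ Y] {Φ : X → Y} (hΦ : ContDiff ℝ ∞ Φ)
    (z : X) (D : X ≃L[ℝ] Y) (hD : fderiv ℝ Φ z = D) :
    ∃ P : OpenPartialHomeomorph X Y, z ∈ P.source ∧ (∀ x, P x = Φ x) ∧
      ContDiffOn ℝ ∞ P.symm P.target := by
  have hd : ∀ x, HasFDerivAt Φ (fderiv ℝ Φ x) x := fun x =>
    (hΦ.differentiable (by simp) x).hasFDerivAt
  have hz : HasFDerivAt Φ (D : X →L[ℝ] Y) z := hD ▸ hd z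
  let P := hΦ.contDiffAt.toOpenPartialHomeomorph Φ hz (by simp)
  have hU : IsOpen {x | fderiv ℝ Φ x ∈ Set.range ((↑) : (X ≃L[ℝ] Y) → X →L[ℝ] Y)} :=
    (ContinuousLinearEquiv.isOpen).preimage (hΦ.continuous_fderiv (by simp))
  refine ⟨P.restrOpen _ hU, ⟨hΦ.contDiffAt.mem_toOpenPartialHomeomorph_source hz (by simp),
    D, hD.symm⟩, fun x => rfl, fun y hy => ?_⟩
  obtain ⟨D', hD'⟩ := ((P.restrOpen _ hU).map_target hy).2
  exact ((P.restrOpen _ hU).contDiffAt_symm hy (f₀' := D') (hD' ▸ hd _)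
    hΦ.contDiffAt).contDiffWithinAt

/-- A map that is smooth in a local parametrization of its source, with a derivative that is
injective and has range complementary to that of a linear map `Q`, is an immersion. -/
lemma isImmersionAtOfComplement_of_parametrization [IsManifold (𝓡 d) ∞ M] {e : M → Euc N}
    {c : Euc d → M} {v : Euc d} (hc : IsLocalDiffeomorphAt (𝓡 d) (𝓡 d) ∞ c v)
    {f : Euc d → Euc N} (hf : ContDiff ℝ ∞ f) (hef : e ∘ c =ᶠ[𝓝 v] f) (Q : Euc k →L[ℝ] Euc N)
    (hinj : ∀ x w, fderiv ℝ f v x + Q w = 0 → x = 0 ∧ w = 0) (hd : d + k = N) :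
    Manifold.IsImmersionAtOfComplement (Euc k) (𝓡 d) (𝓡 N) ∞ e (c v) := by
  let Φ : Euc d × Euc k → Euc N := fun z => f z.1 + Q z.2
  have hΦ : ContDiff ℝ ∞ Φ := (hf.comp contDiff_fst).add (Q.contDiff.comp contDiff_snd)
  have hinj' : Function.Injective ((fderiv ℝ f v).coprod Q).toLinearMap := by
    refine (injective_iff_map_eq_zero _).mpr fun z hz => ?_
    obtain ⟨h1, h2⟩ := hinj z.1 z.2 hz
    exact Prod.ext h1 h2
  have hfr : Module.finrank ℝ (Euc d × Euc k) = Module.finrank ℝ (Euc N) := by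
    simp [hd]
  let D : (Euc d × Euc k) ≃L[ℝ] Euc N :=
    (LinearEquiv.ofInjectiveOfFinrankEq _ hinj' hfr).toContinuousLinearEquiv
  have hD : fderiv ℝ Φ (v, 0) = D := by
    have h1 : HasFDerivAt f (fderiv ℝ f v) (v, (0 : Euc k)).1 :=
      (hf.differentiable (by simp) v).hasFDerivAt
    have h2 := (h1.comp (v, (0 : Euc k)) hasFDerivAt_fst).add
      (Q.hasFDerivAt.comp (v, (0 : Euc k)) hasFDerivAt_snd)
    refine Eq.trans h2.fderiv ?_
    ext z
    · rfl
    · rfl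
  obtain ⟨P, hP, hPΦ, hPs⟩ := exists_openPartialHomeomorph_of_fderiv hΦ (v, 0) D hD
  obtain ⟨C, hvC, hC⟩ := hc
  have hU : {x : Euc d | e (c x) = f x ∧ (x, (0 : Euc k)) ∈ P.source} ∈ 𝓝 v := by
    filter_upwards [hef, (P.open_source.preimage (by fun_prop :
      Continuous fun x : Euc d => (x, (0 : Euc k)))).mem_nhds hP] with x h1 h2 using ⟨h1, h2⟩
  obtain ⟨U, hUsub, hUo, hvU⟩ := mem_nhds_iff.mp hU
  let R := C.toOpenPartialHomeomorph.restrOpen U hUo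
  have hRsrc : ∀ x, x ∈ R.source ↔ x ∈ C.source ∧ x ∈ U := fun x => Iff.rfl
  have hcont : ContinuousAt e (c v) := by
    have hcv : c v = R v := hC hvC
    have hvR : v ∈ R.source := ⟨hvC, hvU⟩
    have h1 : e =ᶠ[𝓝 (c v)] f ∘ R.symm := by
      filter_upwards [R.open_target.mem_nhds (hcv ▸ R.map_source hvR)] with y hy
      have h := R.map_target hy
      have h3 := (hUsub h.2).1
      rw [hC h.1] at h3
      exact (congrArg e (R.right_inv hy)).symm.trans h3
    refine ContinuousAt.congr ?_ h1.symm
    refine hf.continuous.continuousAt.comp (R.continuousAt_symm ?_)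
    exact hcv ▸ R.map_source hvR
  refine Manifold.IsImmersionAtOfComplement.mk_of_continuousAt hcont D R.symm
    (P.symm.trans D.toHomeomorph.toOpenPartialHomeomorph) ?_ ?_ ?_ ?_ ?_
  · rw [hC hvC]
    exact R.map_source ⟨hvC, hvU⟩
  · have h : f v = P (v, 0) := by rw [hPΦ]; simp [Φ]
    have h' : e (c v) = f v := (hUsub hvU).1
    rw [h', h]
    simpa using P.map_source hP
  · refine OpenPartialHomeomorph.mem_maximalAtlas_of_contMDiffOn _ ?_ ?_
    · exact C.contMDiffOn_invFun.mono Set.inter_subset_left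
    · exact C.contMDiffOn_toFun.mono Set.inter_subset_left
  · refine OpenPartialHomeomorph.mem_maximalAtlas_of_contMDiffOn _ ?_ ?_
    · exact (D.contDiff.comp_contDiffOn (hPs.mono (by simp))).contMDiffOn
    · have : ContDiff ℝ ∞ fun y => P (D.symm y) := by
        simp only [hPΦ]; exact hΦ.comp D.symm.contDiff
      exact this.contDiffOn.contMDiffOn
  · intro x hx
    have hx' : x ∈ R.source := by simpa using hx
    have h1 := hUsub hx'.2
    have h2 : e (R x) = P (x, 0) := by
      rw [hPΦ]
      simp only [Φ, map_zero, add_zero, ← h1.1]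
      exact congrArg e (hC hx'.1).symm
    change D (P.symm (e (R x))) = D (x, 0)
    rw [h2, P.left_inv h1.2]

/-- The normal space at a point, computed in a local parametrization. -/
lemma normalSpace_of_parametrization {e : M → Euc N} {c : Euc d → M} {v : Euc d}
    (hc : IsLocalDiffeomorphAt (𝓡 d) (𝓡 d) ∞ c v) {f : Euc d → Euc N}
    (he : MDifferentiableAt (𝓡 d) (𝓡 N) e (c v)) (hef : e ∘ c =ᶠ[𝓝 v] f) :
    normalSpace (d := d) e (c v) = (LinearMap.range (fderiv ℝ f v).toLinearMap)ᗮ := by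
  have h1 : mfderiv (𝓡 d) (𝓡 N) (e ∘ c) v = (mfderiv (𝓡 d) (𝓡 N) e (c v)).comp
      (mfderiv (𝓡 d) (𝓡 d) c v) := mfderiv_comp v he (hc.mdifferentiableAt (by simp))
  rw [hef.mfderiv_eq, mfderiv_eq_fderiv] at h1
  have h2 : Function.Surjective (mfderiv (𝓡 d) (𝓡 d) c v) :=
    (hc.mfderivToContinuousLinearEquiv (by simp)).surjective
  unfold normalSpace
  congr 1
  ext y
  constructor
  · rintro ⟨x, rfl⟩
    obtain ⟨x', rfl⟩ := h2 x
    exact ⟨x', by rw [h1]; rfl⟩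
  · rintro ⟨x, rfl⟩
    exact ⟨mfderiv (𝓡 d) (𝓡 d) c v x, by rw [h1]; rfl⟩

end immersion

/-! ### The product decomposition of Euclidean space -/

section split

variable {m k : ℕ}

/-- The projection `ℝ^{m+k} → ℝ^m`. -/
def left (m k : ℕ) : Euc (m + k) →L[ℝ] Euc m :=
  LinearMap.toContinuousLinearMap
    { toFun := fun z => WithLp.toLp 2 fun i => z (Fin.castAdd k i)
      map_add' := fun _ _ => rfl
      map_smul' := fun _ _ => rfl }

/-- The projection `ℝ^{m+k} → ℝ^k`. -/
def right (m k : ℕ) : Euc (m + k) →L[ℝ] Euc k :=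
  LinearMap.toContinuousLinearMap
    { toFun := fun z => WithLp.toLp 2 fun j => z (Fin.natAdd m j)
      map_add' := fun _ _ => rfl
      map_smul' := fun _ _ => rfl }

/-- The inclusion `ℝ^k → ℝ^{m+k}` of the second factor. -/
def inRight (m k : ℕ) : Euc k →L[ℝ] Euc (m + k) :=
  LinearMap.toContinuousLinearMap
    { toFun := fun y => WithLp.toLp 2 (Fin.append 0 fun j => y j)
      map_add' := fun x y => by
        ext i; induction i using Fin.addCases <;> simp
      map_smul' := fun x y => by
        ext i; induction i using Fin.addCases <;> simp }

@[simp] lemma left_apply (z : Euc (m + k)) (i : Fin m) : left m k z i = z (Fin.castAdd k i) := rfl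

@[simp] lemma right_apply (z : Euc (m + k)) (j : Fin k) : right m k z j = z (Fin.natAdd m j) := rfl

@[simp] lemma inRight_castAdd (y : Euc k) (i : Fin m) : inRight m k y (Fin.castAdd k i) = 0 := by
  simp [inRight]

@[simp] lemma inRight_natAdd (y : Euc k) (j : Fin k) : inRight m k y (Fin.natAdd m j) = y j := by
  simp [inRight]

@[simp] lemma left_inRight (y : Euc k) : left m k (inRight m k y) = 0 := by ext i; simp

@[simp] lemma right_inRight (y : Euc k) : right m k (inRight m k y) = y := by ext i; simp

lemma ext_left_right {z z' : Euc (m + k)} (h : left m k z = left m k z')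
    (h' : right m k z = right m k z') : z = z' := by
  ext i
  induction i using Fin.addCases with
  | left i => exact congrArg (fun p : Euc m => p i) h
  | right j => exact congrArg (fun p : Euc k => p j) h'

lemma norm_sq_left_add_right (z : Euc (m + k)) :
    ‖z‖ ^ 2 = ‖left m k z‖ ^ 2 + ‖right m k z‖ ^ 2 := by
  simp [EuclideanSpace.real_norm_sq_eq, Fin.sum_univ_add]

end split

/-! ### The track of an isotopy through embeddings -/

lemma fderiv_injective_of_leftInverse {X Y : Type*} [NormedAddCommGroup X] [NormedSpace ℝ X]
    [NormedAddCommGroup Y] [NormedSpace ℝ Y] {f : X → Y} {g : Y → X} {a : X}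
    (hf : DifferentiableAt ℝ f a) (hg : DifferentiableAt ℝ g (f a)) (h : g ∘ f =ᶠ[𝓝 a] id) {x : X}
    (hx : fderiv ℝ f a x = 0) : x = 0 := by
  have h1 := fderiv_comp a hg hf
  rw [h.fderiv_eq, fderiv_id] at h1
  have h2 := congrArg (fun T : X →L[ℝ] X => T x) h1
  simpa [hx] using h2

section track

variable {m k : ℕ}

/-- The Jacobian matrix, in the directions of the second factor, of `right + χ`. -/
def fibJacobian (χ : Euc (m + k) → Euc k) (z : Euc (m + k)) : Matrix (Fin k) (Fin k) ℝ :=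
  Matrix.of fun i j => (EuclideanSpace.single j (1 : ℝ) +
    fderiv ℝ χ z (inRight m k (EuclideanSpace.single j 1)) : Euc k) i

/-- The smooth map `χ : ℝ^m × ℝ^k → ℝ^k` is the displacement of a family of diffeomorphisms of
`ℝ^k` parametrized by `ℝ^m`, which is compactly supported (with a bound `R` on the square of the
norm). -/
structure IsDisplacement (R : ℝ) (χ : Euc (m + k) → Euc k) : Prop where
  contDiff : ContDiff ℝ ∞ χ
  eq_zero : ∀ z, R < ‖z‖ ^ 2 → χ z = 0
  det_pos : ∀ z, 0 < (fibJacobian χ z).det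
  injective : ∀ z z', left m k z = left m k z' →
    right m k z + χ z = right m k z' + χ z' → z = z'

lemma toEuclideanLin_fibJacobian (χ : Euc (m + k) → Euc k) (z : Euc (m + k)) (y : Euc k) :
    Matrix.toEuclideanLin (fibJacobian χ z) y = y + fderiv ℝ χ z (inRight m k y) := by
  have h : Matrix.toEuclideanLin (fibJacobian χ z)
      = LinearMap.id + ((fderiv ℝ χ z).comp (inRight m k)).toLinearMap := by
    refine (EuclideanSpace.basisFun (Fin k) ℝ).toBasis.ext fun j => ?_
    ext i
    simp [fibJacobian, Matrix.toLpLin_apply]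
  rw [h]
  rfl

/-- The transpose of the orthonormalization of the fibrewise Jacobian. -/
def orthJacobian (χ : Euc (m + k) → Euc k) (z : Euc (m + k)) : Euc k →L[ℝ] Euc k :=
  (Matrix.toEuclideanCLM (𝕜 := ℝ) (n := Fin k) (gramSchmidtMatrix (fibJacobian χ z)).transpose :)

lemma orthJacobian_apply (χ : Euc (m + k) → Euc k) (z : Euc (m + k)) (w : Euc k) :
    orthJacobian χ z w = Matrix.toEuclideanLin (gramSchmidtMatrix (fibJacobian χ z)).transpose w :=
  rfl

/-- The cosine of the rotation angle at the radius `r`. -/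
def cosA (r : ℝ) : ℝ := Real.cos (angle r)

/-- The sine of the rotation angle at the radius `r`. -/
def sinA (r : ℝ) : ℝ := Real.sin (angle r)

lemma contDiff_cosA : ContDiff ℝ ∞ cosA := Real.contDiff_cos.comp contDiff_angle

lemma contDiff_sinA : ContDiff ℝ ∞ sinA := Real.contDiff_sin.comp contDiff_angle

lemma cosA_sq_add_sinA_sq (r : ℝ) : cosA r ^ 2 + sinA r ^ 2 = 1 := Real.cos_sq_add_sin_sq _

lemma sinA_of_le {r : ℝ} (hr : r ≤ 1 / 2) : sinA r = 0 := by simp [sinA, angle_of_le hr]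

lemma cosA_of_ge {r : ℝ} (hr : 3 / 4 ≤ r) : cosA r = 0 := by simp [cosA, angle_of_ge hr]

lemma sinA_of_ge {r : ℝ} (hr : 3 / 4 ≤ r) : sinA r = 1 := by simp [sinA, angle_of_ge hr]

/-- The interpolation between the identity and the map with displacement `χ`, as the radius grows.
These maps need not be injective. -/
def interp (χ : Euc (m + k) → Euc k) (r : ℝ) (z : Euc (m + k)) : Euc (m + k) :=
  z + inRight m k (sinA r ^ 2 • χ z)

variable {N : ℕ} (ι₁ : Euc (m + k + 1) →ₗᵢ[ℝ] Euc N) (ι₂ : Euc k →ₗᵢ[ℝ] Euc N)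

/-- The track in `ℝ^{m+k+1} × ℝ^k` of the isotopy of embeddings
`y ↦ (y + sin² θ χ, sin θ cos θ χ)` from the inclusion to the map with displacement `χ`. The angle
`θ` depends on the radius, and the embeddings are transferred to the spheres by stereographic
projection. -/
def track (χ : Euc (m + k) → Euc k) (v : Euc (m + k + 1)) : Euc N :=
  ι₁ (coneMap (interp χ) v) + ι₂ (polarExtend (fun r z => (cosA r * sinA r) • χ z) (fun _ => 0) v)

/-- Linear maps `ℝ^k → ℝ^N`, depending continuously on a point `v`, that frame a complement of the
tangent space of the track. They interpolate between `ι₂` (for `θ = 0`) and `ι₂` composed with the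
transpose of the orthonormalized Jacobian (for `θ = π / 2`), which is the reason why this Jacobian
becomes the clutching function. -/
def trackFrame (χ : Euc (m + k) → Euc k) : Euc (m + k + 1) → Euc k →L[ℝ] Euc N :=
  polarExtend (fun r z =>
      ι₁.toContinuousLinearMap ∘L
        (r • fderiv ℝ (fun p : Euc (m + k) => (toSphere p : Euc (m + k + 1))) (interp χ r z)) ∘L
        inRight m k ∘L ((cosA r * sinA r) • (ContinuousLinearMap.id ℝ (Euc k) - orthJacobian χ z)) +
      ι₂.toContinuousLinearMap ∘L
        (ContinuousLinearMap.id ℝ (Euc k) +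
          sinA r ^ 2 • (orthJacobian χ z - ContinuousLinearMap.id ℝ (Euc k))))
    fun _ => ι₂.toContinuousLinearMap

variable {ι₁ ι₂} {χ : Euc (m + k) → Euc k} {R : ℝ}

lemma IsDisplacement.fderiv_eq_zero (h : IsDisplacement R χ) {z : Euc (m + k)}
    (hz : R < ‖z‖ ^ 2) : fderiv ℝ χ z = 0 := by
  have : χ =ᶠ[𝓝 z] fun _ => 0 := by
    filter_upwards [(isOpen_lt continuous_const (continuous_norm.pow 2)).mem_nhds hz] with w hw
      using h.eq_zero w hw
  rw [this.fderiv_eq, fderiv_const_apply]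

lemma IsDisplacement.fibJacobian_eq_one (h : IsDisplacement R χ) {z : Euc (m + k)}
    (hz : R < ‖z‖ ^ 2) : fibJacobian χ z = 1 := by
  ext i j
  simp [fibJacobian, h.fderiv_eq_zero hz, Matrix.one_apply]

lemma IsDisplacement.orthJacobian_eq_id (h : IsDisplacement R χ) {z : Euc (m + k)}
    (hz : R < ‖z‖ ^ 2) : orthJacobian χ z = ContinuousLinearMap.id ℝ (Euc k) := by
  ext1 w
  rw [orthJacobian_apply, h.fibJacobian_eq_one hz, gramSchmidtMatrix_one, Matrix.transpose_one,
    toEuclideanLin_one_apply]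
  rfl

lemma IsDisplacement.continuous_fibJacobian (h : IsDisplacement R χ) :
    Continuous (fibJacobian χ) := by
  have h1 : Continuous (fderiv ℝ χ) := h.contDiff.continuous_fderiv (by simp)
  refine continuous_pi fun i => continuous_pi fun j => ?_
  exact (PiLp.continuous_apply 2 (fun _ : Fin k => ℝ) i).comp
    (continuous_const.add (h1.clm_apply continuous_const))

lemma IsDisplacement.continuous_gramSchmidtMatrix (h : IsDisplacement R χ) :
    Continuous fun z => gramSchmidtMatrix (fibJacobian χ z) :=
  (continuousOn_gramSchmidtMatrix k).comp_continuous h.continuous_fibJacobian h.det_pos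

lemma IsDisplacement.continuous_orthJacobian (h : IsDisplacement R χ) :
    Continuous (orthJacobian χ) := by
  have h2 : Continuous (fun A : Matrix (Fin k) (Fin k) ℝ =>
      (Matrix.toEuclideanCLM (𝕜 := ℝ) (n := Fin k) A : Euc k →L[ℝ] Euc k)) :=
    LinearMap.continuous_of_finiteDimensional
      (Matrix.toEuclideanCLM (𝕜 := ℝ) (n := Fin k)).toAlgEquiv.toLinearMap
  exact h2.comp h.continuous_gramSchmidtMatrix.matrix_transpose

lemma IsDisplacement.contDiff_interp (h : IsDisplacement R χ) :
    ContDiff ℝ ∞ (Function.uncurry (interp χ)) := by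
  have h1 : ContDiff ℝ ∞ fun p : ℝ × Euc (m + k) => sinA p.1 ^ 2 • χ p.2 :=
    ((contDiff_sinA.comp contDiff_fst).pow 2).smul (h.contDiff.comp contDiff_snd)
  exact contDiff_snd.add ((inRight m k).contDiff.comp h1)

lemma IsDisplacement.interp_eq_self (h : IsDisplacement R χ) (r : ℝ) {z : Euc (m + k)}
    (hz : R < ‖z‖ ^ 2) : interp χ r z = z := by
  simp [interp, h.eq_zero z hz]

lemma track_eq_of_norm_le {v : Euc (m + k + 1)} (hv : ‖v‖ ≤ 1 / 2) : track ι₁ ι₂ χ v = ι₁ v := by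
  have h1 : coneMap (interp χ) v = v :=
    coneMap_eq_self fun p => by simp [interp, sinA_of_le hv]
  have h2 : polarExtend (fun r z => (cosA r * sinA r) • χ z) (fun _ => 0) v = 0 :=
    polarExtend_eq_of_norm fun p => by simp [sinA_of_le hv]
  rw [track, h1, h2, map_zero, add_zero]

lemma track_eq_of_le_norm {v : Euc (m + k + 1)} (hv : 3 / 4 ≤ ‖v‖) :
    track ι₁ ι₂ χ v = ι₁ (coneMap (fun _ z => z + inRight m k (χ z)) v) := by
  have h1 : coneMap (interp χ) v = coneMap (fun _ z => z + inRight m k (χ z)) v := by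
    by_cases h : v ∈ offPole (m + k)
    · rw [coneMap_of_mem h, coneMap_of_mem h, interp, sinA_of_ge hv, one_pow, one_smul]
    · rw [coneMap_of_notMem h, coneMap_of_notMem h]
  have h2 : polarExtend (fun r z => (cosA r * sinA r) • χ z) (fun _ => 0) v = 0 :=
    polarExtend_eq_of_norm fun p => by simp [cosA_of_ge hv]
  rw [track, h1, h2, map_zero, add_zero]

lemma IsDisplacement.track_eq_of_mem_nearPole (h : IsDisplacement R χ) {v : Euc (m + k + 1)}
    (hv : v ∈ nearPole (m + k) R) : track ι₁ ι₂ χ v = ι₁ v := by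
  have h1 : coneMap (interp χ) v = v := polarExtend_of_mem_nearPole (R := R)
    (fun r p _ hp => by simp [h.interp_eq_self r hp]) hv
  have h2 : polarExtend (fun r z => (cosA r * sinA r) • χ z) (fun _ => 0) v = 0 :=
    polarExtend_of_mem_nearPole (R := R) (fun r p _ hp => by simp [h.eq_zero p hp]) hv
  rw [track, h1, h2, map_zero, add_zero]

lemma track_eventuallyEq_of_norm_lt {v : Euc (m + k + 1)} (hv : ‖v‖ < 1 / 2) :
    track ι₁ ι₂ χ =ᶠ[𝓝 v] ι₁ := by
  filter_upwards [(isOpen_lt continuous_norm continuous_const).mem_nhds hv] with w hw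
    using track_eq_of_norm_le (le_of_lt hw)

lemma IsDisplacement.contDiff_track (h : IsDisplacement R χ) : ContDiff ℝ ∞ (track ι₁ ι₂ χ) := by
  refine contDiff_iff_contDiffAt.mpr fun v => ?_
  rcases eq_or_ne v 0 with rfl | hv
  · exact ι₁.contDiff.contDiffAt.congr_of_eventuallyEq
      (track_eventuallyEq_of_norm_lt (by norm_num))
  · have h1 : ContDiff ℝ ∞ (Function.uncurry fun (r : ℝ) (z : Euc (m + k)) =>
        (cosA r * sinA r) • χ z) :=
      ((contDiff_cosA.mul contDiff_sinA).comp contDiff_fst).smul (h.contDiff.comp contDiff_snd)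
    exact (ι₁.contDiff.contDiffAt.comp v (contDiffAt_coneMap h.contDiff_interp
      (fun r p hp => h.interp_eq_self r hp) hv)).add
      (ι₂.contDiff.contDiffAt.comp v (contDiffAt_polarExtend (R := R) h1 contDiff_const
        (fun r p _ hp => by simp [h.eq_zero p hp]) hv))

lemma IsDisplacement.continuous_trackFrame (h : IsDisplacement R χ) :
    Continuous (trackFrame ι₁ ι₂ χ) := by
  refine continuous_iff_continuousAt.mpr fun v => ?_
  rcases eq_or_ne v 0 with rfl | hv
  · have : trackFrame ι₁ ι₂ χ =ᶠ[𝓝 0] fun _ => ι₂.toContinuousLinearMap := by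
      filter_upwards [(isOpen_lt continuous_norm continuous_const).mem_nhds
        (show ‖(0 : Euc (m + k + 1))‖ < 1 / 2 by norm_num)] with w hw
      refine polarExtend_eq_of_norm fun p => ?_
      ext1 x
      simp [sinA_of_le (le_of_lt hw)]
    exact continuousAt_const.congr this.symm
  · refine continuousAt_polarExtend (R := R) ?_ continuous_const (fun r p _ hp => ?_) hv
    · have hs : Continuous fun p : ℝ × Euc (m + k) => sinA p.1 :=
        contDiff_sinA.continuous.comp continuous_fst
      have hc : Continuous fun p : ℝ × Euc (m + k) => cosA p.1 :=
        contDiff_cosA.continuous.comp continuous_fst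
      have hQ : Continuous fun p : ℝ × Euc (m + k) => orthJacobian χ p.2 :=
        h.continuous_orthJacobian.comp continuous_snd
      have hD : Continuous fun p : ℝ × Euc (m + k) =>
          fderiv ℝ (fun p : Euc (m + k) => (toSphere p : Euc (m + k + 1))) (interp χ p.1 p.2) :=
        (contDiff_toSphere.continuous_fderiv (by simp)).comp h.contDiff_interp.continuous
      refine Continuous.add ?_ ?_
      · exact continuous_const.clm_comp ((continuous_fst.smul hD).clm_comp
          (continuous_const.clm_comp ((hc.mul hs).smul (continuous_const.sub hQ))))
      · exact continuous_const.clm_comp (continuous_const.add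
          ((hs.pow 2).smul (hQ.sub continuous_const)))
    · rw [h.orthJacobian_eq_id hp]
      ext1 x
      simp

lemma trackFrame_of_notMem {v : Euc (m + k + 1)} (hv : v ∉ offPole (m + k)) :
    trackFrame ι₁ ι₂ χ v = ι₂.toContinuousLinearMap := if_neg hv

lemma isometries_eq_zero {E F : Type*} [NormedAddCommGroup E] [InnerProductSpace ℝ E]
    [NormedAddCommGroup F] [InnerProductSpace ℝ F] {ι₁ : E →ₗᵢ[ℝ] Euc N} {ι₂ : F →ₗᵢ[ℝ] Euc N}
    (ho : ∀ a b, inner ℝ (ι₁ a) (ι₂ b) = 0) {a : E} {b : F} (h : ι₁ a + ι₂ b = 0) :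
    a = 0 ∧ b = 0 := by
  have h1 : inner ℝ (ι₁ a) (ι₁ a + ι₂ b) = 0 := by rw [h, inner_zero_right]
  rw [inner_add_right, ho, add_zero, inner_self_eq_zero] at h1
  rw [h1, zero_add] at h
  exact ⟨ι₁.injective (h1.trans (map_zero _).symm), ι₂.injective (h.trans (map_zero _).symm)⟩

lemma isometries_eq {E F : Type*} [NormedAddCommGroup E] [InnerProductSpace ℝ E]
    [NormedAddCommGroup F] [InnerProductSpace ℝ F] {ι₁ : E →ₗᵢ[ℝ] Euc N} {ι₂ : F →ₗᵢ[ℝ] Euc N}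
    (ho : ∀ a b, inner ℝ (ι₁ a) (ι₂ b) = 0) {a a' : E} {b b' : F}
    (h : ι₁ a + ι₂ b = ι₁ a' + ι₂ b') : a = a' ∧ b = b' := by
  have := isometries_eq_zero ho (a := a - a') (b := b - b')
    (by rw [map_sub, map_sub, sub_add_sub_comm, h, sub_self])
  exact ⟨sub_eq_zero.mp this.1, sub_eq_zero.mp this.2⟩

lemma IsDisplacement.track_injective (h : IsDisplacement R χ)
    (ho : ∀ a b, inner ℝ (ι₁ a) (ι₂ b) = 0) : Function.Injective (track ι₁ ι₂ χ) := by
  intro v v' hvv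
  obtain ⟨h1, h2⟩ := isometries_eq ho hvv
  have hn : ‖v‖ = ‖v'‖ := by
    rw [← norm_coneMap (Ψ := interp χ) v, h1, norm_coneMap]
  have hiff : v ∈ offPole (m + k) ↔ v' ∈ offPole (m + k) := by
    rw [← coneMap_mem_offPole (Ψ := interp χ) (v := v), h1, coneMap_mem_offPole]
  by_cases hv : v ∈ offPole (m + k)
  · have hv' := hiff.mp hv
    have hpos := norm_pos_of_mem_offPole hv
    rw [coneMap_of_mem hv, coneMap_of_mem hv', ← hn] at h1
    have h3 := toSphere_injective (Subtype.ext (smul_right_injective _ hpos.ne' h1))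
    rw [polarExtend_of_mem hv, polarExtend_of_mem hv', ← hn] at h2
    have hl : left m k (stereo v) = left m k (stereo v') := by
      simpa [interp] using congrArg (left m k) h3
    have hr : right m k (stereo v) + sinA ‖v‖ ^ 2 • χ (stereo v)
        = right m k (stereo v') + sinA ‖v‖ ^ 2 • χ (stereo v') := by
      simpa [interp] using congrArg (right m k) h3
    have hz : stereo v = stereo v' := by
      have hcs := cosA_sq_add_sinA_sq ‖v‖
      by_cases hs : sinA ‖v‖ = 0
      · rw [hs] at hr
        exact ext_left_right hl (by simpa using hr)
      by_cases hc : cosA ‖v‖ = 0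
      · rw [hc] at hcs
        have hs1 : sinA ‖v‖ ^ 2 = 1 := by simpa using hcs
        rw [hs1, one_smul, one_smul] at hr
        exact h.injective _ _ hl hr
      · have h4 := smul_right_injective _ (mul_ne_zero hc hs) h2
        rw [h4] at hr
        exact ext_left_right hl (add_right_cancel hr)
    rw [← norm_smul_toSphere_stereo hv, ← norm_smul_toSphere_stereo hv', hz, hn]
  · rwa [coneMap_of_notMem hv, coneMap_of_notMem (mt hiff.mpr hv)] at h1

/-- The polar coordinates `(r, p) ↦ r • toSphere p` have injective differentials. -/
lemma polar_fderiv_injective {n : ℕ} {r : ℝ} (hr : 0 < r) (p : Euc n) {ρ : ℝ} {ζ : Euc n}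
    (h : ρ • (toSphere p : Euc (n + 1)) +
      r • fderiv ℝ (fun p : Euc n => (toSphere p : Euc (n + 1))) p ζ = 0) : ρ = 0 ∧ ζ = 0 := by
  let f : ℝ × Euc n → Euc (n + 1) := fun q => q.1 • (toSphere q.2 : Euc (n + 1))
  have hs : HasFDerivAt (fun p : Euc n => (toSphere p : Euc (n + 1)))
      (fderiv ℝ (fun p : Euc n => (toSphere p : Euc (n + 1))) p) p :=
    (contDiff_toSphere.differentiable (by simp) p).hasFDerivAt
  have hf := (hasFDerivAt_fst (𝕜 := ℝ) (p := (r, p))).smul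
    (HasFDerivAt.comp (r, p) (f := Prod.snd) hs hasFDerivAt_snd)
  have hmem : f (r, p) ∈ offPole n := smul_toSphere_mem_offPole hr p
  have hg : DifferentiableAt ℝ (fun v : Euc (n + 1) => (‖v‖, stereo v)) (f (r, p)) :=
    ((contDiffAt_norm_of_mem_offPole hmem).prodMk (contDiffAt_stereo hmem)).differentiableAt
      (by simp)
  have hgf : (fun v : Euc (n + 1) => (‖v‖, stereo v)) ∘ f =ᶠ[𝓝 (r, p)] id := by
    filter_upwards [(isOpen_lt continuous_const continuous_fst).mem_nhds
      (show (0 : ℝ) < (r, p).1 from hr)] with q hq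
    exact Prod.ext (norm_smul_toSphere (le_of_lt hq) q.2) (stereo_smul_toSphere hq q.2)
  have h0 : fderiv ℝ f (r, p) (ρ, ζ) = 0 := by
    rw [show fderiv ℝ f (r, p) = _ from hf.fderiv]
    refine Eq.trans ?_ h
    simp [add_comm]
  exact Prod.ext_iff.mp (fderiv_injective_of_leftInverse hf.differentiableAt hg hgf h0)

/-- At each point, the tangent space of the track and the complement given by `trackFrame` are
independent. -/
lemma IsDisplacement.fderiv_track_add_trackFrame (h : IsDisplacement R χ)
    (ho : ∀ a b, inner ℝ (ι₁ a) (ι₂ b) = 0) (v : Euc (m + k + 1)) (x : Euc (m + k + 1)) (w : Euc k)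
    (hxw : fderiv ℝ (track ι₁ ι₂ χ) v x + trackFrame ι₁ ι₂ χ v w = 0) : x = 0 ∧ w = 0 := by
  by_cases hv : v ∈ offPole (m + k)
  · set r := ‖v‖ with hr
    set z := stereo v with hz
    have hr0 : 0 < r := norm_pos_of_mem_offPole hv
    have hnorm : HasFDerivAt (fun v : Euc (m + k + 1) => ‖v‖) _ v :=
      ((contDiffAt_norm_of_mem_offPole hv).differentiableAt (by simp)).hasFDerivAt
    have hster : HasFDerivAt (stereo (n := m + k)) _ v :=
      ((contDiffAt_stereo hv).differentiableAt (by simp)).hasFDerivAt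
    set ρ := fderiv ℝ (fun v : Euc (m + k + 1) => ‖v‖) v x with hρ
    set ζ := fderiv ℝ (stereo (n := m + k)) v x with hζ
    have hint : HasFDerivAt (Function.uncurry (interp χ)) _ (r, z) :=
      (h.contDiff_interp.differentiable (by simp) _).hasFDerivAt
    have hsp : HasFDerivAt (fun p : Euc (m + k) => (toSphere p : Euc (m + k + 1)))
        _ (interp χ r z) := (contDiff_toSphere.differentiable (by simp) _).hasFDerivAt
    have hcs : HasDerivAt (fun r => cosA r * sinA r) _ r :=
      ((contDiff_cosA.mul contDiff_sinA).differentiable (by simp) r).hasDerivAt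
    have hχ : HasFDerivAt χ (fderiv ℝ χ z) z := (h.contDiff.differentiable (by simp) z).hasFDerivAt
    -- the derivative of the interpolation, in the directions with a fixed radius
    have hint0 : ∀ ζ, fderiv ℝ (Function.uncurry (interp χ)) (r, z) (0, ζ)
        = ζ + inRight m k (sinA r ^ 2 • fderiv ℝ χ z ζ) := by
      intro ζ
      have h1 : HasFDerivAt (fun z => interp χ r z)
          (ContinuousLinearMap.id ℝ _ + inRight m k ∘L (sinA r ^ 2 • fderiv ℝ χ z)) z :=
        (hasFDerivAt_id z).add ((inRight m k).hasFDerivAt.comp z (hχ.fun_const_smul _))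
      have h2 := HasFDerivAt.comp z (f := fun z => (r, z)) hint (hasFDerivAt_prodMk_right r z)
      have h3 := congrArg (fun T : Euc (m + k) →L[ℝ] Euc (m + k) => T ζ) (h2.unique h1)
      simpa using h3
    have hin := HasFDerivAt.comp v (f := fun v : Euc (m + k + 1) => (‖v‖, stereo v)) hint
      (hnorm.prodMk hster)
    have hA := hnorm.smul (HasFDerivAt.comp v
      (f := Function.uncurry (interp χ) ∘ fun v : Euc (m + k + 1) => (‖v‖, stereo v)) hsp hin)
    have hB := (HasDerivAt.comp_hasFDerivAt v hcs hnorm).smul (HasFDerivAt.comp v hχ hster)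
    have htr := (ι₁.toContinuousLinearMap.hasFDerivAt.comp v hA).add
      (ι₂.toContinuousLinearMap.hasFDerivAt.comp v hB)
    have htrack := htr.congr_of_eventuallyEq (f₁ := track ι₁ ι₂ χ) (by
      filter_upwards [isOpen_offPole.mem_nhds hv] with v' hv'
      exact congrArg₂ (fun a b => ι₁ a + ι₂ b) (coneMap_of_mem hv') (polarExtend_of_mem hv'))
    rw [htrack.fderiv, trackFrame, polarExtend_of_mem hv] at hxw
    have hsum := isometries_eq_zero ho
      (a := (ρ • (toSphere (interp χ r z) : Euc (m + k + 1)) +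
        r • fderiv ℝ (fun p : Euc (m + k) => (toSphere p : Euc (m + k + 1))) (interp χ r z)
          (fderiv ℝ (Function.uncurry (interp χ)) (r, z) (ρ, ζ) +
            inRight m k ((cosA r * sinA r) • (w - orthJacobian χ z w)))))
      (b := (cosA r * sinA r) • fderiv ℝ χ z ζ + (deriv (fun r => cosA r * sinA r) r * ρ) • χ z +
        (w + sinA r ^ 2 • (orthJacobian χ z w - w))) (by
        rw [← hxw]
        simp only [map_add, map_smul, smul_add]
        simp [hρ, hζ, hr, hz]
        module)
    obtain ⟨ha, hb⟩ := hsum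
    -- the radial component vanishes, and the horizontal one is in the direction of the fibre; this
    -- leaves the linear algebra of a rotated graph
    obtain ⟨hρ0, hζ0⟩ := polar_fderiv_injective hr0 _ ha
    rw [hρ0, hint0] at hζ0
    have hζl : left m k ζ = 0 := by simpa using congrArg (left m k) hζ0
    obtain ⟨y, hy⟩ : ∃ y, ζ = inRight m k y :=
      ⟨right m k ζ, ext_left_right (by simpa using hζl) (by simp)⟩
    have hAy := toEuclideanLin_fibJacobian χ z y
    have e1 : (y + sinA r ^ 2 • (Matrix.toEuclideanLin (fibJacobian χ z) y - y)) +
        (cosA r * sinA r) • (w - orthJacobian χ z w) = 0 := by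
      have := congrArg (right m k) hζ0
      rw [hAy, add_sub_cancel_left]
      simpa [hy] using this
    have e2 : (cosA r * sinA r) • (Matrix.toEuclideanLin (fibJacobian χ z) y - y) +
        (w + sinA r ^ 2 • (orthJacobian χ z w - w)) = 0 := by
      rw [hAy, add_sub_cancel_left]
      simpa [hρ0, hy] using hb
    obtain ⟨hy0, hw0⟩ := graph_complement (h.det_pos z) (cosA_sq_add_sinA_sq r) rfl
      (orthJacobian_apply χ z w) e1 e2
    refine ⟨?_, hw0⟩
    refine fderiv_injective_of_leftInverse (f := fun v : Euc (m + k + 1) => (‖v‖, stereo v))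
      (g := fun q : ℝ × Euc (m + k) => q.1 • (toSphere q.2 : Euc (m + k + 1)))
      (hnorm.prodMk hster).differentiableAt
      ((contDiff_fst.smul (contDiff_toSphere.comp contDiff_snd)).differentiable (by simp) _) ?_
      (a := v) ?_
    · filter_upwards [isOpen_offPole.mem_nhds hv] with v' hv' using norm_smul_toSphere_stereo hv'
    · rw [(hnorm.prodMk hster).fderiv]
      refine Prod.ext hρ0 ?_
      change ζ = 0
      rw [hy, hy0, map_zero]
  · have heq : track ι₁ ι₂ χ =ᶠ[𝓝 v] ι₁.toContinuousLinearMap := by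
      rcases eq_or_ne v 0 with rfl | hv0
      · exact track_eventuallyEq_of_norm_lt (by norm_num)
      · have hv' := (mem_offPole_or_mem_nearPole R hv0).resolve_left hv
        filter_upwards [(isOpen_nearPole R).mem_nhds hv'] with v' hv'
          using h.track_eq_of_mem_nearPole hv'
    rw [heq.fderiv_eq, trackFrame_of_notMem hv, ContinuousLinearMap.fderiv] at hxw
    exact isometries_eq_zero ho hxw

end track

/-! ### Closing the track to a sphere by an inversion -/

section closing

open EuclideanGeometry

variable {m k N : ℕ}

lemma hasFDerivAt_inversion_one {p z : Euc N} (hz : z ≠ p) :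
    HasFDerivAt (inversion p 1) (fderiv ℝ (inversion p 1) z) z :=
  (hasFDerivAt_inversion (R := 1) hz).differentiableAt.hasFDerivAt

/-- Inversions are conformal. -/
lemma inner_fderiv_inversion {p z : Euc N} (hz : z ≠ p) (a b : Euc N) :
    inner ℝ (fderiv ℝ (inversion p 1) z a) (fderiv ℝ (inversion p 1) z b)
      = ((1 / dist z p) ^ 2) ^ 2 * inner ℝ a b := by
  rw [(hasFDerivAt_inversion hz).fderiv]
  simp only [smul_apply, inner_smul_left, inner_smul_right, conj_trivial]
  have : inner ℝ (((ℝ ∙ (z - p))ᗮ.reflection : Euc N →L[ℝ] Euc N) a)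
      (((ℝ ∙ (z - p))ᗮ.reflection : Euc N →L[ℝ] Euc N) b) = inner ℝ a b :=
    LinearIsometryEquiv.inner_map_map _ a b
  rw [this]
  ring

lemma eq_zero_of_fderiv_inversion {p z : Euc N} (hz : z ≠ p) {a : Euc N}
    (h : fderiv ℝ (inversion p 1) z a = 0) : a = 0 := by
  have h1 := inner_fderiv_inversion hz a a
  rw [h, inner_zero_left, eq_comm, mul_eq_zero] at h1
  refine inner_self_eq_zero.mp (h1.resolve_left ?_)
  have := dist_pos.mpr hz
  positivity

lemma continuousAt_fderiv_inversion {p z : Euc N} (hz : z ≠ p) :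
    ContinuousAt (fderiv ℝ (inversion p 1)) z := by
  have h : ContDiffAt ℝ ∞ (inversion p (1 : ℝ)) z :=
    ContDiffAt.inversion contDiffAt_const contDiffAt_const contDiffAt_id hz
  exact (h.fderiv_right (m := 0) (by simp)).continuousAt

variable (ι₁ : Euc (m + k + 1) →ₗᵢ[ℝ] Euc N) (ι₂ : Euc k →ₗᵢ[ℝ] Euc N) (e : Euc k)

/-- The track of an isotopy, moved by the inversion at a point that is not on it. The closure of
the image is a sphere, to which the center of the inversion is added. -/
def closedTrack (χ : Euc (m + k) → Euc k) (v : Euc (m + k + 1)) : Euc N :=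
  inversion (ι₂ e) 1 (track ι₁ ι₂ χ v)

/-- Linear maps `ℝ^k → ℝ^N` that frame a complement of the tangent space of the closed track. -/
def closedTrackFrame (χ : Euc (m + k) → Euc k) (v : Euc (m + k + 1)) : Euc k →L[ℝ] Euc N :=
  fderiv ℝ (inversion (ι₂ e) 1) (track ι₁ ι₂ χ v) ∘L trackFrame ι₁ ι₂ χ v

/-- The closed track near the center of the inversion, where it is a round sphere. -/
def cap (w : Euc (m + k + 1)) : Euc N :=
  ι₂ e + (1 + ‖w‖ ^ 2)⁻¹ • (ι₁ w - ‖w‖ ^ 2 • ι₂ e)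

variable {ι₁ ι₂ e} {χ : Euc (m + k) → Euc k} {R : ℝ}

lemma ne_center (ho : ∀ a b, inner ℝ (ι₁ a) (ι₂ b) = 0) (he : ‖e‖ = 1) (y : Euc (m + k + 1)) :
    ι₁ y ≠ ι₂ e := by
  intro h
  have := (isometries_eq ho (a := y) (a' := 0) (b := 0) (b' := e) (by simpa using h)).2
  rw [← this, norm_zero] at he
  exact zero_ne_one he

lemma dist_center_sq (ho : ∀ a b, inner ℝ (ι₁ a) (ι₂ b) = 0) (he : ‖e‖ = 1)
    (y : Euc (m + k + 1)) : dist (ι₁ y) (ι₂ e) ^ 2 = 1 + ‖y‖ ^ 2 := by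
  rw [dist_eq_norm, norm_sub_sq_real, ho, ι₁.norm_map, ι₂.norm_map, he]
  ring

lemma track_ne_center (ho : ∀ a b, inner ℝ (ι₁ a) (ι₂ b) = 0) (he : ‖e‖ = 1)
    (v : Euc (m + k + 1)) : track ι₁ ι₂ χ v ≠ ι₂ e := by
  intro h
  have h1 := (isometries_eq ho (a' := 0) (b' := e) (h.trans (by simp))).1
  have h2 : v = 0 := by rw [← norm_eq_zero, ← norm_coneMap (Ψ := interp χ) v, h1, norm_zero]
  subst h2
  rw [track_eq_of_norm_le (by norm_num)] at h
  exact ne_center ho he 0 h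

lemma IsDisplacement.contDiff_closedTrack (h : IsDisplacement R χ)
    (ho : ∀ a b, inner ℝ (ι₁ a) (ι₂ b) = 0) (he : ‖e‖ = 1) :
    ContDiff ℝ ∞ (closedTrack ι₁ ι₂ e χ) :=
  ContDiff.inversion contDiff_const contDiff_const h.contDiff_track (track_ne_center ho he)

lemma IsDisplacement.closedTrack_injective (h : IsDisplacement R χ)
    (ho : ∀ a b, inner ℝ (ι₁ a) (ι₂ b) = 0) : Function.Injective (closedTrack ι₁ ι₂ e χ) :=
  (inversion_injective _ one_ne_zero).comp (h.track_injective ho)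

lemma closedTrack_ne_center (ho : ∀ a b, inner ℝ (ι₁ a) (ι₂ b) = 0) (he : ‖e‖ = 1)
    (v : Euc (m + k + 1)) : closedTrack ι₁ ι₂ e χ v ≠ ι₂ e := fun h =>
  track_ne_center ho he v ((inversion_eq_center one_ne_zero).mp h)

lemma IsDisplacement.fderiv_closedTrack (h : IsDisplacement R χ)
    (ho : ∀ a b, inner ℝ (ι₁ a) (ι₂ b) = 0) (he : ‖e‖ = 1) (v : Euc (m + k + 1)) :
    fderiv ℝ (closedTrack ι₁ ι₂ e χ) v
      = fderiv ℝ (inversion (ι₂ e) 1) (track ι₁ ι₂ χ v) ∘L fderiv ℝ (track ι₁ ι₂ χ) v :=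
  ((hasFDerivAt_inversion_one (track_ne_center ho he v)).comp v
    (h.contDiff_track.differentiable (by simp) v).hasFDerivAt).fderiv

lemma IsDisplacement.fderiv_closedTrack_add (h : IsDisplacement R χ)
    (ho : ∀ a b, inner ℝ (ι₁ a) (ι₂ b) = 0) (he : ‖e‖ = 1) (v x : Euc (m + k + 1)) (w : Euc k)
    (hxw : fderiv ℝ (closedTrack ι₁ ι₂ e χ) v x + closedTrackFrame ι₁ ι₂ e χ v w = 0) :
    x = 0 ∧ w = 0 := by
  rw [h.fderiv_closedTrack ho he, closedTrackFrame, ContinuousLinearMap.comp_apply,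
    ContinuousLinearMap.comp_apply, ← map_add] at hxw
  exact h.fderiv_track_add_trackFrame ho v x w
    (eq_zero_of_fderiv_inversion (track_ne_center ho he v) hxw)

lemma IsDisplacement.continuous_closedTrackFrame (h : IsDisplacement R χ)
    (ho : ∀ a b, inner ℝ (ι₁ a) (ι₂ b) = 0) (he : ‖e‖ = 1) :
    Continuous (closedTrackFrame ι₁ ι₂ e χ) := by
  refine Continuous.clm_comp ?_ h.continuous_trackFrame
  refine continuous_iff_continuousAt.mpr fun v => ?_
  exact ContinuousAt.comp (f := track ι₁ ι₂ χ)
    (continuousAt_fderiv_inversion (track_ne_center ho he v))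
    h.contDiff_track.continuous.continuousAt

lemma inversion_eq_cap (ho : ∀ a b, inner ℝ (ι₁ a) (ι₂ b) = 0) (he : ‖e‖ = 1)
    {w : Euc (m + k + 1)} (hw : w ≠ 0) :
    inversion (ι₂ e) 1 (ι₁ ((‖w‖ ^ 2)⁻¹ • w)) = cap ι₁ ι₂ e w := by
  have hw' := norm_pos_iff.mpr hw
  rw [inversion, div_pow, dist_center_sq ho he, norm_smul, norm_inv, norm_pow, norm_norm, cap,
    vsub_eq_sub, vadd_eq_add, add_comm, map_smul]
  congr 1
  have h1 : (1 + ‖w‖ ^ 2)⁻¹ • (ι₁ w - ‖w‖ ^ 2 • ι₂ e)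
      = ((1 + ‖w‖ ^ 2)⁻¹ * ‖w‖ ^ 2) • ((‖w‖ ^ 2)⁻¹ • ι₁ w - ι₂ e) := by
    rw [smul_sub, smul_sub, smul_smul, smul_smul, mul_assoc, mul_inv_cancel₀ (by positivity),
      mul_one]
  rw [h1]
  congr 1
  field_simp
  ring

lemma contDiff_cap : ContDiff ℝ ∞ (cap ι₁ ι₂ e) := by
  have hn : ContDiff ℝ ∞ fun w : Euc (m + k + 1) => ‖w‖ ^ 2 := contDiff_norm_sq ℝ
  refine contDiff_const.add (((contDiff_const.add hn).inv fun w => by positivity).smul ?_)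
  exact ι₁.contDiff.sub (hn.smul contDiff_const)

lemma fderiv_cap_zero : fderiv ℝ (cap ι₁ ι₂ e) 0 = ι₁.toContinuousLinearMap := by
  have hn : HasFDerivAt (fun w : Euc (m + k + 1) => ‖w‖ ^ 2)
      (0 : Euc (m + k + 1) →L[ℝ] ℝ) 0 := by
    have := (hasStrictFDerivAt_norm_sq (0 : Euc (m + k + 1))).hasFDerivAt
    simpa using this
  have h1 : HasFDerivAt (fun w : Euc (m + k + 1) => (1 + ‖w‖ ^ 2)⁻¹)
      (0 : Euc (m + k + 1) →L[ℝ] ℝ) 0 := by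
    have h2 := (hasDerivAt_inv (x := 1 + ‖(0 : Euc (m + k + 1))‖ ^ 2) (by simp)).comp_hasFDerivAt
      (0 : Euc (m + k + 1)) (f := fun w : Euc (m + k + 1) => 1 + ‖w‖ ^ 2) (hn.const_add 1)
    exact h2.congr_fderiv (by simp)
  have h3 := h1.smul (ι₁.toContinuousLinearMap.hasFDerivAt.sub (hn.smul_const (ι₂ e)))
  have h4 := h3.const_add (ι₂ e)
  refine Eq.trans (HasFDerivAt.fderiv h4) ?_
  ext1 x
  simp

lemma fderiv_inversion_normal (ho : ∀ a b, inner ℝ (ι₁ a) (ι₂ b) = 0) (he : ‖e‖ = 1)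
    (y : Euc (m + k + 1)) (w : Euc k) :
    fderiv ℝ (inversion (ι₂ e) 1) (ι₁ y) (ι₂ w)
      = (1 + ‖y‖ ^ 2)⁻¹ • (ι₂ w + (2 * inner ℝ e w / (1 + ‖y‖ ^ 2)) • (ι₁ y - ι₂ e)) := by
  have hd := dist_center_sq ho he y
  rw [(hasFDerivAt_inversion (ne_center ho he y)).fderiv, smul_apply, div_pow, hd, one_pow,
    one_div]
  congr 1
  change (ℝ ∙ (ι₁ y - ι₂ e))ᗮ.reflection (ι₂ w) = _
  rw [Submodule.reflection_orthogonal_apply, Submodule.reflection_singleton_apply]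
  rw [dist_eq_norm] at hd
  simp only [RCLike.ofReal_real_eq_id, id_eq]
  rw [hd, inner_sub_left, ho, ι₂.inner_map_map]
  module

end closing

/-! ### Two disks glued along a diffeomorphism of the sphere -/

section gluing

variable {d : ℕ} {M : Type}

/-- The manifold `M` is covered by the parametrizations `c₀` and `c₁` by `ℝ^d`, with transition
`v ↦ C v / |v|²` away from the origins. -/
structure IsGluing [TopologicalSpace M] [ChartedSpace (Euc d) M] (C : Euc d → Euc d)
    (c₀ c₁ : Euc d → M) : Prop where
  local₀ : IsLocalDiffeomorph (𝓡 d) (𝓡 d) ∞ c₀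
  local₁ : IsLocalDiffeomorph (𝓡 d) (𝓡 d) ∞ c₁
  injective₀ : Function.Injective c₀
  cover : ∀ q, (∃ v, q = c₀ v) ∨ q = c₁ 0
  ne_zero : ∀ v, c₀ v ≠ c₁ 0
  glue : ∀ v ≠ 0, c₀ v = c₁ ((‖v‖ ^ 2)⁻¹ • C v)
  glue' : ∀ w ≠ 0, ∃ v ≠ 0, c₁ w = c₀ v ∧ C v = (‖w‖ ^ 2)⁻¹ • w

lemma IsTwistedSphere.exists_isGluing {n : ℕ} {M : Type} [TopologicalSpace M]
    [ChartedSpace (Euc (n + 1)) M] {φ : Sph n ≃ₘ^∞⟮𝓡 n, 𝓡 n⟯ Sph n} {Φ : Euc n → Euc n}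
    (hφ : IsExtension Φ φ) (h : IsTwistedSphere φ M) :
    ∃ c₀ c₁ : Euc (n + 1) → M, IsGluing (coneMap fun _ => Φ) c₀ c₁ := by
  obtain ⟨c₀, c₁, hl₀, hi₀, hl₁, -, hcov, hglue⟩ := h
  have key : ∀ (t : ℝ) (u : Sph n), 0 < t → coneMap (fun _ => Φ) (t • (u : Euc (n + 1)))
      = t • (φ u : Euc (n + 1)) := fun t u ht => by
    rw [coneMap_smul Φ ht, hφ.coe_eq_coneMap]
  have hnorm : ∀ (t : ℝ) (u : Sph n), 0 < t → ‖t • (u : Euc (n + 1))‖ = t := fun t u ht => by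
    rw [norm_smul, norm_sphere, mul_one, Real.norm_eq_abs, abs_of_pos ht]
  have hpolar : ∀ v : Euc (n + 1), v ≠ 0 →
      ∃ (t : ℝ) (u : Sph n), 0 < t ∧ v = t • (u : Euc (n + 1)) := fun v hv => ⟨‖v‖, ⟨‖v‖⁻¹ • v, by
      rw [mem_sphere_zero_iff_norm, norm_smul, norm_inv, norm_norm,
        inv_mul_cancel₀ (norm_ne_zero_iff.mpr hv)]⟩, norm_pos_iff.mpr hv, by
      rw [smul_smul, mul_inv_cancel₀ (norm_ne_zero_iff.mpr hv), one_smul]⟩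
  have hg' : ∀ w ≠ 0, ∃ v ≠ 0, c₁ w = c₀ v ∧ coneMap (fun _ => Φ) v = (‖w‖ ^ 2)⁻¹ • w := by
    intro w hw
    obtain ⟨t, u, ht, rfl⟩ := hpolar w hw
    have ht' : 0 < t⁻¹ := inv_pos.mpr ht
    refine ⟨t⁻¹ • (φ.symm u : Euc (n + 1)), ?_, ?_, ?_⟩
    · rw [← norm_pos_iff, hnorm _ _ ht']
      exact ht'
    · exact ((hglue _ _).mpr ⟨t⁻¹, ht', φ.symm u, rfl, by simp⟩).symm
    · rw [key _ _ ht', hnorm _ _ ht, smul_smul, φ.apply_symm_apply]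
      congr 1
      field_simp
  refine ⟨c₀, c₁, hl₀, hl₁, hi₀, fun q => ?_, fun v hv => ?_, fun v hv => ?_, hg'⟩
  · have hq : q ∈ Set.range c₀ ∪ Set.range c₁ := hcov ▸ Set.mem_univ q
    rcases hq with ⟨v, rfl⟩ | ⟨w, rfl⟩
    · exact Or.inl ⟨v, rfl⟩
    · rcases eq_or_ne w 0 with rfl | hw
      · exact Or.inr rfl
      · obtain ⟨v, -, hv, -⟩ := hg' w hw
        exact Or.inl ⟨v, hv⟩
  · obtain ⟨t, ht, u, -, h0⟩ := (hglue _ _).mp hv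
    have := hnorm t⁻¹ (φ u) (inv_pos.mpr ht)
    rw [← h0, norm_zero] at this
    exact (inv_pos.mpr ht).ne this
  · obtain ⟨t, u, ht, rfl⟩ := hpolar v hv
    refine (hglue _ _).mpr ⟨t, ht, u, rfl, ?_⟩
    rw [key _ _ ht, hnorm _ _ ht, smul_smul]
    congr 1
    field_simp

lemma left_toSphere (v : Euc d) :
    left d 1 (toSphere v : Euc (d + 1)) = (2 / (‖v‖ ^ 2 + 1)) • v := by
  ext i
  rw [left_apply]
  refine (toSphere_castSucc v i).trans ?_
  simp only [PiLp.smul_apply, smul_eq_mul]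
  ring

lemma height_toSphere (v : Euc d) : height (toSphere v) = (‖v‖ ^ 2 - 1) / (‖v‖ ^ 2 + 1) :=
  toSphere_last v

lemma norm_sq_left_add_height (η : Sph d) :
    ‖left d 1 (η : Euc (d + 1))‖ ^ 2 + height η ^ 2 = 1 := by
  have h := norm_sq_eq_sum_last (η : Euc (d + 1))
  rw [norm_sphere] at h
  rw [EuclideanSpace.real_norm_sq_eq]
  exact h.symm.trans (one_pow 2)

lemma mem_offPole_sphere {η : Sph d} : (η : Euc (d + 1)) ∈ offPole d ↔ height η < 1 := by
  rw [offPole, Set.mem_ofPred_eq, norm_sphere]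
  rfl

lemma height_eq_one {η : Sph d} (h : (η : Euc (d + 1)) ∉ offPole d) : height η = 1 := by
  refine le_antisymm ?_ (not_lt.mp (mt mem_offPole_sphere.mpr h))
  nlinarith [norm_sq_left_add_height η, sq_nonneg ‖left d 1 (η : Euc (d + 1))‖]

lemma left_eq_zero {η : Sph d} (h : (η : Euc (d + 1)) ∉ offPole d) :
    left d 1 (η : Euc (d + 1)) = 0 := by
  have := norm_sq_left_add_height η
  rw [height_eq_one h] at this
  simpa using this

lemma continuous_height : Continuous (height (d := d)) :=
  continuous_last.comp continuous_subtype_val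

lemma eq_of_notMem_offPole {η η' : Sph d} (h : (η : Euc (d + 1)) ∉ offPole d)
    (h' : (η' : Euc (d + 1)) ∉ offPole d) : η = η' := by
  refine Subtype.ext (ext_left_right (m := d) (k := 1) ?_ ?_)
  · rw [left_eq_zero h, left_eq_zero h']
  · ext i
    have hi : Fin.natAdd d i = Fin.last d := by ext; simp
    rw [right_apply, right_apply, hi]
    exact (height_eq_one h).trans (height_eq_one h').symm

open Classical in
/-- The map from the sphere to the union of two disks that is `c₀` in the stereographic coordinates
and sends the north pole to the center of the other disk. -/
def sphereMap (c₀ c₁ : Euc d → M) (η : Sph d) : M :=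
  if (η : Euc (d + 1)) ∈ offPole d then c₀ (stereo (η : Euc (d + 1))) else c₁ 0

variable {C : Euc d → Euc d} {c₀ c₁ : Euc d → M}

lemma sphereMap_toSphere (v : Euc d) : sphereMap c₀ c₁ (toSphere v) = c₀ v := by
  rw [sphereMap, if_pos (mem_range_toSphere_iff.mp ⟨v, rfl⟩), stereo_toSphere]

lemma sphereMap_of_notMem {η : Sph d} (h : (η : Euc (d + 1)) ∉ offPole d) :
    sphereMap c₀ c₁ η = c₁ 0 := if_neg h

variable [TopologicalSpace M] [ChartedSpace (Euc d) M]

lemma IsGluing.sphereMap_bijective (h : IsGluing C c₀ c₁) :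
    Function.Bijective (sphereMap c₀ c₁) := by
  constructor
  · intro η η' hη
    by_cases h1 : (η : Euc (d + 1)) ∈ offPole d <;> by_cases h2 : (η' : Euc (d + 1)) ∈ offPole d
    · obtain ⟨v, rfl⟩ := mem_range_toSphere_iff.mpr h1
      obtain ⟨v', rfl⟩ := mem_range_toSphere_iff.mpr h2
      rw [sphereMap_toSphere, sphereMap_toSphere] at hη
      rw [h.injective₀ hη]
    · obtain ⟨v, rfl⟩ := mem_range_toSphere_iff.mpr h1
      rw [sphereMap_toSphere, sphereMap_of_notMem h2] at hη
      exact absurd hη (h.ne_zero v)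
    · obtain ⟨v', rfl⟩ := mem_range_toSphere_iff.mpr h2
      rw [sphereMap_toSphere, sphereMap_of_notMem h1] at hη
      exact absurd hη.symm (h.ne_zero v')
    · exact eq_of_notMem_offPole h1 h2
  · intro q
    rcases h.cover q with ⟨v, rfl⟩ | rfl
    · exact ⟨toSphere v, sphereMap_toSphere v⟩
    · have hN : ‖(EuclideanSpace.single (Fin.last d) 1 : Euc (d + 1))‖ = 1 := by simp
      refine ⟨⟨EuclideanSpace.single (Fin.last d) 1, mem_sphere_zero_iff_norm.mpr hN⟩,
        sphereMap_of_notMem ?_⟩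
      rw [mem_offPole_sphere]
      simp [height]

lemma IsGluing.continuous_sphereMap (h : IsGluing C c₀ c₁) (hC : Continuous C) (hC0 : C 0 = 0)
    (hCs : ∀ t : ℝ, 0 < t → ∀ v, C (t • v) = t • C v) : Continuous (sphereMap c₀ c₁) := by
  refine continuous_iff_continuousAt.mpr fun η => ?_
  by_cases hη : (η : Euc (d + 1)) ∈ offPole d
  · have h1 : sphereMap c₀ c₁ =ᶠ[𝓝 η] fun η => c₀ (stereo (η : Euc (d + 1))) := by
      filter_upwards [(isOpen_offPole.preimage continuous_subtype_val).mem_nhds hη] with η' h'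
        using if_pos h'
    refine ContinuousAt.congr ?_ h1.symm
    exact h.local₀.contMDiff.continuous.continuousAt.comp
      (ContinuousAt.comp (g := stereo) (contDiffAt_stereo hη).continuousAt
        continuous_subtype_val.continuousAt)
  · -- near the north pole, the map is expressed through the other disk
    have h1 : sphereMap c₀ c₁ =ᶠ[𝓝 η]
        fun η => c₁ (C ((1 + height η)⁻¹ • left d 1 (η : Euc (d + 1)))) := by
      filter_upwards [(isOpen_lt continuous_const continuous_height).mem_nhds
        (show (-1 : ℝ) < height η by rw [height_eq_one hη]; norm_num)] with η' h'
      by_cases hη' : (η' : Euc (d + 1)) ∈ offPole d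
      · obtain ⟨v, rfl⟩ := mem_range_toSphere_iff.mpr hη'
        have hh : 1 + height (toSphere v) = 2 * ‖v‖ ^ 2 / (‖v‖ ^ 2 + 1) := by
          rw [height_toSphere]; field_simp; ring
        have hv : v ≠ 0 := by
          rintro rfl
          rw [height_toSphere] at h'
          norm_num at h'
        have hv' := norm_pos_iff.mpr hv
        rw [sphereMap_toSphere, h.glue v hv, hh, left_toSphere, smul_smul,
          ← hCs _ (by positivity)]
        congr 3
        field_simp
      · rw [sphereMap_of_notMem hη', left_eq_zero hη', smul_zero, hC0]
    refine ContinuousAt.congr ?_ h1.symm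
    refine h.local₁.contMDiff.continuous.continuousAt.comp (hC.continuousAt.comp ?_)
    refine ContinuousAt.smul (ContinuousAt.inv₀
      (continuous_const.add continuous_height).continuousAt ?_) (by fun_prop)
    change 1 + height η ≠ 0
    rw [height_eq_one hη]
    norm_num

/-- The sphere is homeomorphic to the union of two disks, by the Alexander trick. -/
def IsGluing.homeomorph [T2Space M] (h : IsGluing C c₀ c₁) (hC : Continuous C) (hC0 : C 0 = 0)
    (hCs : ∀ t : ℝ, 0 < t → ∀ v, C (t • v) = t • C v) : Sph d ≃ₜ M :=
  Continuous.homeoOfEquivCompactToT2 (f := Equiv.ofBijective _ h.sphereMap_bijective)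
    (h.continuous_sphereMap hC hC0 hCs)

open Classical in
/-- The map on the union of two disks that is `f` on the first one and takes the value `p` at the
center of the second. -/
def fromDisk {Y : Type*} (c₀ : Euc d → M) (f : Euc d → Y) (p : Y) (q : M) : Y :=
  if h : ∃ v, q = c₀ v then f h.choose else p

lemma IsGluing.fromDisk_apply {Y : Type*} {f : Euc d → Y} {p : Y} (h : IsGluing C c₀ c₁)
    (v : Euc d) : fromDisk c₀ f p (c₀ v) = f v := by
  have hv : ∃ v', c₀ v = c₀ v' := ⟨v, rfl⟩
  rw [fromDisk, dif_pos hv]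
  exact congrArg f (h.injective₀ hv.choose_spec).symm

lemma IsGluing.fromDisk_zero {Y : Type*} {f : Euc d → Y} {p : Y} (h : IsGluing C c₀ c₁) :
    fromDisk c₀ f p (c₁ 0) = p :=
  dif_neg fun ⟨v, hv⟩ => h.ne_zero v hv.symm

lemma IsGluing.fromDisk_injective {Y : Type*} {f : Euc d → Y} {p : Y} (h : IsGluing C c₀ c₁)
    (hf : Function.Injective f) (hp : ∀ v, f v ≠ p) : Function.Injective (fromDisk c₀ f p) := by
  intro q q' hq
  rcases h.cover q with ⟨v, rfl⟩ | rfl <;> rcases h.cover q' with ⟨v', rfl⟩ | rfl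
  · rw [h.fromDisk_apply, h.fromDisk_apply] at hq
    rw [hf hq]
  · rw [h.fromDisk_apply, h.fromDisk_zero] at hq
    exact absurd hq (hp v)
  · rw [h.fromDisk_apply, h.fromDisk_zero] at hq
    exact absurd hq.symm (hp v')
  · rfl

end gluing

/-! ### The embedding and its normal bundle -/

section embedding

open EuclideanGeometry

variable {m k N : ℕ} {M : Type} [TopologicalSpace M] [ChartedSpace (Euc (m + k + 1)) M]

/-- The cone over the map `right + χ` of `ℝ^m × ℝ^k`. -/
def dispCone (χ : Euc (m + k) → Euc k) : Euc (m + k + 1) → Euc (m + k + 1) :=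
  coneMap fun _ z => z + inRight m k (χ z)

variable {χ : Euc (m + k) → Euc k} {R : ℝ}

lemma IsDisplacement.contDiff_uncurry (h : IsDisplacement R χ) : ContDiff ℝ ∞
    (Function.uncurry fun (_ : ℝ) (z : Euc (m + k)) => z + inRight m k (χ z)) :=
  contDiff_snd.add ((inRight m k).contDiff.comp (h.contDiff.comp contDiff_snd))

lemma IsDisplacement.add_eq_self (h : IsDisplacement R χ) (_ : ℝ) (z : Euc (m + k))
    (hz : R < ‖z‖ ^ 2) : z + inRight m k (χ z) = z := by
  rw [h.eq_zero z hz, map_zero, add_zero]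

lemma IsDisplacement.continuous_dispCone (h : IsDisplacement R χ) : Continuous (dispCone χ) :=
  continuous_coneMap h.contDiff_uncurry h.add_eq_self

lemma dispCone_smul {t : ℝ} (ht : 0 < t) (v : Euc (m + k + 1)) :
    dispCone χ (t • v) = t • dispCone χ v := coneMap_smul _ ht v

lemma norm_dispCone (v : Euc (m + k + 1)) : ‖dispCone χ v‖ = ‖v‖ := norm_coneMap v

/-- The clutching function: the orthonormalized fibrewise Jacobian. -/
def clutchMap (h : IsDisplacement R χ) : C(Sph (m + k), SO k) where
  toFun u := polarExtend (fun _ z => (⟨gramSchmidtMatrix (fibJacobian χ z),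
    gramSchmidtMatrix_mem (h.det_pos z)⟩ : SO k)) (fun _ => 1) (u : Euc (m + k + 1))
  continuous_toFun := by
    refine continuous_iff_continuousAt.mpr fun u => ?_
    refine ContinuousAt.comp (continuousAt_polarExtend (R := R) ?_ continuous_const ?_ ?_)
      continuous_subtype_val.continuousAt
    · exact (h.continuous_gramSchmidtMatrix.comp continuous_snd).subtype_mk _
    · intro r p _ hp
      refine Subtype.ext ?_
      change gramSchmidtMatrix (fibJacobian χ p) = 1
      rw [h.fibJacobian_eq_one hp, gramSchmidtMatrix_one]
    · rw [← norm_ne_zero_iff, norm_sphere]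
      exact one_ne_zero

variable {ι₁ : Euc (m + k + 1) →ₗᵢ[ℝ] Euc N} {ι₂ : Euc k →ₗᵢ[ℝ] Euc N} {e : Euc k}
  {c₀ c₁ : Euc (m + k + 1) → M}

lemma IsGluing.fromDisk_eventuallyEq_cap (g : IsGluing (dispCone χ) c₀ c₁)
    (ho : ∀ a b, inner ℝ (ι₁ a) (ι₂ b) = 0) (he : ‖e‖ = 1) :
    fromDisk c₀ (closedTrack ι₁ ι₂ e χ) (ι₂ e) ∘ c₁ =ᶠ[𝓝 0] cap ι₁ ι₂ e := by
  filter_upwards [(isOpen_lt continuous_norm continuous_const).mem_nhds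
    (show ‖(0 : Euc (m + k + 1))‖ < 1 by simp)] with w hw
  rcases eq_or_ne w 0 with rfl | hw0
  · simp [g.fromDisk_zero, cap]
  · obtain ⟨v, hv, hwv, hCv⟩ := g.glue' w hw0
    have hw' := norm_pos_iff.mpr hw0
    have hnv : ‖v‖ = ‖w‖⁻¹ := by
      rw [← norm_dispCone (χ := χ), hCv, norm_smul, norm_inv, norm_pow, norm_norm]
      field_simp
    have h1 : 1 < ‖v‖ := hnv ▸ (one_lt_inv₀ hw').mpr hw
    rw [Function.comp_apply, hwv, g.fromDisk_apply, closedTrack, track_eq_of_le_norm (by linarith),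
      ← inversion_eq_cap ho he hw0, ← hCv]
    rfl

/-- The first factor is injective and `ι₂` frames its complement. -/
lemma fderiv_cap_add (ho : ∀ a b, inner ℝ (ι₁ a) (ι₂ b) = 0) (x : Euc (m + k + 1)) (w : Euc k)
    (h : fderiv ℝ (cap ι₁ ι₂ e) 0 x + ι₂.toContinuousLinearMap w = 0) : x = 0 ∧ w = 0 := by
  rw [fderiv_cap_zero] at h
  exact isometries_eq_zero ho h

lemma IsGluing.isSmoothEmbedding [IsManifold (𝓡 (m + k + 1)) ∞ M] [T2Space M] [CompactSpace M]
    (g : IsGluing (dispCone χ) c₀ c₁) (h : IsDisplacement R χ)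
    (ho : ∀ a b, inner ℝ (ι₁ a) (ι₂ b) = 0) (he : ‖e‖ = 1) (hN : m + k + 1 + k = N) :
    Manifold.IsSmoothEmbedding (𝓡 (m + k + 1)) (𝓡 N) ∞
      (fromDisk c₀ (closedTrack ι₁ ι₂ e χ) (ι₂ e)) := by
  have himm : Manifold.IsImmersionOfComplement (Euc k) (𝓡 (m + k + 1)) (𝓡 N) ∞
      (fromDisk c₀ (closedTrack ι₁ ι₂ e χ) (ι₂ e)) := by
    intro q
    rcases g.cover q with ⟨v, rfl⟩ | rfl
    · exact isImmersionAtOfComplement_of_parametrization (g.local₀ v)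
        (h.contDiff_closedTrack ho he) (Filter.Eventually.of_forall fun v => g.fromDisk_apply v)
        (closedTrackFrame ι₁ ι₂ e χ v) (h.fderiv_closedTrack_add ho he v) hN
    · exact isImmersionAtOfComplement_of_parametrization (g.local₁ 0) contDiff_cap
        (g.fromDisk_eventuallyEq_cap ho he) ι₂.toContinuousLinearMap (fderiv_cap_add ho) hN
  refine ⟨himm.isImmersion, ?_⟩
  exact (himm.contMDiff.continuous.isClosedEmbedding (g.fromDisk_injective
    (h.closedTrack_injective ho) (closedTrack_ne_center ho he))).isEmbedding

/-- The frame of the normal bundle over the upper hemisphere, where the sphere is the image of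
a disk in a linear subspace under the inversion. -/
def upperFrame (ι₁ : Euc (m + k + 1) →ₗᵢ[ℝ] Euc N) (ι₂ : Euc k →ₗᵢ[ℝ] Euc N) (e : Euc k)
    (χ : Euc (m + k) → Euc k) (η : Sph (m + k + 1)) : Euc k →L[ℝ] Euc N :=
  (1 / 2 : ℝ) • (ι₂.toContinuousLinearMap + (innerSL ℝ e).smulRight
    (ι₁ (dispCone χ (left (m + k + 1) 1 (η : Euc (m + k + 1 + 1)))) - (1 - height η) • ι₂ e))

lemma IsDisplacement.continuous_upperFrame (h : IsDisplacement R χ) :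
    Continuous (upperFrame ι₁ ι₂ e χ) := by
  have h1 : Continuous fun η : Sph (m + k + 1) =>
      ι₁ (dispCone χ (left (m + k + 1) 1 (η : Euc (m + k + 1 + 1)))) - (1 - height η) • ι₂ e :=
    (ι₁.continuous.comp (h.continuous_dispCone.comp (by fun_prop))).sub
      ((continuous_const.sub continuous_height).smul continuous_const)
  have h2 : Continuous fun η : Sph (m + k + 1) => ι₂.toContinuousLinearMap +
      (innerSL ℝ e).smulRight (ι₁ (dispCone χ (left (m + k + 1) 1 (η : Euc (m + k + 1 + 1)))) -
        (1 - height η) • ι₂ e) := continuous_const.add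
    ((ContinuousLinearMap.smulRightL ℝ (Euc k) (Euc N) (innerSL ℝ e)).continuous.comp h1)
  exact h2.const_smul (1 / 2 : ℝ)

lemma upperFrame_toSphere (ho : ∀ a b, inner ℝ (ι₁ a) (ι₂ b) = 0) (he : ‖e‖ = 1)
    (v : Euc (m + k + 1)) (w : Euc k) : upperFrame ι₁ ι₂ e χ (toSphere v) w
      = ((1 + ‖v‖ ^ 2) / 2) • fderiv ℝ (inversion (ι₂ e) 1) (ι₁ (dispCone χ v)) (ι₂ w) := by
  rw [fderiv_inversion_normal ho he, norm_dispCone, upperFrame, left_toSphere, height_toSphere,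
    dispCone_smul (by positivity)]
  have h1 : 1 - (‖v‖ ^ 2 - 1) / (‖v‖ ^ 2 + 1) = 2 / (‖v‖ ^ 2 + 1) := by field_simp; ring
  have h0 : (1 + ‖v‖ ^ 2) ≠ 0 := by positivity
  rw [h1, smul_smul, map_smul, add_comm (‖v‖ ^ 2) 1]
  simp only [smul_apply, add_apply, ContinuousLinearMap.smulRight_apply, innerSL_apply_apply,
    LinearIsometry.coe_toContinuousLinearMap]
  rw [← smul_sub, smul_smul]
  congr 1
  · field_simp
  · congr 2
    ring

/-- Over the region where the isotopy is constant, the normal space of the closed track is the image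
of the second factor under the differential of the inversion. -/
lemma IsDisplacement.adjoint_fderiv_closedTrack (h : IsDisplacement R χ)
    (ho : ∀ a b, inner ℝ (ι₁ a) (ι₂ b) = 0) (he : ‖e‖ = 1) {v : Euc (m + k + 1)} (hv : 1 ≤ ‖v‖)
    (w : Euc k) : (fderiv ℝ (closedTrack ι₁ ι₂ e χ) v).adjoint
      (fderiv ℝ (inversion (ι₂ e) 1) (ι₁ (dispCone χ v)) (ι₂ w)) = 0 := by
  have hv0 : v ≠ 0 := by
    rintro rfl
    rw [norm_zero] at hv
    linarith
  have htr : track ι₁ ι₂ χ =ᶠ[𝓝 v] fun v => ι₁ (dispCone χ v) := by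
    filter_upwards [(isOpen_lt continuous_const continuous_norm).mem_nhds
      (show 3 / 4 < ‖v‖ by linarith)] with v' hv'
    exact track_eq_of_le_norm (le_of_lt hv')
  have hC : HasFDerivAt (dispCone χ) (fderiv ℝ (dispCone χ) v) v :=
    ((contDiffAt_coneMap h.contDiff_uncurry h.add_eq_self hv0).differentiableAt
      (by simp)).hasFDerivAt
  refine ext_inner_left ℝ fun x => ?_
  rw [inner_zero_right, ContinuousLinearMap.adjoint_inner_right, h.fderiv_closedTrack ho he,
    htr.eq_of_nhds, htr.fderiv_eq, show fderiv ℝ (fun v => ι₁ (dispCone χ v)) v = _ from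
      (ι₁.toContinuousLinearMap.hasFDerivAt.comp v hC).fderiv]
  refine (inner_fderiv_inversion (ne_center ho he _) _ _).trans ?_
  exact mul_eq_zero_of_right _ (ho _ _)

lemma toSphere_stereo {d : ℕ} {η : Sph d} (h : (η : Euc (d + 1)) ∈ offPole d) :
    toSphere (stereo (η : Euc (d + 1))) = η := by
  obtain ⟨v, rfl⟩ := mem_range_toSphere_iff.mpr h
  rw [stereo_toSphere]

lemma stereo_equator {n : ℕ} (u : Sph n) :
    stereo (equator u : Euc (n + 1 + 1)) = (u : Euc (n + 1)) := by
  have h0 : (equator u : Euc (n + 1 + 1)) (Fin.last (n + 1)) = 0 := by simp [equator]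
  ext i
  simp only [stereo, norm_sphere, h0]
  simp [equator]

lemma height_equator {n : ℕ} (u : Sph n) : height (equator u) = 0 := by simp [height, equator]

/-- The normal bundle of the embedded sphere is clutched by the orthonormalized Jacobian. -/
lemma IsGluing.exists_isClutchedBy [IsManifold (𝓡 (m + k + 1)) ∞ M] [T2Space M] [CompactSpace M]
    (g : IsGluing (dispCone χ) c₀ c₁) (h : IsDisplacement R χ)
    (ho : ∀ a b, inner ℝ (ι₁ a) (ι₂ b) = 0) (he : ‖e‖ = 1) (hN : m + k + 1 + k = N) :
    ∃ H : Sph (m + k + 1) ≃ₕ M, IsClutchedBy (fun w => normalSpace (d := m + k + 1)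
      (fromDisk c₀ (closedTrack ι₁ ι₂ e χ) (ι₂ e)) (H w)) (clutchMap h) := by
  set E := fromDisk c₀ (closedTrack ι₁ ι₂ e χ) (ι₂ e) with hE
  have hEd : ∀ q, MDifferentiableAt (𝓡 (m + k + 1)) (𝓡 N) E q := fun q =>
    (g.isSmoothEmbedding h ho he hN).contMDiff.mdifferentiable (by simp) q
  have hd : Module.finrank ℝ (Euc (m + k + 1)) + Module.finrank ℝ (Euc k)
      = Module.finrank ℝ (Euc N) := by simp [← hN]
  have hn₀ : ∀ v, normalSpace (d := m + k + 1) E (c₀ v)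
      = (LinearMap.range (fderiv ℝ (closedTrack ι₁ ι₂ e χ) v).toLinearMap)ᗮ := fun v =>
    normalSpace_of_parametrization (g.local₀ v) (hEd _)
      (Filter.Eventually.of_forall fun v => g.fromDisk_apply v)
  have hn₁ : normalSpace (d := m + k + 1) E (c₁ 0)
      = (LinearMap.range (fderiv ℝ (cap ι₁ ι₂ e) 0).toLinearMap)ᗮ :=
    normalSpace_of_parametrization (g.local₁ 0) (hEd _) (g.fromDisk_eventuallyEq_cap ho he)
  have hinj : ∀ v, Function.Injective (fderiv ℝ (closedTrack ι₁ ι₂ e χ) v) := fun v =>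
    (injective_iff_map_eq_zero _).mpr fun x hx =>
      (h.fderiv_closedTrack_add ho he v x 0 (by rw [hx, map_zero, add_zero])).1
  let H := g.homeomorph h.continuous_dispCone coneMap_zero fun t ht v => dispCone_smul ht v
  have hHs : ∀ v, H (toSphere v) = c₀ v := sphereMap_toSphere
  have hHN : ∀ η : Sph (m + k + 1), (η : Euc (m + k + 1 + 1)) ∉ offPole (m + k + 1) →
    H η = c₁ 0 := fun η hη => sphereMap_of_notMem hη
  -- Over the upper hemisphere, the frame comes from the second factor through the inversion; over the
  -- lower hemisphere, which is parametrized by the first disk, it is the frame of the track,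
  -- projected to the normal space.
  refine ⟨H.toHomotopyEquiv, upperFrame ι₁ ι₂ e χ, fun η =>
    orthFrame (fderiv ℝ (closedTrack ι₁ ι₂ e χ) (stereo (η : Euc (m + k + 1 + 1))))
      (closedTrackFrame ι₁ ι₂ e χ (stereo (η : Euc (m + k + 1 + 1)))),
    h.continuous_upperFrame.continuousOn, ?_, fun η hη => ?_, fun η hη => ?_, fun u v => ?_⟩
  · have hst : ContinuousOn (fun η : Sph (m + k + 1) => stereo (η : Euc (m + k + 1 + 1)))
        {w | height w ≤ 0} := by
      intro η hη
      have hη' : (η : Euc (m + k + 1 + 1)) ∈ offPole (m + k + 1) :=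
        mem_offPole_sphere.mpr (lt_of_le_of_lt hη one_pos)
      exact (ContinuousAt.comp (g := stereo) (contDiffAt_stereo hη').continuousAt
        continuous_subtype_val.continuousAt).continuousWithinAt
    exact continuousOn_orthFrame
      (((h.contDiff_closedTrack ho he).continuous_fderiv (by simp)).comp_continuousOn hst)
      ((h.continuous_closedTrackFrame ho he).comp_continuousOn hst) fun η _ => hinj _
  · change _ ∧ _ = normalSpace (d := m + k + 1) E (H η)
    by_cases hp : (η : Euc (m + k + 1 + 1)) ∈ offPole (m + k + 1)
    · obtain ⟨v, rfl⟩ := mem_range_toSphere_iff.mpr hp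
      have hv : 1 ≤ ‖v‖ := by
        rw [height_toSphere, le_div_iff₀ (by positivity)] at hη
        nlinarith [norm_nonneg v]
      have hU : Function.Injective (upperFrame ι₁ ι₂ e χ (toSphere v)) := by
        refine (injective_iff_map_eq_zero _).mpr fun w hw => ?_
        rw [upperFrame_toSphere ho he, smul_eq_zero] at hw
        have h1 := eq_zero_of_fderiv_inversion (ne_center ho he _)
          (hw.resolve_left (by positivity))
        exact ι₂.injective (h1.trans (map_zero ι₂).symm)
      refine ⟨hU, ?_⟩
      rw [hHs, hn₀]
      refine range_eq_orthogonal_range (hinj v) hU (fun w => ?_) hd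
      rw [upperFrame_toSphere ho he, map_smul, h.adjoint_fderiv_closedTrack ho he hv, smul_zero]
    · have hU : ∀ w, upperFrame ι₁ ι₂ e χ η w = (1 / 2 : ℝ) • ι₂ w := fun w => by
        rw [upperFrame, left_eq_zero hp, height_eq_one hp,
          show dispCone χ 0 = 0 from coneMap_zero, sub_self, zero_smul, map_zero, sub_zero]
        simp
      have hUi : Function.Injective (upperFrame ι₁ ι₂ e χ η) := by
        refine (injective_iff_map_eq_zero _).mpr fun w hw => ?_
        rw [hU, smul_eq_zero] at hw
        exact ι₂.injective ((hw.resolve_left (by norm_num)).trans (map_zero ι₂).symm)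
      refine ⟨hUi, ?_⟩
      rw [hHN η hp, hn₁, fderiv_cap_zero]
      refine range_eq_orthogonal_range ι₁.injective hUi (fun w => ?_) hd
      rw [hU, map_smul, smul_eq_zero]
      right
      refine ext_inner_left ℝ fun x => ?_
      rw [inner_zero_right, ContinuousLinearMap.adjoint_inner_right]
      exact ho x w
  · change _ ∧ _ = normalSpace (d := m + k + 1) E (H η)
    have hp : (η : Euc (m + k + 1 + 1)) ∈ offPole (m + k + 1) :=
      mem_offPole_sphere.mpr (lt_of_le_of_lt hη one_pos)
    obtain ⟨v, rfl⟩ := mem_range_toSphere_iff.mpr hp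
    rw [hHs, hn₀]
    simp only [stereo_toSphere]
    exact ⟨orthFrame_injective (h.fderiv_closedTrack_add ho he v),
      range_orthFrame (h.fderiv_closedTrack_add ho he v) hd⟩
  · have hp : (equator u : Euc (m + k + 1 + 1)) ∈ offPole (m + k + 1) :=
      mem_offPole_sphere.mpr (by rw [height_equator]; exact one_pos)
    have hu1 := norm_sphere u
    have hF := upperFrame_toSphere (χ := χ) ho he (u : Euc (m + k + 1)) v
    rw [← stereo_equator u, toSphere_stereo hp, stereo_equator, hu1] at hF
    -- on the unit sphere, the angle is `π / 2`
    have htf : trackFrame ι₁ ι₂ χ (u : Euc (m + k + 1))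
        (Matrix.toEuclideanLin (clutchMap h u).1 v) = ι₂ v := by
      by_cases huP : (u : Euc (m + k + 1)) ∈ offPole (m + k)
      · have h1 : (clutchMap h u).1
            = gramSchmidtMatrix (fibJacobian χ (stereo (u : Euc (m + k + 1)))) :=
          congrArg Subtype.val (polarExtend_of_mem huP)
        have h2 : orthJacobian χ (stereo (u : Euc (m + k + 1)))
            (Matrix.toEuclideanLin (clutchMap h u).1 v) = v := by
          rw [h1, orthJacobian_apply, toEuclideanLin_comp_apply,
            mul_eq_one_comm.mp (gramSchmidtMatrix_mul_transpose (h.det_pos _)),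
            toEuclideanLin_one_apply]
        rw [trackFrame, polarExtend_of_mem huP, hu1, cosA_of_ge (by norm_num),
          sinA_of_ge (by norm_num)]
        simp [h2]
      · have h1 : (clutchMap h u).1 = 1 := congrArg Subtype.val
          (show clutchMap h u = 1 from if_neg huP)
        rw [h1, trackFrame_of_notMem huP, toEuclideanLin_one_apply]
        rfl
    have hcf : closedTrackFrame ι₁ ι₂ e χ (u : Euc (m + k + 1))
        (Matrix.toEuclideanLin (clutchMap h u).1 v)
        = fderiv ℝ (inversion (ι₂ e) 1) (ι₁ (dispCone χ (u : Euc (m + k + 1)))) (ι₂ v) := by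
      rw [closedTrackFrame, ContinuousLinearMap.comp_apply, htf,
        track_eq_of_le_norm (by rw [hu1]; norm_num)]
      rfl
    simp only [stereo_equator]
    rw [orthFrame_eq_of_adjoint (by
      rw [hcf]; exact h.adjoint_fderiv_closedTrack ho he hu1.ge v), hcf, hF]
    norm_num

end embedding

/-! ### Smooth families of diffeomorphisms and their displacements -/

section family

variable {m k : ℕ}

lemma left_box (z : Fin (m + k) → I) :
    left m k (box z) = box fun i => z (Fin.castAdd k i) := rfl

lemma right_box (z : Fin (m + k) → I) :
    right m k (box z) = box fun j => z (Fin.natAdd m j) := rfl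

lemma norm_sq_box_le {d : ℕ} (s : Fin d → I) : ‖box s‖ ^ 2 ≤ d := by
  rw [EuclideanSpace.real_norm_sq_eq]
  calc ∑ i, (box s) i ^ 2 ≤ ∑ _i : Fin d, (1 : ℝ) := by
        refine Finset.sum_le_sum fun i _ => ?_
        have h0 := (s i).2.1
        have h1 := (s i).2.2
        simp only [box]
        nlinarith
    _ = d := by simp

lemma mem_range_box_iff {d : ℕ} {p : Euc d} : p ∈ Set.range (box (d := d)) ↔ ∀ i, |p i| ≤ 1 := by
  constructor
  · rintro ⟨s, rfl⟩ i
    have h0 := (s i).2.1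
    have h1 := (s i).2.2
    rw [abs_le]
    constructor <;> simp only [box] <;> linarith
  · intro h
    refine ⟨fun i => ⟨(p i + 1) / 2, ?_, ?_⟩, ?_⟩
    · have := (abs_le.mp (h i)).1; linarith
    · have := (abs_le.mp (h i)).2; linarith
    · ext i
      simp only [box]
      ring

lemma one_lt_norm_of_notMem_range_box {d : ℕ} {p : Euc d} (h : p ∉ Set.range (box (d := d))) :
    1 < ‖p‖ := by
  rw [mem_range_box_iff] at h
  push Not at h
  obtain ⟨i, hi⟩ := h
  exact hi.trans_le (PiLp.norm_apply_le p i)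

/-- The displacement of a family of self-maps of `ℝ^k`. -/
def displacement (ψ : Euc m × Euc k → Euc k) (z : Euc (m + k)) : Euc k :=
  ψ (left m k z, right m k z) - right m k z

variable {ψ : Euc m × Euc k → Euc k}

lemma right_add_displacement (z : Euc (m + k)) :
    right m k z + displacement ψ z = ψ (left m k z, right m k z) := by
  simp [displacement]

lemma fiberwise_eq (z : Euc (m + k)) :
    fiberwise ψ z = z + inRight m k (displacement ψ z) := by
  refine ext_left_right ?_ ?_
  · rw [map_add, left_inRight, add_zero]
    ext i
    simp [fiberwise]
  · rw [map_add, right_inRight, right_add_displacement]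
    ext j
    change fiberwise ψ z (Fin.natAdd m j) = _
    simp only [fiberwise, Fin.append_right]
    rfl

lemma contDiff_displacement (hψ : ContDiff ℝ ∞ ψ) : ContDiff ℝ ∞ (displacement ψ) :=
  (hψ.comp ((left m k).contDiff.prodMk (right m k).contDiff)).sub (right m k).contDiff

lemma fibJacobian_displacement (hψ : ContDiff ℝ ∞ ψ) (z : Euc (m + k)) (i j : Fin k) :
    fibJacobian (displacement ψ) z i j
      = fderiv ℝ (fun y => ψ (left m k z, y)) (right m k z) (EuclideanSpace.single j 1) i := by
  have h1 : (fun y => ψ (left m k z, y))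
      = fun y => y + displacement ψ (z + inRight m k (y - right m k z)) := by
    funext y
    simp [displacement]
  have h2 : HasFDerivAt (displacement ψ) (fderiv ℝ (displacement ψ) z)
      (z + inRight m k (right m k z - right m k z)) := by
    rw [sub_self, map_zero, add_zero]
    exact ((contDiff_displacement hψ).differentiable (by simp) z).hasFDerivAt
  have h3 : HasFDerivAt (fun y => z + inRight m k (y - right m k z)) (inRight m k)
      (right m k z) := by
    have := ((inRight m k).hasFDerivAt.comp (right m k z)
      ((hasFDerivAt_id (right m k z)).sub_const (right m k z))).const_add z
    exact this.congr_fderiv (by ext; rfl)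
  have h4 := (hasFDerivAt_id (right m k z)).add
    (h2.comp (right m k z) (f := fun y => z + inRight m k (y - right m k z)) h3)
  have h5 : fderiv ℝ (fun y => y + displacement ψ (z + inRight m k (y - right m k z)))
      (right m k z) = _ := h4.fderiv
  rw [h1, h5]
  rfl

variable {g : Ω^ (Fin m) (DiffDisk k) (DiffDisk.id k)}

lemma IsSmoothFamily.fibJacobian_of_box (hψ : IsSmoothFamily g ψ) {z : Euc (m + k)} {s : Fin m → I}
    (hs : left m k z = box s) :
    fibJacobian (displacement ψ) z = (g s).jacobian (right m k z) := by
  ext i j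
  rw [fibJacobian_displacement hψ.contDiff, hs]
  simp only [hψ.on_box]
  rfl

lemma IsSmoothFamily.fibJacobian_of_notMem (hψ : IsSmoothFamily g ψ) {z : Euc (m + k)}
    (hs : left m k z ∉ Set.range (box (d := m))) : fibJacobian (displacement ψ) z = 1 := by
  ext i j
  rw [fibJacobian_displacement hψ.contDiff]
  simp [hψ.off_box _ hs, Matrix.one_apply]

lemma IsSmoothFamily.isDisplacement (hψ : IsSmoothFamily g ψ) :
    IsDisplacement (m + 1) (displacement ψ) where
  contDiff := contDiff_displacement hψ.contDiff
  eq_zero z hz := by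
    by_cases hs : left m k z ∈ Set.range (box (d := m))
    · obtain ⟨s, hs⟩ := hs
      have hr : 1 ≤ ‖right m k z‖ := by
        have h1 := norm_sq_box_le s
        rw [norm_sq_left_add_right, ← hs] at hz
        nlinarith [norm_nonneg (right m k z)]
      rw [displacement, ← hs, hψ.on_box, (g s).eq_of_one_le _ hr, sub_self]
    · rw [displacement, hψ.off_box _ hs, sub_self]
  det_pos z := by
    by_cases hs : left m k z ∈ Set.range (box (d := m))
    · obtain ⟨s, hs⟩ := hs
      rw [hψ.fibJacobian_of_box hs.symm]
      exact (g s).jacobian_det_pos _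
    · rw [hψ.fibJacobian_of_notMem hs, Matrix.det_one]
      exact one_pos
  injective z z' hl hr := by
    rw [right_add_displacement, right_add_displacement, ← hl] at hr
    refine ext_left_right hl ?_
    by_cases hs : left m k z ∈ Set.range (box (d := m))
    · obtain ⟨s, hs⟩ := hs
      rw [← hs, hψ.on_box, hψ.on_box] at hr
      exact (g s).toDiffeo.injective hr
    · rwa [hψ.off_box _ hs, hψ.off_box _ hs] at hr

/-- The clutching function of the normal bundle is the map on the sphere that corresponds to the
loop `derivLoop g`. -/
lemma IsSmoothFamily.isSphereMap (hψ : IsSmoothFamily g ψ) :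
    IsSphereMap (derivLoop g) (clutchMap hψ.isDisplacement) := by
  have hval : ∀ z, (clutchMap hψ.isDisplacement (toSphere z)).1
      = gramSchmidtMatrix (fibJacobian (displacement ψ) z) := fun z => by
    have h : (clutchMap hψ.isDisplacement (toSphere z)).1 = gramSchmidtMatrix
        (fibJacobian (displacement ψ) (stereo (toSphere z : Euc (m + k + 1)))) :=
      congrArg Subtype.val (polarExtend_of_mem (mem_range_toSphere_iff.mp ⟨z, rfl⟩))
    rwa [stereo_toSphere] at h
  refine ⟨fun z => Subtype.ext ?_, fun u hu => ?_⟩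
  · rw [hval, hψ.fibJacobian_of_box (left_box z), right_box]
    rfl
  · by_cases hp : (u : Euc (m + k + 1)) ∈ offPole (m + k)
    · obtain ⟨z, rfl⟩ := mem_range_toSphere_iff.mpr hp
      refine Subtype.ext ?_
      rw [hval]
      change _ = 1
      rw [← gramSchmidtMatrix_one]
      congr 1
      by_cases hs : left m k z ∈ Set.range (box (d := m))
      · obtain ⟨s, hs⟩ := hs
        have hr : right m k z ∉ Set.range (box (d := k)) := by
          rintro ⟨t, ht⟩
          refine hu ⟨Fin.append s t, congrArg toSphere (ext_left_right ?_ ?_)⟩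
          · rw [left_box, ← hs]; simp
          · rw [right_box, ← ht]; simp
        rw [hψ.fibJacobian_of_box hs.symm]
        exact (g s).jacobian_eq_one (one_lt_norm_of_notMem_range_box hr).le
      · exact hψ.fibJacobian_of_notMem hs
    · exact if_neg hp

end family

lemma exists_orthogonal_isometries {a b N : ℕ} (h : a + b = N) :
    ∃ (ι₁ : Euc a →ₗᵢ[ℝ] Euc N) (ι₂ : Euc b →ₗᵢ[ℝ] Euc N), ∀ x y, inner ℝ (ι₁ x) (ι₂ y) = 0 := by
  subst h
  refine ⟨⟨{ toFun := fun x => WithLp.toLp 2 (Fin.append (fun i => x i) 0)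
             map_add' := fun x y => by ext i; induction i using Fin.addCases <;> simp
             map_smul' := fun c x => by ext i; induction i using Fin.addCases <;> simp },
      fun x => ?_⟩, ⟨(inRight a b).toLinearMap, fun y => ?_⟩, fun x y => ?_⟩
  · simp [EuclideanSpace.norm_eq, Fin.sum_univ_add]
  · simp [EuclideanSpace.norm_eq, Fin.sum_univ_add]
  · simp [PiLp.inner_apply, Fin.sum_univ_add]

/-- Every twisted sphere that represents the image of a class under Gromoll's map has an embedding
with the prescribed normal bundle. -/
theorem RepresentsGromoll.exists_embedding {m k : ℕ} (hk : 1 ≤ k)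
    {x : HomotopyGroup.Pi m (DiffDisk k) (DiffDisk.id k)} {S : HomotopySphere (m + k + 1)}
    (hS : RepresentsGromoll x S) : ∃ e : S.carrier → Euc (m + k + k + 1),
      Manifold.IsSmoothEmbedding (𝓡 (m + k + 1)) (𝓡 (m + k + k + 1)) ∞ e ∧
        IsClassifiedUpToSign (normalSpace (d := m + k + 1) e) (derivStar x) := by
  obtain ⟨g, ψ, φ, rfl, hψ, hφ, hM⟩ := hS
  have hN : m + k + 1 + k = m + k + k + 1 := by omega
  obtain ⟨ι₁, ι₂, ho⟩ := exists_orthogonal_isometries hN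
  obtain ⟨c₀, c₁, G⟩ := hM.exists_isGluing hφ
  have G' : IsGluing (dispCone (displacement ψ)) c₀ c₁ := by
    have : (fun _ : ℝ => fiberwise ψ)
        = fun _ z => z + inRight m k (displacement ψ z) := by
      funext _ z
      exact fiberwise_eq z
    rwa [this] at G
  have he : ‖(EuclideanSpace.single ⟨0, hk⟩ 1 : Euc k)‖ = 1 := by simp
  obtain ⟨H, hH⟩ := G'.exists_isClutchedBy hψ.isDisplacement ho he hN
  exact ⟨_, G'.isSmoothEmbedding hψ.isDisplacement ho he hN, H, derivLoop g,
    clutchMap hψ.isDisplacement, rfl, hψ.isSphereMap, hH⟩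

/-! ### Smooth representatives of homotopy classes -/

section smoothing

variable {m k : ℕ}

/-- A smooth map whose derivative is everywhere close to the identity is a diffeomorphism. -/
lemma exists_diffeomorph_of_fderiv_sub_id {F : Euc k → Euc k} (hF : ContDiff ℝ ∞ F)
    (h : ∀ z, ‖fderiv ℝ F z - ContinuousLinearMap.id ℝ (Euc k)‖ ≤ 1 / 2) :
    ∃ Φ : Euc k ≃ₘ^∞⟮𝓘(ℝ, Euc k), 𝓘(ℝ, Euc k)⟯ Euc k, ∀ z, Φ z = F z := by
  have hd : ∀ z, HasFDerivAt F (fderiv ℝ F z) z := fun z =>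
    (hF.differentiable (by simp) z).hasFDerivAt
  have happ : ApproximatesLinearOn F ((ContinuousLinearEquiv.refl ℝ (Euc k) :
      Euc k ≃L[ℝ] Euc k) : Euc k →L[ℝ] Euc k) Set.univ (1 / 2) := by
    rw [ApproximatesLinearOn.approximatesLinearOn_iff_lipschitzOnWith]
    refine Convex.lipschitzOnWith_of_nnnorm_hasFDerivWithin_le (𝕜 := ℝ)
      (f' := fun z => fderiv ℝ F z - ContinuousLinearMap.id ℝ (Euc k))
      (fun z _ => ((hd z).sub (ContinuousLinearMap.hasFDerivAt _)).hasFDerivWithinAt)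
      (fun z _ => ?_) convex_univ
    rw [← NNReal.coe_le_coe]
    simpa using h z
  have hc : Subsingleton (Euc k) ∨ (1 / 2 : NNReal) < ‖((ContinuousLinearEquiv.refl ℝ
      (Euc k)).symm : Euc k →L[ℝ] Euc k)‖₊⁻¹ := by
    rcases subsingleton_or_nontrivial (Euc k) with hs | hs
    · exact Or.inl hs
    · right
      have h1 : ‖((ContinuousLinearEquiv.refl ℝ (Euc k)).symm : Euc k →L[ℝ] Euc k)‖₊ = 1 := by
        rw [← NNReal.coe_inj]
        exact ContinuousLinearMap.norm_id
      rw [h1, inv_one, ← NNReal.coe_lt_coe]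
      norm_num
  have hu : ∀ z, ∃ D : Euc k ≃L[ℝ] Euc k, (D : Euc k →L[ℝ] Euc k) = fderiv ℝ F z := by
    intro z
    have hlt : ‖ContinuousLinearMap.id ℝ (Euc k) - fderiv ℝ F z‖ < 1 := by
      rw [norm_sub_rev]
      exact (h z).trans_lt (by norm_num)
    refine ⟨ContinuousLinearEquiv.unitsEquiv ℝ (Euc k) (Units.oneSub _ hlt), ?_⟩
    ext1 x
    simp
  choose D hD using hu
  let T := happ.toHomeomorph F hc
  have hT : ∀ z, T z = F z := fun z => rfl
  have hsymm : ContDiff ℝ ∞ T.symm :=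
    T.contDiff_symm (f₀' := D) (fun z => by rw [hD]; exact hd z) hF
  exact ⟨{ toEquiv := T.toEquiv
           contMDiff_toFun := hF.contMDiff
           contMDiff_invFun := hsymm.contMDiff }, hT⟩

namespace DiffDisk

lemma ext_fun {f f' : DiffDisk k} (h : ∀ y, f y = f' y) : f = f' := by
  have : f.toDiffeo = f'.toDiffeo := Diffeomorph.ext h
  cases f; cases f'; congr

lemma fderiv_eq_jacobian (f : DiffDisk k) (y : Euc k) :
    fderiv ℝ f y = (Matrix.toEuclideanCLM (𝕜 := ℝ) (n := Fin k) (f.jacobian y) :) := by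
  apply ContinuousLinearMap.coe_injective
  refine (EuclideanSpace.basisFun (Fin k) ℝ).toBasis.ext fun j => ?_
  ext i
  simp [jacobian]

lemma continuous_fderiv : Continuous fun p : DiffDisk k × Euc k => fderiv ℝ p.1 p.2 := by
  have h2 : Continuous (fun A : Matrix (Fin k) (Fin k) ℝ =>
      (Matrix.toEuclideanCLM (𝕜 := ℝ) (n := Fin k) A : Euc k →L[ℝ] Euc k)) :=
    LinearMap.continuous_of_finiteDimensional
      (Matrix.toEuclideanCLM (𝕜 := ℝ) (n := Fin k)).toAlgEquiv.toLinearMap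
  simp_rw [fderiv_eq_jacobian]
  exact h2.comp continuous_jacobian

lemma fderiv_eq_id (f : DiffDisk k) {y : Euc k} (hy : 1 ≤ ‖y‖) :
    fderiv ℝ f y = ContinuousLinearMap.id ℝ (Euc k) := by
  rw [fderiv_eq_jacobian, f.jacobian_eq_one hy, map_one]
  rfl

lemma fderiv_symm_comp (f : DiffDisk k) (y : Euc k) :
    fderiv ℝ f.toDiffeo.symm (f y) ∘L fderiv ℝ f y = ContinuousLinearMap.id ℝ (Euc k) ∧
      fderiv ℝ f y ∘L fderiv ℝ f.toDiffeo.symm (f y) = ContinuousLinearMap.id ℝ (Euc k) := by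
  have hd : ∀ y, DifferentiableAt ℝ f y := fun y => (f.contDiff.differentiable (by simp)) y
  have hs : ContDiff ℝ ∞ f.toDiffeo.symm := f.toDiffeo.symm.contMDiff_toFun.contDiff
  have hds : ∀ z, DifferentiableAt ℝ f.toDiffeo.symm z := fun z => hs.differentiable (by simp) z
  constructor
  · rw [← fderiv_comp y (hds _) (hd y),
      show (f.toDiffeo.symm ∘ f : Euc k → Euc k) = _root_.id from
        funext fun w => f.toDiffeo.symm_apply_apply w, fderiv_id]
  · have h1 : f.toDiffeo.symm (f y) = y := f.toDiffeo.symm_apply_apply y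
    have h2 := fderiv_comp (f y) (hd (f.toDiffeo.symm (f y))) (hds (f y))
    rw [h1] at h2
    rw [← h2, show (f ∘ f.toDiffeo.symm : Euc k → Euc k) = _root_.id from
        funext fun w => f.toDiffeo.apply_symm_apply w, fderiv_id]

lemma isUnit_fderiv (f : DiffDisk k) (y : Euc k) : IsUnit (fderiv ℝ f y) :=
  ⟨⟨fderiv ℝ f y, fderiv ℝ f.toDiffeo.symm (f y), (f.fderiv_symm_comp y).2,
    (f.fderiv_symm_comp y).1⟩, rfl⟩

lemma inverse_fderiv (f : DiffDisk k) (y : Euc k) :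
    Ring.inverse (fderiv ℝ f y) = fderiv ℝ f.toDiffeo.symm (f y) := by
  let u : (Euc k →L[ℝ] Euc k)ˣ := ⟨fderiv ℝ f y, fderiv ℝ f.toDiffeo.symm (f y),
    (f.fderiv_symm_comp y).2, (f.fderiv_symm_comp y).1⟩
  exact Ring.inverse_unit u

/-- A map which is `C^1`-close to a diffeomorphism of the disk is a diffeomorphism. -/
lemma exists_of_fderiv_sub_le (T : DiffDisk k) {f : Euc k → Euc k} (hf : ContDiff ℝ ∞ f)
    (hid : ∀ y, 1 ≤ ‖y‖ → f y = y) {K : ℝ} (hK : 0 < K)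
    (hT : ∀ y, ‖Ring.inverse (fderiv ℝ T y)‖ ≤ K)
    (h : ∀ y, ‖fderiv ℝ f y - fderiv ℝ T y‖ ≤ (2 * K)⁻¹) : ∃ f' : DiffDisk k, ∀ y, f' y = f y := by
  have hs : ContDiff ℝ ∞ T.toDiffeo.symm := T.toDiffeo.symm.contMDiff_toFun.contDiff
  obtain ⟨Φ, hΦ⟩ := exists_diffeomorph_of_fderiv_sub_id (F := f ∘ T.toDiffeo.symm) (hf.comp hs) (by
    intro z
    obtain ⟨y, hy⟩ : ∃ y, T y = z := T.toDiffeo.surjective z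
    subst hy
    have h1 : T.toDiffeo.symm (T y) = y := T.toDiffeo.symm_apply_apply y
    have h2 := fderiv_comp (T y) (hf.differentiable (by simp) (T.toDiffeo.symm (T y)))
      (hs.differentiable (by simp) (T y))
    rw [h1] at h2
    rw [h2, ← (T.fderiv_symm_comp y).2, ← ContinuousLinearMap.sub_comp]
    refine (ContinuousLinearMap.opNorm_comp_le _ _).trans ?_
    rw [← inverse_fderiv]
    calc _ ≤ (2 * K)⁻¹ * K := by
          gcongr
          · exact h y
          · exact hT y
      _ = 1 / 2 := by field_simp)
  refine ⟨⟨T.toDiffeo.trans Φ, fun y hy => ?_⟩, fun y => ?_⟩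
  · change Φ (T y) = y
    rw [hΦ, Function.comp_apply, show T.toDiffeo.symm (T y) = y from
      T.toDiffeo.symm_apply_apply y, hid y hy]
  · change Φ (T y) = f y
    rw [hΦ, Function.comp_apply, show T.toDiffeo.symm (T y) = y from
      T.toDiffeo.symm_apply_apply y]

end DiffDisk

/-- The retraction of `ℝ^d` onto the cube, as a map to the unit cube. -/
def clamp {d : ℕ} (p : Euc d) (i : Fin d) : I := Set.projIcc 0 1 zero_le_one ((p i + 1) / 2)

lemma continuous_clamp {d : ℕ} : Continuous (clamp (d := d)) :=
  continuous_pi fun i => continuous_projIcc.comp (by fun_prop)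

lemma clamp_box {d : ℕ} (s : Fin d → I) : clamp (box s) = s := by
  funext i
  have : ((box s) i + 1) / 2 = (s i : ℝ) := by simp only [box]; ring
  rw [clamp, this, Set.projIcc_val]

lemma clamp_mem_boundary {d : ℕ} {p : Euc d} (hp : p ∉ Set.range (box (d := d))) :
    clamp p ∈ Cube.boundary (Fin d) := by
  rw [mem_range_box_iff] at hp
  push Not at hp
  obtain ⟨i, hi⟩ := hp
  refine ⟨i, ?_⟩
  rcases lt_abs.mp hi with h | h
  · right
    exact Set.projIcc_of_right_le _ (by linarith)
  · left
    exact Set.projIcc_of_le_left _ (by linarith)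

lemma isCompact_range_box {d : ℕ} : IsCompact (Set.range (box (d := d))) :=
  isCompact_range continuous_box

lemma box_mem_closure_compl {d : ℕ} {s : Fin d → I} (hs : s ∈ Cube.boundary (Fin d)) :
    box s ∈ closure (Set.range (box (d := d)))ᶜ := by
  obtain ⟨i, hi⟩ := hs
  have ht : Filter.Tendsto (fun t : ℝ => box s + t • EuclideanSpace.single i (box s i))
      (𝓝[>] 0) (𝓝 (box s)) := by
    have h : Continuous fun t : ℝ => box s + t • EuclideanSpace.single i (box s i) := by fun_prop
    have := h.tendsto 0
    rw [zero_smul, add_zero] at this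
    exact this.mono_left nhdsWithin_le_nhds
  refine mem_closure_of_tendsto ht ?_
  filter_upwards [self_mem_nhdsWithin] with t ht
  have ht' : (0 : ℝ) < t := ht
  rw [Set.mem_compl_iff, mem_range_box_iff]
  push Not
  refine ⟨i, ?_⟩
  have : (box s + t • EuclideanSpace.single i (box s i)) i = (1 + t) * box s i := by
    simp; ring
  rw [this, abs_mul, abs_of_pos (by linarith)]
  rcases hi with hi | hi <;> norm_num [box, hi] <;> linarith

variable (g : Ω^ (Fin m) (DiffDisk k) (DiffDisk.id k))

lemma apply_clamp_eq_id {p : Euc m} (hp : p ∉ Set.range (box (d := m))) :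
    g (clamp p) = DiffDisk.id k := g.2 _ (clamp_mem_boundary hp)

lemma continuous_fderiv_clamp :
    Continuous fun q : Euc m × Euc k => fderiv ℝ (g (clamp q.1)) q.2 :=
  DiffDisk.continuous_fderiv.comp
    (((map_continuous g).comp (continuous_clamp.comp continuous_fst)).prodMk continuous_snd)

/-- The inverses of the differentials of a loop of diffeomorphisms are bounded. -/
lemma exists_bound_inverse_fderiv :
    ∃ K > 0, ∀ (s : Fin m → I) (y : Euc k), ‖Ring.inverse (fderiv ℝ (g s) y)‖ ≤ K := by
  have hc : Continuous fun q : (Fin m → I) × Euc k => ‖Ring.inverse (fderiv ℝ (g q.1) q.2)‖ := by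
    refine continuous_iff_continuousAt.mpr fun q => ContinuousAt.norm ?_
    obtain ⟨u, hu⟩ := (g q.1).isUnit_fderiv q.2
    have h := NormedRing.inverse_continuousAt u
    rw [hu] at h
    exact ContinuousAt.comp (f := fun q : (Fin m → I) × Euc k => fderiv ℝ (g q.1) q.2) h
      (DiffDisk.continuous_fderiv.comp (((map_continuous g).comp continuous_fst).prodMk
        continuous_snd)).continuousAt
  obtain ⟨K, hK⟩ := ((isCompact_univ (X := Fin m → I)).prod
    (isCompact_closedBall (0 : Euc k) 1)).bddAbove_image hc.continuousOn
  refine ⟨max K (max 1 ‖Ring.inverse (ContinuousLinearMap.id ℝ (Euc k))‖), by positivity,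
    fun s y => ?_⟩
  by_cases hy : ‖y‖ ≤ 1
  · refine le_trans (hK ⟨(s, y), ⟨Set.mem_univ _, ?_⟩, rfl⟩) (le_max_left _ _)
    simpa using hy
  · rw [(g s).fderiv_eq_id (le_of_lt (not_le.mp hy))]
    exact (le_max_right _ _).trans (le_max_right _ _)

lemma fderiv_close_nhds {ε : ℝ} (hε : 0 < ε) (p₀ : Euc m) :
    ∀ᶠ p in 𝓝 p₀, ∀ y, ‖fderiv ℝ (g (clamp p)) y - fderiv ℝ (g (clamp p₀)) y‖ < ε := by
  have h1 : ∀ᶠ p in 𝓝 p₀, ∀ y ∈ Metric.closedBall (0 : Euc k) 1,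
      ‖fderiv ℝ (g (clamp p)) y - fderiv ℝ (g (clamp p₀)) y‖ < ε := by
    refine (isCompact_closedBall (0 : Euc k) 1).eventually_forall_of_forall_eventually
      fun y _ => ?_
    have hc : Continuous fun q : Euc m × Euc k =>
        ‖fderiv ℝ (g (clamp q.1)) q.2 - fderiv ℝ (g (clamp p₀)) q.2‖ :=
      ((continuous_fderiv_clamp g).sub ((continuous_fderiv_clamp g).comp
        (f := fun q : Euc m × Euc k => (p₀, q.2)) (by fun_prop))).norm
    exact hc.continuousAt.eventually_lt continuousAt_const (by simpa using hε)
  filter_upwards [h1] with p hp y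
  by_cases hy : ‖y‖ ≤ 1
  · exact hp y (by simpa using hy)
  · rw [(g _).fderiv_eq_id (le_of_lt (not_le.mp hy)), (g _).fderiv_eq_id (le_of_lt (not_le.mp hy)),
      sub_self, norm_zero]
    exact hε

/-- A loop of diffeomorphisms is approximated, in the `C^1`-sense, by finite convex combinations of
diffeomorphisms of the disk with smooth coefficients; outside the cube only the identity is used. -/
lemma exists_convex_approximation {ε : ℝ} (hε : 0 < ε) :
    ∃ (ι : Type) (_ : Fintype ι) (b : ι → Euc m → ℝ) (G : ι → DiffDisk k),
      (∀ j, ContDiff ℝ ∞ (b j)) ∧ (∀ j p, 0 ≤ b j p) ∧ (∀ p, ∑ j, b j p = 1) ∧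
      (∀ s j, b j (box s) ≠ 0 → ∀ y, ‖fderiv ℝ (G j) y - fderiv ℝ (g s) y‖ ≤ ε) ∧
      ∀ p ∉ Set.range (box (d := m)), ∀ j, b j p ≠ 0 → G j = DiffDisk.id k := by
  have hε2 : 0 < ε / 2 := by positivity
  have hU : ∀ p₀ : Euc m, ∃ U : Set (Euc m), IsOpen U ∧ p₀ ∈ U ∧ ∀ p ∈ U, ∀ y,
      ‖fderiv ℝ (g (clamp p)) y - fderiv ℝ (g (clamp p₀)) y‖ < ε / 2 := by
    intro p₀
    obtain ⟨U, hU, hUo, hp⟩ := mem_nhds_iff.mp (fderiv_close_nhds g hε2 p₀)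
    exact ⟨U, hUo, hp, fun p hp => hU hp⟩
  choose U hUo hUm hUε using hU
  obtain ⟨t, ht⟩ := isCompact_range_box.elim_finite_subcover U hUo
    (fun p _ => Set.mem_iUnion.mpr ⟨p, hUm p⟩)
  -- a sample point of each set of the cover, which lies outside the cube whenever this is possible
  have hc : ∀ p₀ : Euc m, ∃ c ∈ U p₀, ∀ p ∈ U p₀, p ∉ Set.range (box (d := m)) →
      c ∉ Set.range (box (d := m)) := by
    intro p₀
    by_cases h : U p₀ ⊆ Set.range (box (d := m))
    · exact ⟨p₀, hUm p₀, fun p hp hp' => absurd (h hp) hp'⟩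
    · obtain ⟨c, hc, hc'⟩ := Set.not_subset.mp h
      exact ⟨c, hc, fun _ _ _ => hc'⟩
  choose c hcU hc using hc
  obtain ⟨f, hf⟩ := SmoothPartitionOfUnity.exists_isSubordinate 𝓘(ℝ, Euc m)
    (isCompact_range_box (d := m)).isClosed (fun i : t => U i) (fun i => hUo i) (by
      intro p hp
      obtain ⟨i, hi, hpi⟩ := Set.mem_iUnion₂.mp (ht hp)
      exact Set.mem_iUnion.mpr ⟨⟨i, hi⟩, hpi⟩)
  have hfU : ∀ (i : t) p, f i p ≠ 0 → p ∈ U i := fun i p hp => hf i (subset_tsupport _ hp)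
  have hfs : ∀ i : t, ContDiff ℝ ∞ (f i) := fun i => (f i).contMDiff.contDiff
  have hsum : ∀ p, ∑ᶠ i, f i p = ∑ i, f i p := fun p => finsum_eq_sum_of_fintype _
  refine ⟨Option t, inferInstance,
    fun j p => j.elim (1 - ∑ i, f i p) fun i => f i p,
    fun j => j.elim (DiffDisk.id k) fun i => g (clamp (c i)), ?_, ?_, ?_, ?_, ?_⟩
  · rintro (_ | i)
    · exact contDiff_const.sub (ContDiff.sum fun i _ => hfs i)
    · exact hfs i
  · rintro (_ | i) p
    · have := f.sum_le_one p
      rw [hsum] at this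
      exact sub_nonneg.mpr this
    · exact f.nonneg i p
  · intro p
    rw [Fintype.sum_option]
    exact sub_add_cancel _ _
  · rintro s (_ | i) hs y
    · refine absurd ?_ hs
      have := f.sum_eq_one (Set.mem_range_self s)
      rw [hsum] at this
      exact sub_eq_zero.mpr this.symm
    · have h1 := hUε i (box s) (hfU i _ hs) y
      have h2 := hUε i (c i) (hcU i) y
      rw [clamp_box] at h1
      rw [norm_sub_rev] at h1
      have h3 := norm_add_le (fderiv ℝ (g (clamp (c i))) y - fderiv ℝ (g (clamp (i : Euc m))) y)
        (fderiv ℝ (g (clamp (i : Euc m))) y - fderiv ℝ (g s) y)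
      rw [sub_add_sub_cancel] at h3
      exact h3.trans (by linarith)
  · rintro p hp (_ | i) hi
    · rfl
    · exact apply_clamp_eq_id g (hc i p (hfU i p hi) hp)

/-- Continuity of a map into `Diff_∂(D^k)`, in terms of all iterated derivatives. -/
lemma DiffDisk.continuous_of_iteratedFDeriv {X : Type*} [TopologicalSpace X] {H : X → DiffDisk k}
    (h : ∀ i, Continuous fun q : X × Euc k => iteratedFDeriv ℝ i (H q.1) q.2) : Continuous H :=
  continuous_iInf_rng.mpr fun i => continuous_induced_rng.mpr
    (ContinuousMap.continuous_of_continuous_uncurry _ (h i))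

lemma DiffDisk.continuous_iteratedFDeriv (i : ℕ) :
    Continuous fun q : DiffDisk k × Euc k => iteratedFDeriv ℝ i q.1 q.2 :=
  ((DiffDisk.continuous_iterDeriv i).comp continuous_fst).eval continuous_snd

/-- Every element of `π_m Diff_∂(D^k)` has a smooth representative. -/
theorem exists_smooth_representative (x : HomotopyGroup.Pi m (DiffDisk k) (DiffDisk.id k)) :
    ∃ (g : Ω^ (Fin m) (DiffDisk k) (DiffDisk.id k)) (ψ : Euc m × Euc k → Euc k),
      x = Quotient.mk _ g ∧ IsSmoothFamily g ψ := by
  obtain ⟨g, rfl⟩ := Quotient.exists_rep x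
  obtain ⟨K, hK, hgK⟩ := exists_bound_inverse_fderiv g
  -- the tolerance `(2 * K)⁻¹` is that of `DiffDisk.exists_of_fderiv_sub_le`
  obtain ⟨ι, _, b, G, hb, hb0, hb1, hbG, hbid⟩ :=
    exists_convex_approximation g (show 0 < (2 * K)⁻¹ by positivity)
  let ψ : Euc m × Euc k → Euc k := fun q => ∑ j, b j q.1 • G j q.2
  have hψ : ContDiff ℝ ∞ ψ := ContDiff.sum fun j _ =>
    ((hb j).comp contDiff_fst).smul ((G j).contDiff.comp contDiff_snd)
  have hψp : ∀ p, ContDiff ℝ ∞ fun y => ψ (p, y) := fun p => hψ.comp (contDiff_prodMk_right p)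
  have hψd : ∀ p y, HasFDerivAt (fun y => ψ (p, y)) (∑ j, b j p • fderiv ℝ (G j) y) y :=
    fun p y => HasFDerivAt.fun_sum fun j _ =>
      ((G j).contDiff.differentiable (by simp) y).hasFDerivAt.const_smul (b j p)
  have hψ1 : ∀ p y, 1 ≤ ‖y‖ → ψ (p, y) = y := fun p y hy => by
    simp only [ψ, (G _).eq_of_one_le y hy]
    rw [← Finset.sum_smul, hb1, one_smul]
  have hψoff : ∀ p ∉ Set.range (box (d := m)), ∀ y, ψ (p, y) = y := fun p hp y => by
    have : ∀ j, b j p • G j y = b j p • y := fun j => by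
      by_cases hj : b j p = 0
      · rw [hj, zero_smul, zero_smul]
      · rw [hbid p hp j hj]; rfl
    simp only [ψ, this]
    rw [← Finset.sum_smul, hb1, one_smul]
  have hψbd : ∀ s ∈ Cube.boundary (Fin m), ∀ y, ψ (box s, y) = y := fun s hs y => by
    have hcl : IsClosed {p | ψ (p, y) = y} :=
      isClosed_eq (hψ.continuous.comp (by fun_prop)) continuous_const
    exact hcl.closure_subset_iff.mpr (fun p hp => hψoff p hp y) (box_mem_closure_compl hs)
  have hclose : ∀ s y, ‖(∑ j, b j (box s) • fderiv ℝ (G j) y) - fderiv ℝ (g s) y‖ ≤ (2 * K)⁻¹ := by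
    intro s y
    have h1 : (∑ j, b j (box s) • fderiv ℝ (G j) y) - fderiv ℝ (g s) y
        = ∑ j, b j (box s) • (fderiv ℝ (G j) y - fderiv ℝ (g s) y) := by
      simp only [smul_sub, Finset.sum_sub_distrib]
      rw [← Finset.sum_smul, hb1, one_smul]
    rw [h1]
    refine (norm_sum_le _ _).trans ?_
    calc _ ≤ ∑ j, b j (box s) * (2 * K)⁻¹ := by
          refine Finset.sum_le_sum fun j _ => ?_
          rw [norm_smul, Real.norm_eq_abs, abs_of_nonneg (hb0 j _)]
          by_cases hj : b j (box s) = 0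
          · rw [hj, zero_mul, zero_mul]
          · exact mul_le_mul_of_nonneg_left (hbG s j hj y) (hb0 j _)
      _ = (2 * K)⁻¹ := by rw [← Finset.sum_mul, hb1, one_mul]
  -- the straight-line homotopy stays within the diffeomorphisms
  let h : I × (Fin m → I) → Euc k → Euc k := fun q y =>
    (1 - (q.1 : ℝ)) • g q.2 y + (q.1 : ℝ) • ψ (box q.2, y)
  have hH : ∀ q, ∃ f : DiffDisk k, ∀ y, f y = h q y := by
    rintro ⟨τ, s⟩
    refine (g s).exists_of_fderiv_sub_le (((g s).contDiff.const_smul _).add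
      ((hψp (box s)).const_smul _)) (fun y hy => ?_) hK (hgK s) fun y => ?_
    · change (1 - (τ : ℝ)) • g s y + (τ : ℝ) • ψ (box s, y) = y
      rw [hψ1 _ _ hy, (g s).eq_of_one_le y hy, ← add_smul, sub_add_cancel, one_smul]
    · have hd := (((g s).contDiff.differentiable (by simp) y).hasFDerivAt.const_smul
        (1 - (τ : ℝ))).add ((hψd (box s) y).const_smul (τ : ℝ))
      have hd' : fderiv ℝ (h (τ, s)) y = _ := hd.fderiv
      change ‖fderiv ℝ (h (τ, s)) y - fderiv ℝ (g s) y‖ ≤ _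
      rw [hd']
      have h2 : (1 - (τ : ℝ)) • fderiv ℝ (g s) y + (τ : ℝ) • (∑ j, b j (box s) • fderiv ℝ (G j) y)
          - fderiv ℝ (g s) y
          = (τ : ℝ) • ((∑ j, b j (box s) • fderiv ℝ (G j) y) - fderiv ℝ (g s) y) := by module
      rw [h2, norm_smul, Real.norm_eq_abs, abs_of_nonneg τ.2.1]
      exact (mul_le_of_le_one_left (norm_nonneg _) τ.2.2).trans (hclose s y)
  choose H hH using hH
  have hHc : Continuous H := by
    refine DiffDisk.continuous_of_iteratedFDeriv fun i => ?_
    have hle : ((i : ℕ∞) : WithTop ℕ∞) ≤ ∞ := by exact_mod_cast le_top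
    have heq : (fun q : (I × (Fin m → I)) × Euc k => iteratedFDeriv ℝ i (H q.1) q.2)
        = fun q => (1 - (q.1.1 : ℝ)) • iteratedFDeriv ℝ i (g q.1.2) q.2
          + (q.1.1 : ℝ) • ∑ j, b j (box q.1.2) • iteratedFDeriv ℝ i (G j) q.2 := by
      funext ⟨⟨τ, s⟩, y⟩
      have h1 : (H (τ, s) : Euc k → Euc k) = fun y => (1 - (τ : ℝ)) • g s y
          + (τ : ℝ) • ∑ j, b j (box s) • G j y := funext fun y => hH (τ, s) y
      have hG : ∀ j, ContDiffAt ℝ i (G j) y := fun j => ((G j).contDiff.of_le hle).contDiffAt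
      have hg : ContDiffAt ℝ i (g s) y := ((g s).contDiff.of_le hle).contDiffAt
      have hs : ContDiffAt ℝ i (fun y => ∑ j, b j (box s) • G j y) y :=
        ContDiffAt.sum fun j _ => (hG j).const_smul _
      rw [h1]
      simp only
      rw [fun_iteratedFDeriv_add_apply (hg.const_smul _) (hs.const_smul _),
        iteratedFDeriv_const_smul_apply' hg, iteratedFDeriv_const_smul_apply' hs,
        iteratedFDeriv_fun_sum_apply fun j _ => (hG j).const_smul _]
      congr 2
      exact Finset.sum_congr rfl fun j _ => iteratedFDeriv_const_smul_apply' (hG j)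
    rw [heq]
    have hcg : Continuous fun q : (I × (Fin m → I)) × Euc k =>
        iteratedFDeriv ℝ i (g q.1.2) q.2 :=
      (DiffDisk.continuous_iteratedFDeriv i).comp
        (((map_continuous g).comp (by fun_prop)).prodMk continuous_snd)
    have hcG : ∀ j, Continuous fun q : (I × (Fin m → I)) × Euc k =>
        iteratedFDeriv ℝ i (G j) q.2 := fun j =>
      ((G j).contDiff.continuous_iteratedFDeriv hle).comp continuous_snd
    have hcb : ∀ j, Continuous fun q : (I × (Fin m → I)) × Euc k => b j (box q.1.2) := fun j =>
      (hb j).continuous.comp (continuous_box.comp (by fun_prop))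
    have hct : Continuous fun q : (I × (Fin m → I)) × Euc k => (q.1.1 : ℝ) := by fun_prop
    exact ((continuous_const.sub hct).smul hcg).add
      (hct.smul (continuous_finsetSum _ fun j _ => (hcb j).smul (hcG j)))
  have hHbd : ∀ τ, ∀ s ∈ Cube.boundary (Fin m), H (τ, s) = DiffDisk.id k := fun τ s hs =>
    DiffDisk.ext_fun fun y => by
      rw [hH]
      change (1 - (τ : ℝ)) • g s y + (τ : ℝ) • ψ (box s, y) = y
      rw [hψbd s hs, show g s = DiffDisk.id k from g.2 s hs]
      change (1 - (τ : ℝ)) • y + (τ : ℝ) • y = y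
      rw [← add_smul, sub_add_cancel, one_smul]
  let g' : Ω^ (Fin m) (DiffDisk k) (DiffDisk.id k) :=
    ⟨⟨fun s => H (1, s), hHc.comp (by fun_prop)⟩, fun s hs => hHbd 1 s hs⟩
  refine ⟨g', ψ, Quotient.sound ?_, hψ, fun s y => ?_, hψoff⟩
  · refine ⟨⟨⟨⟨H, hHc⟩, fun s => ?_, fun s => rfl⟩, fun τ s hs => ?_⟩⟩
    · refine DiffDisk.ext_fun fun y => ?_
      change H (0, s) y = g s y
      rw [hH]
      simp [h]
    · change H (τ, s) = g s
      rw [hHbd τ s hs]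
      exact (g.2 s hs).symm
  · change ψ (box s, y) = H (1, s) y
    rw [hH]
    simp [h]

end smoothing

/-! ### The diffeomorphism of the sphere given by a smooth family -/

section fiberwise

variable {m k : ℕ} {g : Ω^ (Fin m) (DiffDisk k) (DiffDisk.id k)} {ψ : Euc m × Euc k → Euc k}

lemma IsSmoothFamily.bijective_fiberwise (h : IsSmoothFamily g ψ) :
    Function.Bijective (fiberwise ψ) := by
  have hl : ∀ z, left m k (fiberwise ψ z) = left m k z := fun z => by
    rw [fiberwise_eq, map_add, left_inRight, add_zero]
  have hr : ∀ z, right m k (fiberwise ψ z) = ψ (left m k z, right m k z) := fun z => by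
    rw [fiberwise_eq, map_add, right_inRight, right_add_displacement]
  constructor
  · intro z z' hz
    refine h.isDisplacement.injective z z' ?_ ?_
    · rw [← hl, hz, hl]
    · rw [right_add_displacement, right_add_displacement, ← hr, hz, hr]
  · intro z
    by_cases hs : left m k z ∈ Set.range (box (d := m))
    · obtain ⟨s, hs⟩ := hs
      obtain ⟨y, hy⟩ : ∃ y, g s y = right m k z := (g s).toDiffeo.surjective _
      refine ⟨z + inRight m k (y - right m k z), ext_left_right ?_ ?_⟩
      · rw [hl]; simp
      · rw [hr]
        simp [← hs, h.on_box, hy]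
    · exact ⟨z, ext_left_right (hl z) (by rw [hr, h.off_box _ hs])⟩

lemma IsSmoothFamily.contDiff_fiberwise (h : IsSmoothFamily g ψ) :
    ContDiff ℝ ∞ (fiberwise ψ) := by
  rw [funext (fiberwise_eq (ψ := ψ))]
  exact contDiff_id.add ((inRight m k).contDiff.comp h.isDisplacement.contDiff)

lemma IsSmoothFamily.fiberwise_eq_self (h : IsSmoothFamily g ψ) {z : Euc (m + k)}
    (hz : (m + 1 : ℝ) < ‖z‖ ^ 2) : fiberwise ψ z = z := by
  rw [fiberwise_eq, h.isDisplacement.eq_zero z hz, map_zero, add_zero]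

lemma IsSmoothFamily.fderiv_fiberwise_injective (h : IsSmoothFamily g ψ) (z : Euc (m + k)) :
    Function.Injective (fderiv ℝ (fiberwise ψ) z) := by
  have hd : HasFDerivAt (fiberwise ψ) (ContinuousLinearMap.id ℝ _ +
      (inRight m k).comp (fderiv ℝ (displacement ψ) z)) z := by
    rw [funext (fiberwise_eq (ψ := ψ))]
    exact (hasFDerivAt_id z).add ((inRight m k).hasFDerivAt.comp z
      (h.isDisplacement.contDiff.differentiable (by simp) z).hasFDerivAt)
  rw [hd.fderiv]
  refine (injective_iff_map_eq_zero _).mpr fun x hx => ?_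
  replace hx : x + inRight m k (fderiv ℝ (displacement ψ) z x) = 0 := hx
  have hxl : left m k x = 0 := by simpa using congrArg (left m k) hx
  have hxr : x = inRight m k (right m k x) :=
    ext_left_right (by rw [hxl, left_inRight]) (by rw [right_inRight])
  have h1 : Matrix.toEuclideanLin (fibJacobian (displacement ψ) z) (right m k x) = 0 := by
    rw [toEuclideanLin_fibJacobian, ← hxr]
    simpa using congrArg (right m k) hx
  have h3 : right m k x = 0 := by
    have hu : IsUnit (fibJacobian (displacement ψ) z).det :=
      isUnit_iff_ne_zero.mpr (h.isDisplacement.det_pos z).ne'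
    have h4 := congrArg (fun y : Euc k => Matrix.toEuclideanLin
      (fibJacobian (displacement ψ) z)⁻¹ y) h1
    simpa [Matrix.toLpLin_apply, Matrix.nonsing_inv_mul _ hu] using h4
  rw [hxr, h3, map_zero]

/-- A smooth bijection of a Euclidean space with injective derivatives has a smooth inverse. -/
lemma exists_contDiff_inverse {d : ℕ} {Φ : Euc d → Euc d} (hΦ : ContDiff ℝ ∞ Φ)
    (hb : Function.Bijective Φ) (hd : ∀ z, Function.Injective (fderiv ℝ Φ z)) :
    ∃ Φ' : Euc d → Euc d, ContDiff ℝ ∞ Φ' ∧ (∀ z, Φ' (Φ z) = z) ∧ ∀ z, Φ (Φ' z) = z := by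
  let T := Equiv.ofBijective Φ hb
  have h1 : ∀ z, T.symm (Φ z) = z := T.symm_apply_apply
  refine ⟨T.symm, contDiff_iff_contDiffAt.mpr fun w => ?_, h1, T.apply_symm_apply⟩
  obtain ⟨z, rfl⟩ := hb.2 w
  obtain ⟨P, hP, hPΦ, hPs⟩ := exists_openPartialHomeomorph_of_fderiv hΦ z
    (LinearEquiv.ofInjectiveEndo (fderiv ℝ Φ z).toLinearMap (hd z)).toContinuousLinearEquiv rfl
  have hz : Φ z ∈ P.target := hPΦ z ▸ P.map_source hP
  refine (hPs.contDiffAt (P.open_target.mem_nhds hz)).congr_of_eventuallyEq ?_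
  filter_upwards [P.open_target.mem_nhds hz] with w hw
  conv_lhs => rw [← P.right_inv hw, hPΦ, h1]

end fiberwise

section sphere

variable {n : ℕ} {Φ Φ' : Euc n → Euc n} {R : ℝ}

/-- The restriction of a homogeneous cone to the unit sphere. -/
def coneSphere (Φ : Euc n → Euc n) (u : Sph n) : Sph n :=
  ⟨coneMap (fun _ => Φ) (u : Euc (n + 1)), by
    rw [mem_sphere_zero_iff_norm, norm_coneMap, norm_sphere]⟩

lemma contMDiff_coneSphere (hΦ : ContDiff ℝ ∞ Φ) (hR : ∀ p, R < ‖p‖ ^ 2 → Φ p = p) :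
    ContMDiff (𝓡 n) (𝓡 n) ∞ (coneSphere Φ) := by
  have : Fact (Module.finrank ℝ (Euc (n + 1)) = n + 1) := ⟨finrank_euclideanSpace_fin⟩
  have h : ContMDiff (𝓡 n) 𝓘(ℝ, Euc (n + 1)) ∞ fun u : Sph n =>
      coneMap (fun _ => Φ) (u : Euc (n + 1)) := fun u => by
    have hu : (u : Euc (n + 1)) ≠ 0 := by
      rw [← norm_ne_zero_iff, norm_sphere]
      exact one_ne_zero
    exact ContMDiffAt.comp u (contDiffAt_coneMap (Ψ := fun _ => Φ) (hΦ.comp contDiff_snd)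
      (fun _ p => hR p) hu).contMDiffAt (contMDiff_coe_sphere u)
  exact h.codRestrict_sphere _

lemma coneSphere_coneSphere (h : ∀ p, Φ' (Φ p) = p) (u : Sph n) :
    coneSphere Φ' (coneSphere Φ u) = u :=
  Subtype.ext ((coneMap_coneMap (Ψ := fun _ => Φ') (Ψ' := fun _ => Φ) (u : Euc (n + 1))).trans
    (coneMap_eq_self (Ψ := fun _ p => Φ' (Φ p)) h))

/-- A compactly supported diffeomorphism of Euclidean space extends to the sphere. -/
lemma exists_isExtension (hΦ : ContDiff ℝ ∞ Φ) (hΦ' : ContDiff ℝ ∞ Φ')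
    (hR : ∀ p, R < ‖p‖ ^ 2 → Φ p = p) (h1 : ∀ p, Φ' (Φ p) = p) (h2 : ∀ p, Φ (Φ' p) = p) :
    ∃ φ : Sph n ≃ₘ^∞⟮𝓡 n, 𝓡 n⟯ Sph n, IsExtension Φ φ := by
  have hR' : ∀ p, R < ‖p‖ ^ 2 → Φ' p = p := fun p hp => by
    conv_lhs => rw [← hR p hp, h1]
  let φ : Sph n ≃ₘ^∞⟮𝓡 n, 𝓡 n⟯ Sph n :=
    { toFun := coneSphere Φ
      invFun := coneSphere Φ'
      left_inv := coneSphere_coneSphere (Φ := Φ) (Φ' := Φ') h1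
      right_inv := coneSphere_coneSphere (Φ := Φ') (Φ' := Φ) h2
      contMDiff_toFun := contMDiff_coneSphere hΦ hR
      contMDiff_invFun := contMDiff_coneSphere hΦ' hR' }
  have hφ : ∀ u, (φ u : Euc (n + 1)) = coneMap (fun _ => Φ) (u : Euc (n + 1)) := fun _ => rfl
  refine ⟨φ, fun p => Subtype.ext ?_, fun u hu => Subtype.ext ?_⟩
  · rw [hφ]
    simpa using coneMap_smul_toSphere (Ψ := fun _ => Φ) one_pos p
  · rw [hφ, coneMap_of_notMem (mt mem_range_toSphere_iff.mpr hu)]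

end sphere

/-! ### The construction of twisted spheres -/

/-- A space which is covered by two open subsets parametrized by Euclidean space, with smooth
transition maps, is a smooth manifold. -/
lemma exists_chartedSpace {d : ℕ} {M : Type} [TopologicalSpace M]
    (c₀ c₁ : OpenPartialHomeomorph (Euc d) M) (h₀ : c₀.source = Set.univ)
    (h₁ : c₁.source = Set.univ) (hcov : ∀ q, q ∈ c₀.target ∨ q ∈ c₁.target)
    (h01 : ContDiffOn ℝ ∞ (c₁.symm ∘ c₀) (c₀ ⁻¹' c₁.target))
    (h10 : ContDiffOn ℝ ∞ (c₀.symm ∘ c₁) (c₁ ⁻¹' c₀.target)) :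
    ∃ (_ : ChartedSpace (Euc d) M) (_ : IsManifold (𝓡 d) ∞ M),
      IsLocalDiffeomorph (𝓡 d) (𝓡 d) ∞ c₀ ∧ IsLocalDiffeomorph (𝓡 d) (𝓡 d) ∞ c₁ := by
  classical
  let charted : ChartedSpace (Euc d) M :=
    { atlas := {c₀.symm, c₁.symm}
      chartAt := fun q => if q ∈ c₀.target then c₀.symm else c₁.symm
      mem_chart_source := fun q => by
        by_cases hq : q ∈ c₀.target
        · rw [if_pos hq]
          exact hq
        · rw [if_neg hq]
          exact (hcov q).resolve_left hq
      chart_mem_atlas := fun q => by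
        by_cases hq : q ∈ c₀.target
        · rw [if_pos hq]
          exact Set.mem_insert _ _
        · rw [if_neg hq]
          exact Set.mem_insert_of_mem _ rfl }
  have hid : ∀ c : OpenPartialHomeomorph (Euc d) M, ∀ s ⊆ c.source,
      ContDiffOn ℝ ∞ (c.symm ∘ c) s := fun c s hs =>
    contDiffOn_id.congr fun x hx => c.left_inv (hs hx)
  have hman : IsManifold (𝓡 d) ∞ M := by
    refine isManifold_of_contDiffOn _ _ _ fun e e' he he' => ?_
    rcases he with rfl | rfl <;> rcases he' with rfl | rfl
    · exact hid c₀ _ fun x _ => h₀ ▸ Set.mem_univ x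
    · exact h01.mono fun x hx => hx.1.2
    · exact h10.mono fun x hx => hx.1.2
    · exact hid c₁ _ fun x _ => h₁ ▸ Set.mem_univ x
  have hloc : ∀ c : OpenPartialHomeomorph (Euc d) M, c.source = Set.univ →
      c.symm ∈ atlas (Euc d) M → IsLocalDiffeomorph (𝓡 d) (𝓡 d) ∞ c := fun c hc ha x => by
    have hm : c.symm ∈ IsManifold.maximalAtlas (𝓡 d) ∞ M := IsManifold.subset_maximalAtlas ha
    exact ⟨{ toPartialEquiv := c.toPartialEquiv
             open_source := c.open_source
             open_target := c.open_target
             contMDiffOn_toFun := contMDiffOn_symm_of_mem_maximalAtlas hm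
             contMDiffOn_invFun := contMDiffOn_of_mem_maximalAtlas hm },
      show x ∈ c.source from hc ▸ Set.mem_univ x, fun _ _ => rfl⟩
  exact ⟨charted, hman, hloc c₀ h₀ (Set.mem_insert _ _),
    hloc c₁ h₁ (Set.mem_insert_of_mem _ rfl)⟩

/-- The inverse stereographic projection as a parametrization of an open subset of the sphere. -/
def sphereParam (d : ℕ) : OpenPartialHomeomorph (Euc d) (Sph d) where
  toFun := toSphere
  invFun u := stereo (u : Euc (d + 1))
  source := Set.univ
  target := {u | (u : Euc (d + 1)) ∈ offPole d}
  map_source' p _ := mem_range_toSphere_iff.mp ⟨p, rfl⟩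
  map_target' _ _ := Set.mem_univ _
  left_inv' p _ := stereo_toSphere p
  right_inv' u hu := by
    obtain ⟨p, rfl⟩ := mem_range_toSphere_iff.mpr hu
    rw [stereo_toSphere]
  open_source := isOpen_univ
  open_target := isOpen_offPole.preimage continuous_subtype_val
  continuousOn_toFun := (contDiff_toSphere.continuous.subtype_mk _).continuousOn
  continuousOn_invFun := fun u hu =>
    (ContinuousAt.comp (g := stereo) (contDiffAt_stereo hu).continuousAt
      continuous_subtype_val.continuousAt).continuousWithinAt

lemma neg_toSphere {d : ℕ} {v : Euc d} (hv : v ≠ 0) :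
    -toSphere v = toSphere (-((‖v‖ ^ 2)⁻¹ • v)) := by
  have hv' := norm_pos_iff.mpr hv
  have hn : ‖-((‖v‖ ^ 2)⁻¹ • v)‖ ^ 2 = (‖v‖ ^ 2)⁻¹ := by
    rw [norm_neg, norm_smul, norm_inv, norm_pow, norm_norm]
    field_simp
  refine Subtype.ext ?_
  ext i
  induction i using Fin.lastCases with
  | last =>
    change -(toSphere v : Euc (d + 1)) (Fin.last d) = _
    rw [toSphere_last, toSphere_last, hn]
    field_simp
    ring
  | cast i =>
    change -(toSphere v : Euc (d + 1)) i.castSucc = _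
    rw [toSphere_castSucc, toSphere_castSucc, hn]
    simp only [PiLp.neg_apply, PiLp.smul_apply, smul_eq_mul]
    field_simp
    ring

lemma toSphere_ne_neg_toSphere_zero {d : ℕ} (v : Euc d) : toSphere v ≠ -toSphere (0 : Euc d) := by
  intro h
  have h1 := mem_offPole_sphere.mp (mem_range_toSphere_iff.mp ⟨v, rfl⟩)
  have h2 : height (-toSphere (0 : Euc d)) = 1 := by
    change -(toSphere (0 : Euc d) : Euc (d + 1)) (Fin.last d) = 1
    rw [toSphere_last]
    simp
  rw [h, h2] at h1
  exact lt_irrefl _ h1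

/-- The coordinate change between the stereographic projections from the two poles is the
inversion. -/
lemma toSphere_eq_neg_toSphere_iff {d : ℕ} {v w : Euc d} :
    toSphere v = -toSphere (-w) ↔ v ≠ 0 ∧ w = (‖v‖ ^ 2)⁻¹ • v := by
  rw [eq_comm, neg_eq_iff_eq_neg, eq_comm]
  constructor
  · intro h
    have hv : v ≠ 0 := by
      rintro rfl
      exact toSphere_ne_neg_toSphere_zero _ h.symm
    rw [neg_toSphere hv] at h
    exact ⟨hv, (neg_injective (toSphere_injective h)).symm⟩
  · rintro ⟨hv, rfl⟩
    exact neg_toSphere hv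

lemma eq_inv_norm_sq_smul {d : ℕ} {v w : Euc d} (h : w = (‖v‖ ^ 2)⁻¹ • v) :
    v = (‖w‖ ^ 2)⁻¹ • w := by
  rcases eq_or_ne v 0 with rfl | hv
  · simp [h]
  · have hv' := norm_pos_iff.mpr hv
    rw [h, norm_smul, norm_inv, norm_pow, norm_norm, smul_smul]
    have : ((((‖v‖ ^ 2)⁻¹ * ‖v‖) ^ 2)⁻¹ * (‖v‖ ^ 2)⁻¹) = 1 := by field_simp
    rw [this, one_smul]

/-- The inverse stereographic projection from the south pole, `w ↦ -toSphere (-w)`, precomposed with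
the inverse of a homeomorphism `C`. Its transition to `sphereParam` is then `v ↦ C (v / |v|²)`. -/
def oppositeParam {d : ℕ} (C : Euc d ≃ₜ Euc d) : OpenPartialHomeomorph (Euc d) (Sph d) :=
  ((C.symm.trans (Homeomorph.neg _)).toOpenPartialHomeomorph.trans
    (sphereParam d)).transHomeomorph (Homeomorph.neg _)

lemma oppositeParam_apply {d : ℕ} (C : Euc d ≃ₜ Euc d) (w : Euc d) :
    oppositeParam C w = -toSphere (-C.symm w) := rfl

lemma oppositeParam_source {d : ℕ} (C : Euc d ≃ₜ Euc d) : (oppositeParam C).source = Set.univ := by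
  simp [oppositeParam, sphereParam]

section

variable {d : ℕ} {C : Euc d ≃ₜ Euc d}

lemma symm_ne_zero (hn : ∀ v, ‖C.symm v‖ = ‖v‖) {v : Euc d} : C.symm v ≠ 0 ↔ v ≠ 0 := by
  rw [← norm_ne_zero_iff, hn, norm_ne_zero_iff]

lemma sphereParam_eq_oppositeParam_iff {v w : Euc d} :
    sphereParam d v = oppositeParam C w ↔ v ≠ 0 ∧ C.symm w = (‖v‖ ^ 2)⁻¹ • v :=
  toSphere_eq_neg_toSphere_iff

lemma sphereParam_eq_oppositeParam_iff' (hn : ∀ v, ‖C.symm v‖ = ‖v‖) {v w : Euc d} :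
    sphereParam d v = oppositeParam C w ↔ w ≠ 0 ∧ v = (‖C.symm w‖ ^ 2)⁻¹ • C.symm w := by
  rw [sphereParam_eq_oppositeParam_iff, ← symm_ne_zero hn (v := w)]
  constructor
  · rintro ⟨hv, h⟩
    refine ⟨?_, eq_inv_norm_sq_smul h⟩
    have := norm_pos_iff.mpr hv
    rwa [h, Ne, smul_eq_zero_iff_right (by positivity)]
  · rintro ⟨hw, h⟩
    refine ⟨?_, eq_inv_norm_sq_smul h⟩
    have := norm_pos_iff.mpr hw
    rwa [h, Ne, smul_eq_zero_iff_right (by positivity)]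

lemma mem_target_sphereParam_or (hn : ∀ v, ‖C.symm v‖ = ‖v‖) (q : Sph d) :
    q ∈ (sphereParam d).target ∨ q ∈ (oppositeParam C).target := by
  by_cases hq : q ∈ (sphereParam d).target
  · exact Or.inl hq
  · right
    -- only the north pole is missed
    have h0 : q = oppositeParam C 0 := by
      have hC : C.symm 0 = 0 := by rw [← norm_eq_zero, hn, norm_zero]
      rw [oppositeParam_apply, hC, neg_zero]
      refine eq_of_notMem_offPole hq fun h => ?_
      obtain ⟨v, hv⟩ := mem_range_toSphere_iff.mpr h
      exact toSphere_ne_neg_toSphere_zero v hv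
    rw [h0]
    exact (oppositeParam C).map_source (oppositeParam_source C ▸ Set.mem_univ _)

lemma contDiffAt_inv_norm_sq_smul {v : Euc d} (hv : v ≠ 0) :
    ContDiffAt ℝ ∞ (fun v : Euc d => (‖v‖ ^ 2)⁻¹ • v) v :=
  ((contDiff_norm_sq ℝ).contDiffAt.inv (pow_ne_zero 2 (norm_ne_zero_iff.mpr hv))).smul contDiffAt_id

lemma contDiffOn_sphereParam_oppositeParam (hC : ∀ v ≠ 0, ContDiffAt ℝ ∞ C v) :
    ContDiffOn ℝ ∞ ((oppositeParam C).symm ∘ sphereParam d)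
      (sphereParam d ⁻¹' (oppositeParam C).target) := by
  have key : ∀ v ∈ sphereParam d ⁻¹' (oppositeParam C).target, v ≠ 0 ∧
      ((oppositeParam C).symm ∘ sphereParam d) v = C ((‖v‖ ^ 2)⁻¹ • v) := fun v hv => by
    obtain ⟨w, hw⟩ : ∃ w, oppositeParam C w = sphereParam d v := ⟨_, (oppositeParam C).right_inv hv⟩
    obtain ⟨hv0, h⟩ := sphereParam_eq_oppositeParam_iff.mp hw.symm
    refine ⟨hv0, ?_⟩
    rw [Function.comp_apply, ← hw,
      (oppositeParam C).left_inv (oppositeParam_source C ▸ Set.mem_univ _), ← h,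
      C.apply_symm_apply]
  refine ContDiffOn.congr (fun v hv => ?_) fun v hv => (key v hv).2
  have hv0 := (key v hv).1
  have := norm_pos_iff.mpr hv0
  refine ((hC _ ?_).comp v (contDiffAt_inv_norm_sq_smul hv0)).contDiffWithinAt
  rwa [Ne, smul_eq_zero_iff_right (by positivity)]

lemma contDiffOn_oppositeParam_sphereParam (hn : ∀ v, ‖C.symm v‖ = ‖v‖)
    (hC : ∀ v ≠ 0, ContDiffAt ℝ ∞ C.symm v) :
    ContDiffOn ℝ ∞ ((sphereParam d).symm ∘ oppositeParam C)
      (oppositeParam C ⁻¹' (sphereParam d).target) := by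
  have key : ∀ w ∈ oppositeParam C ⁻¹' (sphereParam d).target, w ≠ 0 ∧
      ((sphereParam d).symm ∘ oppositeParam C) w = (‖C.symm w‖ ^ 2)⁻¹ • C.symm w := fun w hw => by
    obtain ⟨v, hv⟩ : ∃ v, sphereParam d v = oppositeParam C w := ⟨_, (sphereParam d).right_inv hw⟩
    obtain ⟨hw0, h⟩ := (sphereParam_eq_oppositeParam_iff' hn).mp hv
    refine ⟨hw0, ?_⟩
    rw [Function.comp_apply, ← hv, (sphereParam d).left_inv (Set.mem_univ _), h]
  refine ContDiffOn.congr (fun w hw => ?_) fun w hw => (key w hw).2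
  have hw0 := (key w hw).1
  exact ((contDiffAt_inv_norm_sq_smul ((symm_ne_zero hn).mpr hw0)).comp w
    (hC w hw0)).contDiffWithinAt

end

/-- The cone over a compactly supported diffeomorphism of Euclidean space. -/
def coneHomeomorph {n : ℕ} {Φ Φ' : Euc n → Euc n} {R : ℝ} (hΦ : ContDiff ℝ ∞ Φ)
    (hΦ' : ContDiff ℝ ∞ Φ') (hR : ∀ p, R < ‖p‖ ^ 2 → Φ p = p)
    (hR' : ∀ p, R < ‖p‖ ^ 2 → Φ' p = p) (h1 : ∀ p, Φ' (Φ p) = p) (h2 : ∀ p, Φ (Φ' p) = p) :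
    Euc (n + 1) ≃ₜ Euc (n + 1) where
  toFun := coneMap fun _ => Φ
  invFun := coneMap fun _ => Φ'
  left_inv v := (coneMap_coneMap (Ψ := fun _ => Φ') (Ψ' := fun _ => Φ) v).trans
    (coneMap_eq_self (Ψ := fun _ p => Φ' (Φ p)) h1)
  right_inv v := (coneMap_coneMap (Ψ := fun _ => Φ) (Ψ' := fun _ => Φ') v).trans
    (coneMap_eq_self (Ψ := fun _ p => Φ (Φ' p)) h2)
  continuous_toFun := continuous_coneMap (Ψ := fun _ => Φ) (hΦ.comp contDiff_snd) fun _ p => hR p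
  continuous_invFun := continuous_coneMap (Ψ := fun _ => Φ') (hΦ'.comp contDiff_snd)
    fun _ p => hR' p

/-- In polar coordinates, the cone over a diffeomorphism of the sphere followed by an inversion is
the gluing map of the twisted sphere. -/
lemma ne_zero_and_symm_eq_iff {n : ℕ} {φ : Sph n ≃ₘ^∞⟮𝓡 n, 𝓡 n⟯ Sph n}
    {C : Euc (n + 1) ≃ₜ Euc (n + 1)} (hφ : ∀ u : Sph n, (φ u : Euc (n + 1)) = C u)
    (hC : ∀ t : ℝ, 0 < t → ∀ v, C (t • v) = t • C v) {v w : Euc (n + 1)} :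
    v ≠ 0 ∧ C.symm w = (‖v‖ ^ 2)⁻¹ • v ↔
      ∃ t : ℝ, 0 < t ∧ ∃ u : Sph n, v = t • (u : Euc (n + 1)) ∧ w = t⁻¹ • (φ u : Euc (n + 1)) := by
  constructor
  · rintro ⟨hv, h⟩
    have hv' := norm_pos_iff.mpr hv
    refine ⟨‖v‖, hv', ⟨‖v‖⁻¹ • v, by
      rw [mem_sphere_zero_iff_norm, norm_smul, norm_inv, norm_norm,
        inv_mul_cancel₀ hv'.ne']⟩, (smul_inv_smul₀ hv'.ne' v).symm, ?_⟩
    rw [hφ, ← hC _ (inv_pos.mpr hv'), ← C.symm_apply_eq, h, smul_smul, pow_two, mul_inv]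
  · rintro ⟨t, ht, u, rfl, rfl⟩
    have hn : ‖t • (u : Euc (n + 1))‖ = t := by
      rw [norm_smul, norm_sphere, mul_one, Real.norm_eq_abs, abs_of_pos ht]
    refine ⟨norm_ne_zero_iff.mp (hn.trans_ne ht.ne'), ?_⟩
    rw [hφ, ← hC _ (inv_pos.mpr ht), C.symm_apply_apply, hn, smul_smul]
    congr 1
    field_simp

/-- The two disks glued along a diffeomorphism of the sphere which is supported in the
stereographic coordinates form a homotopy sphere: by the Alexander trick, their union is the
standard sphere with another smooth structure, for which the identification of the second disk with
a hemisphere is precomposed with a cone. -/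
lemma exists_homotopySphere {n : ℕ} {Φ Φ' : Euc n → Euc n} {R : ℝ} (hΦ : ContDiff ℝ ∞ Φ)
    (hΦ' : ContDiff ℝ ∞ Φ') (hR : ∀ p, R < ‖p‖ ^ 2 → Φ p = p) (h1 : ∀ p, Φ' (Φ p) = p)
    (h2 : ∀ p, Φ (Φ' p) = p) {φ : Sph n ≃ₘ^∞⟮𝓡 n, 𝓡 n⟯ Sph n} (hφ : IsExtension Φ φ) :
    ∃ S : HomotopySphere (n + 1), IsTwistedSphere φ S.carrier := by
  have hR' : ∀ p, R < ‖p‖ ^ 2 → Φ' p = p := fun p hp => by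
    conv_lhs => rw [← hR p hp, h1]
  let C := coneHomeomorph hΦ hΦ' hR hR' h1 h2
  have hC : ∀ v ≠ 0, ContDiffAt ℝ ∞ C v := fun v hv =>
    contDiffAt_coneMap (Ψ := fun _ => Φ) (hΦ.comp contDiff_snd) (fun _ p => hR p) hv
  have hC' : ∀ v ≠ 0, ContDiffAt ℝ ∞ C.symm v := fun v hv =>
    contDiffAt_coneMap (Ψ := fun _ => Φ') (hΦ'.comp contDiff_snd) (fun _ p => hR' p) hv
  have hn : ∀ v, ‖C.symm v‖ = ‖v‖ := fun v => norm_coneMap (Ψ := fun _ => Φ') v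
  have hφC : ∀ u : Sph n, (φ u : Euc (n + 1)) = C u := hφ.coe_eq_coneMap
  have hCs : ∀ t : ℝ, 0 < t → ∀ v, C (t • v) = t • C v := fun t ht v => coneMap_smul Φ ht v
  clear_value C
  obtain ⟨charted, hman, hl₀, hl₁⟩ := exists_chartedSpace (sphereParam (n + 1)) (oppositeParam C)
    rfl (oppositeParam_source C) (mem_target_sphereParam_or hn)
    (contDiffOn_sphereParam_oppositeParam hC) (contDiffOn_oppositeParam_sphereParam hn hC')
  refine ⟨@HomotopySphere.mk (n + 1) (Sph (n + 1)) _ charted hman _ _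
    ⟨ContinuousMap.HomotopyEquiv.refl _⟩, sphereParam (n + 1), oppositeParam C, hl₀,
    toSphere_injective, hl₁, fun w w' h => ?_, Set.eq_univ_of_forall fun q => ?_, fun v w => ?_⟩
  · exact (oppositeParam C).injOn (oppositeParam_source C ▸ Set.mem_univ w)
      (oppositeParam_source C ▸ Set.mem_univ w') h
  · exact (mem_target_sphereParam_or hn q).imp
      (fun hq => ⟨_, (sphereParam (n + 1)).right_inv hq⟩)
      fun hq => ⟨_, (oppositeParam C).right_inv hq⟩
  · exact sphereParam_eq_oppositeParam_iff.trans (ne_zero_and_symm_eq_iff hφC hCs)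

/-- Gromoll's map is defined: every class has a smooth representative, and the corresponding
twisted sphere exists. -/
theorem exists_representsGromoll {m k : ℕ}
    (x : HomotopyGroup.Pi m (DiffDisk k) (DiffDisk.id k)) :
    ∃ S : HomotopySphere (m + k + 1), RepresentsGromoll x S := by
  obtain ⟨g, ψ, hx, hψ⟩ := exists_smooth_representative x
  obtain ⟨Φ', hΦ', h1, h2⟩ := exists_contDiff_inverse hψ.contDiff_fiberwise
    hψ.bijective_fiberwise hψ.fderiv_fiberwise_injective
  obtain ⟨φ, hφ⟩ := exists_isExtension hψ.contDiff_fiberwise hΦ'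
    (fun _ => hψ.fiberwise_eq_self) h1 h2
  obtain ⟨S, hS⟩ := exists_homotopySphere hψ.contDiff_fiberwise hΦ'
    (fun _ => hψ.fiberwise_eq_self) h1 h2 hφ
  exact ⟨S, g, ψ, φ, hx, hψ, hφ, hS⟩

end DerivMap

end

theorem lemma2p1 (m k : ℕ) (hk : 1 ≤ k)
    (x : HomotopyGroup.Pi m (DiffDisk k) (DiffDisk.id k)) :
    (∃ S : HomotopySphere (m + k + 1), RepresentsGromoll x S) ∧
    ∀ S : HomotopySphere (m + k + 1), RepresentsGromoll x S →
      ∃ e : S.carrier → Euc (m + k + k + 1),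
        Manifold.IsSmoothEmbedding (𝓡 (m + k + 1)) (𝓡 (m + k + k + 1)) ∞ e ∧
        IsClassifiedUpToSign (normalSpace (d := m + k + 1) e) (derivStar x) := by
  exact ⟨exists_representsGromoll x, fun _ hS => hS.exists_embedding hk⟩
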